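/- Let $n\ge 1$, $\sigma>-1$, $H=\{y\in\mathbb R^n: y_n>0\}$, $\overline H=\{y\in\mathbb R^n:y_n\ge 0\}$, and let $I=(s_1,s_2)$ with $-\infty\le s_1<s_2\le\infty$. For $\tau>-1$ put $d\mu_\tau=y_n^\tau\,dy$ on $H$ and $L^2_\tau=L^2(H,\mu_\tau)$. Write $[s_1,s_2)$ for $I$ together with its left end point if that is finite, and $C_c^\infty([s_1,s_2)\times\overline H)$ for the functions on $[s_1,s_2)\times\overline H$ whose support is a compact subset of this set and which extend to $C_c^\infty(\mathbb R\times\mathbb R^n)$. Spatial derivatives are distributional on $H$, and the time derivative is distributional on $I$. Given $f\in L^1_{loc}([s_1,s_2);L^2_\sigma)$ and $u_0\in L^2_\sigma$ (with $u_0=0$ required if $s_1=-\infty$), $u$ is a *$\sigma$-solution to $f$ on $I\times\overline H$ with initial value $u_0$* if $u\in L^2_{loc}([s_1,s_2);L^2_\sigma)$, $\nabla_y u\in L^2(I;L^2_{1+\sigma})$ and $$-\int_I (u,\partial_s\varphi)_{L^2_\sigma}\,ds+\int_I(\nabla_y u,\nabla_y\varphi)_{L^2_{1+\sigma}}\,ds=\int_I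 (f,\varphi)_{L^2_\sigma}\,ds+(u_0,\varphi(s_1))_{L^2_\sigma}$$ for all $\varphi\in C_c^\infty([s_1,s_2)\times\overline H)$, where the last term is absent if $s_1=-\infty$. **Proposition.** There is a constant $c=c(n,\sigma)>0$ such that for every such interval $I$, every $f\in L^2(I;L^2_\sigma)$ and every $\sigma$-solution $u$ to $f$ on $I\times\overline H$ with zero initial value the following hold. 1. $u$ has a representative that is continuous from the closure of $I$ in $\mathbb R$ into $L^2_\sigma$. For this representative, $\nabla_y u(s)\in L^2_{1+\sigma}$ for every $s$ in this closure, and $s\mapsto\|\nabla_y u(s)\|_{L^2_{1+\sigma}}$ is bounded and continuous on $\overline I=[s_1,s_2]$, with value $0$ at $s_1$; here values at infinite end points are understood as limits (which exist). 2. $\partial_s u\in L^2(I;L^2_\sigma)$, $\nabla_y u\in L^2(I;L^2_\sigma)$, $D_y^2u\in L^2(I;L^2_{2+\sigma})$, and $$\int_I\|\partial_s u\|_{L^2_\sigma}^2\,ds+\int_I\|\nabla_y u\|_{L^2_\sigma}^2\,ds+\int_I\|D_y^2u\|_{L^2_{2+\sigma}}^2\,ds\le c\int_I\|f\|_{L^2_\sigma}^2\,ds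 .$$ -/

import Mathlib

open MeasureTheory Set Filter Topology
open scoped ContDiff ENNReal

noncomputable section

namespace HalfSpace

/-- Euclidean space `ℝⁿ` with `n = d + 1 ≥ 1`. -/
abbrev E (d : ℕ) : Type := EuclideanSpace ℝ (Fin (d + 1))

/-- The open upper half space `H = {y ∈ ℝⁿ | y_n > 0}`. -/
def openHalf (d : ℕ) : Set (E d) := {y | 0 < y (Fin.last d)}

/-- The closed upper half space. -/
def closedHalf (d : ℕ) : Set (E d) := {y | 0 ≤ y (Fin.last d)}

/-- The weighted measure `dμ_σ = y_n ^ σ dy` on `H`. -/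
def mu (d : ℕ) (σ : ℝ) : Measure (E d) :=
  (volume.restrict (openHalf d)).withDensity fun y => ENNReal.ofReal (y (Fin.last d) ^ σ)

/-- `L²_σ(H)`, real-valued. -/
abbrev L2 (d : ℕ) (σ : ℝ) : Type := Lp ℝ 2 (mu d σ)

/-- `L²_σ(H)` for vector fields; the norm is that of `|G| = (∑ᵢ Gᵢ²)^(1/2)`. -/
abbrev L2Vec (d : ℕ) (σ : ℝ) : Type := Lp (E d) 2 (mu d σ)

/-- `L²_σ(H)` for matrix fields; the norm is that of `|D| = (∑ᵢⱼ Dᵢⱼ²)^(1/2)`. -/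
abbrev L2Mat (d : ℕ) (σ : ℝ) : Type :=
  Lp (EuclideanSpace ℝ (Fin (d + 1) × Fin (d + 1))) 2 (mu d σ)

/-- The classical partial derivative `∂ᵢ φ`. -/
def pd {d : ℕ} (i : Fin (d + 1)) (φ : E d → ℝ) (y : E d) : ℝ :=
  fderiv ℝ φ y (EuclideanSpace.single i 1)

/-- `φ ∈ C_c^∞(H)`. -/
def IsTestOnHalf {d : ℕ} (φ : E d → ℝ) : Prop :=
  ContDiff ℝ ∞ φ ∧ HasCompactSupport φ ∧ tsupport φ ⊆ openHalf d

/-- `G = ∇v` on `H` in the sense of distributions. -/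
def HasWeakGradient {d : ℕ} (v : E d → ℝ) (G : E d → E d) : Prop :=
  LocallyIntegrableOn v (openHalf d) ∧ LocallyIntegrableOn G (openHalf d) ∧
    ∀ φ : E d → ℝ, IsTestOnHalf φ → ∀ i,
      ∫ y in openHalf d, v y * pd i φ y = - ∫ y in openHalf d, G y i * φ y

/-- `D = D²v` on `H` in the sense of distributions. -/
def HasWeakHessian {d : ℕ} (v : E d → ℝ)
    (D : E d → EuclideanSpace ℝ (Fin (d + 1) × Fin (d + 1))) : Prop :=
  LocallyIntegrableOn v (openHalf d) ∧ LocallyIntegrableOn D (openHalf d) ∧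
    ∀ φ : E d → ℝ, IsTestOnHalf φ → ∀ i j,
      ∫ y in openHalf d, v y * pd i (pd j φ) y = ∫ y in openHalf d, D y (i, j) * φ y

/-- The time interval `I = (s₁, s₂) ⊆ ℝ`, where `s₁ = -∞` and `s₂ = ∞` are allowed. -/
def timeI (s₁ s₂ : EReal) : Set ℝ := {s | s₁ < (s : EReal) ∧ (s : EReal) < s₂}

/-- The interval `I` together with its left end point, if that is finite. -/
def timeIleft (s₁ s₂ : EReal) : Set ℝ := {s | s₁ ≤ (s : EReal) ∧ (s : EReal) < s₂}

/-- The closure of `I` in `ℝ`, if `s₁ < s₂`. -/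
def timeIclosed (s₁ s₂ : EReal) : Set ℝ := {s | s₁ ≤ (s : EReal) ∧ (s : EReal) ≤ s₂}

/-- `φ` is an extension in `C_c^∞(ℝ × ℝⁿ)` of an element of `C_c^∞(Q)`, for a set
`Q ⊆ ℝ × ℝⁿ` that need not be open: the support of `φ|_Q` is a compact subset of `Q`. -/
def IsTestOn {d : ℕ} (Q : Set (ℝ × E d)) (φ : ℝ × E d → ℝ) : Prop :=
  ContDiff ℝ ∞ φ ∧ HasCompactSupport φ ∧
    ∃ K ⊆ Q, IsCompact K ∧ ∀ x ∈ Q, x ∉ K → φ x = 0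

/-- `V = ∂ₛ u` on the open interval `I` in the sense of vector-valued distributions. -/
def HasWeakTimeDeriv {d : ℕ} {σ : ℝ} (s₁ s₂ : EReal) (u V : ℝ → L2 d σ) : Prop :=
  LocallyIntegrableOn u (timeI s₁ s₂) ∧ LocallyIntegrableOn V (timeI s₁ s₂) ∧
    ∀ ψ : ℝ → ℝ, ContDiff ℝ ∞ ψ → HasCompactSupport ψ → tsupport ψ ⊆ timeI s₁ s₂ →
      ∫ s in timeI s₁ s₂, deriv ψ s • u s = - ∫ s in timeI s₁ s₂, ψ s • V s

/-- `u` is a `σ`-solution of `∂ₛ u - y_n Δ u - (1 + σ) ∂_n u = f` on `I` times the closed upper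
half space with initial value `u₀`.  For `s₁ = -∞` only `u₀ = 0` is allowed, and then the last
summand of the equation is zero. The term `∇u · ∇φ` is written as the derivative of `φ(s, ·)`
in the direction `∇u`. -/
def IsSigmaSolution {d : ℕ} {σ : ℝ} (s₁ s₂ : EReal) (f u : ℝ → L2 d σ) (u₀ : L2 d σ) : Prop :=
  (∀ K ⊆ timeIleft s₁ s₂, IsCompact K → IntegrableOn f K) ∧
  (∀ K ⊆ timeIleft s₁ s₂, IsCompact K → MemLp u 2 (volume.restrict K)) ∧
  (s₁ = ⊥ → u₀ = 0) ∧
  ∃ G : ℝ → L2Vec d (1 + σ),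
    MemLp G 2 (volume.restrict (timeI s₁ s₂)) ∧
    (∀ᵐ s ∂(volume.restrict (timeI s₁ s₂)), HasWeakGradient (u s) (G s)) ∧
    ∀ φ : ℝ × E d → ℝ, IsTestOn (timeIleft s₁ s₂ ×ˢ closedHalf d) φ →
      - (∫ s in timeI s₁ s₂, ∫ y, u s y * deriv (fun τ => φ (τ, y)) s ∂(mu d σ))
        + (∫ s in timeI s₁ s₂,
            ∫ y, fderiv ℝ (fun z => φ (s, z)) y (G s y) ∂(mu d (1 + σ)))
      = (∫ s in timeI s₁ s₂, ∫ y, f s y * φ (s, y) ∂(mu d σ))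
        + ∫ y, u₀ y * φ (s₁.toReal, y) ∂(mu d σ)

end HalfSpace

end

open HalfSpace

/-! The estimate splits into an energy argument in time and an elliptic estimate in space.

In time, `u` is extended by zero to all times before `s₂`; because the initial value is zero, no
source appears at `s₁`. The extension solves `∂ₛ u + A u = f` weakly, where `(A u, ζ) = (∇u, ∇ζ)`
with weight exponent `1 + σ`. Averaging over the past with a smooth kernel keeps the equation and
makes the time derivative an admissible test function. Testing with it gives `2 ‖∂ₛ u‖² + d/ds ‖∇u‖²
= 2 (f, ∂ₛ u) ≤ ‖f‖² + ‖∂ₛ u‖²`, which bounds both `∫ ‖∂ₛ u‖²` and `sup ‖∇u‖²` by `∫ ‖f‖²`. The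
bound is linear in the kernel. Applied to differences of kernels it makes the averages Cauchy,
uniformly in time for the gradients, and the continuous representatives are the limits. This is
`IsWeakEvolution.maximal_regularity`; it uses only that the graph of the gradient is closed and that
the test functions are dense in it.

In space, almost every `v = u(s)` solves `-y_n Δv - (1 + σ) ∂_n v = g` weakly with `g = f - ∂ₛ u`.
The crucial gain is that `∇v` lies in the space with exponent `σ` instead of `1 + σ`. It comes from
testing with `v(y + h e_n) - v(y)`: translating the weight `y_n^(1+σ)` by `h` loses exactly `1 + σ`
times the weight `slab`, which is of size `h y_n^σ` away from the boundary, and the difference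
itself is bounded by the same weight. Absorbing, dividing by `h` and letting `h → 0` gives
`IsWeakElliptic.lintegral_grad_le`. The equation then puts `Δv` into the space with exponent `2 +
σ`. For smooth functions the Hessian is bounded by the Laplacian and the gradient through
integration by parts (`integral_hess_le`), and the density theorem `exists_smooth_approx` carries
this to `v`. The smoothing there looks only upwards, so it never leaves the half space and works up
to the boundary.

Finally, gradient and Hessian depend linearly and boundedly on `(u, ∇u, f - ∂ₛ u)`. This makes them
measurable in time, and the pointwise elliptic bounds can be integrated. -/

/-! ### Averages against a rescaled smooth kernel -/

section Averages

set_option linter.unusedSectionVars false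

variable {A : Type*} [NormedAddCommGroup A] [NormedSpace ℝ A] [FiniteDimensional ℝ A]
  [MeasureSpace A] [BorelSpace A] [(volume : Measure A).IsAddHaarMeasure]
  {B : Type*} [NormedAddCommGroup B] [NormedSpace ℝ B]

/-- A nonnegative smooth kernel with compact support and integral one. -/
structure IsMollifier (κ : A → ℝ) : Prop where
  contDiff : ContDiff ℝ ∞ κ
  hasCompactSupport : HasCompactSupport κ
  nonneg : ∀ x, 0 ≤ κ x
  integral_eq : ∫ x, κ x = 1

/-- The average of the values `F (y - ε t)` with weight `κ t`. -/
noncomputable def avg (κ : A → ℝ) (ε : ℝ) (F : A → B) (y : A) : B := ∫ t, κ t • F (y - ε • t)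

/-- The kernel `κ`, rescaled to length `ε`. -/
noncomputable def dil (κ : A → ℝ) (ε : ℝ) (x : A) : ℝ :=
  (ε ^ Module.finrank ℝ A)⁻¹ * κ (ε⁻¹ • x)

lemma contDiff_dil {κ : A → ℝ} (hκ : ContDiff ℝ ∞ κ) (ε : ℝ) : ContDiff ℝ ∞ (dil κ ε) :=
  contDiff_const.mul (hκ.comp (contDiff_const_smul _))

lemma hasCompactSupport_dil {κ : A → ℝ} (hκ : HasCompactSupport κ) {ε : ℝ} (hε : 0 < ε) :
    HasCompactSupport (dil κ ε) := by
  have h : HasCompactSupport fun x : A => κ (ε⁻¹ • x) :=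
    hκ.comp_homeomorph (Homeomorph.smulOfNeZero ε⁻¹ (inv_ne_zero hε.ne'))
  exact h.mul_left

/-- Averages are suited to Jensen's inequality and to uniformity in `ε`, convolutions to
differentiation; this is the passage between them. -/
lemma avg_eq_convolution (κ : A → ℝ) {ε : ℝ} (hε : 0 < ε) (F : A → B) (y : A) :
    avg κ ε F y = ∫ x, dil κ ε x • F (y - x) := by
  have h := Measure.integral_comp_smul (volume : Measure A)
    (fun x => κ (ε⁻¹ • x) • F (y - x)) ε
  simp only [inv_smul_smul₀ hε.ne'] at h
  rw [avg, h, abs_of_pos (by positivity), ← integral_smul]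
  simp only [dil, smul_smul]

lemma IsMollifier.lintegral_eq {κ : A → ℝ} (hκ : IsMollifier κ) :
    ∫⁻ t, ENNReal.ofReal (κ t) = 1 := by
  rw [← ofReal_integral_eq_lintegral_ofReal
    (hκ.contDiff.continuous.integrable_of_hasCompactSupport hκ.hasCompactSupport)
    (ae_of_all _ hκ.nonneg), hκ.integral_eq, ENNReal.ofReal_one]

lemma eLpNorm_two_sq {α : Type*} [MeasurableSpace α] {C : Type*} [NormedAddCommGroup C]
    (μ : Measure α) (F : α → C) : eLpNorm F 2 μ ^ 2 = ∫⁻ x, ‖F x‖ₑ ^ 2 ∂μ := by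
  have := eLpNorm_nnreal_pow_eq_lintegral (f := F) (μ := μ) (p := 2) (by norm_num)
  simpa using this

/-- Jensen's inequality for squares of averages. -/
lemma IsMollifier.sq_lintegral_le {κ : A → ℝ} (hκ : IsMollifier κ) {h : A → ℝ≥0∞}
    (hh : Measurable h) :
    (∫⁻ t, ENNReal.ofReal (κ t) * h t) ^ 2 ≤ ∫⁻ t, ENNReal.ofReal (κ t) * h t ^ 2 := by
  have hm : Measurable fun t => ENNReal.ofReal (κ t) :=
    hκ.contDiff.continuous.measurable.ennreal_ofReal
  -- Cauchy-Schwarz with `κ` split into two square roots; the first factor has `L²` norm one because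
  -- `κ` has integral one.
  have key := ENNReal.lintegral_mul_le_Lp_mul_Lq (μ := (volume : Measure A))
    Real.HolderConjugate.two_two
    (f := fun t => ENNReal.ofReal (κ t) ^ (1 / 2 : ℝ))
    (g := fun t => ENNReal.ofReal (κ t) ^ (1 / 2 : ℝ) * h t)
    (hm.pow_const _).aemeasurable ((hm.pow_const _).mul hh).aemeasurable
  have h1 : ∀ t, (ENNReal.ofReal (κ t) ^ (1 / 2 : ℝ)) ^ (2 : ℝ) = ENNReal.ofReal (κ t) := by
    intro t; rw [← ENNReal.rpow_mul]; norm_num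
  have h2 : ∀ t, ENNReal.ofReal (κ t) ^ (1 / 2 : ℝ) * ENNReal.ofReal (κ t) ^ (1 / 2 : ℝ)
      = ENNReal.ofReal (κ t) := by
    intro t; rw [← ENNReal.rpow_add_of_nonneg _ _ (by norm_num) (by norm_num)]; norm_num
  simp only [Pi.mul_apply, ← mul_assoc, h2, ENNReal.mul_rpow_of_nonneg _ _ (zero_le_two (α := ℝ)),
    h1, hκ.lintegral_eq, ENNReal.one_rpow, one_mul] at key
  calc _ ≤ _ := pow_le_pow_left' key 2
    _ = _ := by
      rw [← ENNReal.rpow_natCast, ← ENNReal.rpow_mul]; norm_num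

/-- The measure `μ` is controlled by its averages over the translations by `ε t`. -/
def AvgBound (κ : A → ℝ) (ε : ℝ) (μ : Measure A) (C : ℝ≥0∞) : Prop :=
  ∀ h : A → ℝ≥0∞, Measurable h →
    ∫⁻ y, (∫⁻ t, ENNReal.ofReal (κ t) * h (y - ε • t)) ∂μ ≤ C ^ 2 * ∫⁻ y, h y ∂μ

variable {κ : A → ℝ} {ε : ℝ} {μ : Measure A} {C : ℝ≥0∞}

lemma lintegral_sq_avg_enorm_le (hκ : IsMollifier κ) (hC : AvgBound κ ε μ C) {F : A → B}
    (hF : StronglyMeasurable F) :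
    ∫⁻ y, (∫⁻ t, ENNReal.ofReal (κ t) * ‖F (y - ε • t)‖ₑ) ^ 2 ∂μ
      ≤ C ^ 2 * ∫⁻ y, ‖F y‖ₑ ^ 2 ∂μ := by
  refine le_trans (lintegral_mono (g := fun y => ∫⁻ t, ENNReal.ofReal (κ t) * ‖F (y - ε • t)‖ₑ ^ 2)
    fun y => ?_) (hC (fun y => ‖F y‖ₑ ^ 2) (hF.enorm.pow_const 2))
  exact hκ.sq_lintegral_le (h := fun t => ‖F (y - ε • t)‖ₑ) (by
    have := hF.enorm
    fun_prop)

lemma IsMollifier.enorm_smul (hκ : IsMollifier κ) (t : A) (b : B) :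
    ‖κ t • b‖ₑ = ENNReal.ofReal (κ t) * ‖b‖ₑ := by
  rw [_root_.enorm_smul, ← ofReal_norm, Real.norm_of_nonneg (hκ.nonneg t)]

/-- The constant in `AvgBound` is squared so that `C` itself bounds the averaging operator on `L²`.
-/
lemma eLpNorm_avg_le (hκ : IsMollifier κ) (hC : AvgBound κ ε μ C) {F : A → B}
    (hF : StronglyMeasurable F) : eLpNorm (avg κ ε F) 2 μ ≤ C * eLpNorm F 2 μ := by
  have : eLpNorm (avg κ ε F) 2 μ ^ 2 ≤ (C * eLpNorm F 2 μ) ^ 2 := by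
    rw [mul_pow, eLpNorm_two_sq, eLpNorm_two_sq]
    refine le_trans (lintegral_mono fun y => ?_) (lintegral_sq_avg_enorm_le hκ hC hF)
    gcongr
    refine (enorm_integral_le_lintegral_enorm _).trans (le_of_eq ?_)
    simp only [hκ.enorm_smul]
  exact (ENNReal.pow_le_pow_left_iff two_ne_zero).1 this

/-- Needed for linearity: `avg` takes the value zero where its integral diverges, so it is additive
only at points of convergence. -/
lemma ae_integrable_avg (hκ : IsMollifier κ) (hC : AvgBound κ ε μ C) (hC' : C ≠ ⊤) {F : A → B}
    (hF : StronglyMeasurable F) (hF2 : MemLp F 2 μ) [SFinite μ] :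
    ∀ᵐ y ∂μ, Integrable (fun t => κ t • F (y - ε • t)) := by
  have hfin : C ^ 2 * ∫⁻ y, ‖F y‖ₑ ^ 2 ∂μ < ⊤ := by
    rw [← eLpNorm_two_sq, ← mul_pow]
    exact ENNReal.pow_lt_top (ENNReal.mul_lt_top hC'.lt_top hF2.2)
  have hm : Measurable fun y => ∫⁻ t, ENNReal.ofReal (κ t) * ‖F (y - ε • t)‖ₑ := by
    apply Measurable.lintegral_prod_right
    have := hF.enorm
    have := hκ.contDiff.continuous.measurable
    fun_prop
  have := ae_lt_top (hm.pow_const 2) ((lintegral_sq_avg_enorm_le hκ hC hF).trans_lt hfin).ne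
  filter_upwards [this] with y hy
  have hy' : (∫⁻ t, ENNReal.ofReal (κ t) * ‖F (y - ε • t)‖ₑ) < ⊤ := by
    by_contra h
    rw [not_lt, top_le_iff] at h
    simp [h] at hy
  refine ⟨(hκ.contDiff.continuous.stronglyMeasurable.smul
    (hF.comp_measurable (by fun_prop))).aestronglyMeasurable, ?_⟩
  rw [hasFiniteIntegral_iff_enorm]
  simpa only [hκ.enorm_smul] using hy'

lemma dist_avg_le (hκ : IsMollifier κ) [CompleteSpace B] {g : A → B} {y : A} {δ : ℝ}
    (hi : Integrable (fun t => κ t • g (y - ε • t)))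
    (hg : ∀ t ∈ tsupport κ, ‖g (y - ε • t) - g y‖ ≤ δ) : ‖avg κ ε g y - g y‖ ≤ δ := by
  have hκi : Integrable κ :=
    hκ.contDiff.continuous.integrable_of_hasCompactSupport hκ.hasCompactSupport
  have h1 : avg κ ε g y - g y = ∫ t, κ t • (g (y - ε • t) - g y) := by
    have : g y = ∫ t, κ t • g y := by rw [integral_smul_const, hκ.integral_eq, one_smul]
    conv_lhs => rw [this]
    rw [avg, ← integral_sub hi (hκi.smul_const _)]
    simp only [smul_sub]
  rw [h1]
  calc _ ≤ ∫ t, κ t * δ := by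
        refine norm_integral_le_of_norm_le (hκi.mul_const _) (ae_of_all _ fun t => ?_)
        rw [norm_smul, Real.norm_of_nonneg (hκ.nonneg t)]
        by_cases ht : t ∈ tsupport κ
        · exact mul_le_mul_of_nonneg_left (hg t ht) (hκ.nonneg t)
        · simp [image_eq_zero_of_notMem_tsupport ht]
    _ = δ := by rw [integral_mul_const, hκ.integral_eq, one_mul]

/-- The averages of a continuous function with compact support converge in `L²`. -/
lemma tendsto_avg_of_continuous (hκ : IsMollifier κ) [CompleteSpace B] [IsLocallyFiniteMeasure μ]
    {e : ℕ → ℝ} (he0 : Tendsto e atTop (𝓝 0)) {g : A → B} (hg : Continuous g)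
    (hgc : HasCompactSupport g) :
    Tendsto (fun k => eLpNorm (avg κ (e k) g - g) 2 μ) atTop (𝓝 0) := by
  obtain ⟨R, hR⟩ := hgc.isCompact.isBounded.subset_closedBall 0
  obtain ⟨S, hS⟩ := hκ.hasCompactSupport.isCompact.isBounded.subset_closedBall 0
  -- For `|e k| ≤ 1` the averages of `g` are supported in this ball; `|S|` spares a discussion of
  -- the sign of `S`.
  have hfin : μ (Metric.closedBall 0 (R + |S|)) ≠ ⊤ :=
    (isCompact_closedBall _ _).measure_ne_top
  have huc := hgc.uniformContinuous_of_continuous hg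
  rw [ENNReal.tendsto_atTop_zero]
  intro η hη
  set M := μ (Metric.closedBall (0 : A) (R + |S|)) ^ (1 / 2 : ℝ) with hM
  have hMfin : M ≠ ⊤ := ENNReal.rpow_ne_top_of_nonneg (by norm_num) hfin
  obtain ⟨δ, hδ0, hδ⟩ : ∃ δ : ℝ, 0 < δ ∧ ENNReal.ofReal δ * M ≤ η := by
    by_cases hη' : η = ⊤
    · exact ⟨1, one_pos, by simp [hη']⟩
    · refine ⟨(η / (M + 1)).toReal, ENNReal.toReal_pos ?_ ?_, ?_⟩
      · exact (ENNReal.div_pos hη.ne' (by simp [hMfin])).ne'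
      · exact ENNReal.div_ne_top hη' (by simp)
      · rw [ENNReal.ofReal_toReal (ENNReal.div_ne_top hη' (by simp))]
        calc _ ≤ η / (M + 1) * (M + 1) := by gcongr; exact le_self_add
          _ ≤ η := (ENNReal.div_mul_cancel (by simp) (by simp [hMfin])).le
  obtain ⟨r, hr0, hr⟩ := Metric.uniformContinuous_iff.1 huc δ hδ0
  have hev : ∀ᶠ k in atTop, |e k| < min 1 (r / (|S| + 1)) := by
    have := he0.abs
    rw [abs_zero] at this
    exact this.eventually_lt_const (by positivity)
  obtain ⟨N, hN⟩ := eventually_atTop.1 hev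
  refine ⟨N, fun k hk => ?_⟩
  have hk1 := (lt_min_iff.1 (hN k hk)).1
  have hk2 := (lt_min_iff.1 (hN k hk)).2
  have hsmall : ∀ t ∈ tsupport κ, ‖e k • t‖ ≤ |e k| * |S| := by
    intro t ht
    have := hS ht
    rw [mem_closedBall_zero_iff] at this
    rw [norm_smul, Real.norm_eq_abs]
    gcongr
    exact this.trans (le_abs_self S)
  have hpt : ∀ y, ‖avg κ (e k) g y - g y‖ ≤ δ := by
    intro y
    refine dist_avg_le hκ ?_ fun t ht => ?_
    · refine Continuous.integrable_of_hasCompactSupport ?_ hκ.hasCompactSupport.smul_right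
      have := hκ.contDiff.continuous
      fun_prop
    · rw [← dist_eq_norm]
      refine (hr ?_).le
      rw [dist_eq_norm, sub_sub_cancel_left, norm_neg]
      calc _ ≤ |e k| * |S| := hsmall t ht
        _ ≤ |e k| * (|S| + 1) := by gcongr; linarith
        _ < r := by rwa [lt_div_iff₀ (by positivity)] at hk2
  have hsupp : ∀ y, y ∉ Metric.closedBall (0 : A) (R + |S|) → (avg κ (e k) g - g) y = 0 := by
    intro y hy
    rw [mem_closedBall_zero_iff, not_le] at hy
    have hz : ∀ z, R < ‖z‖ → g z = 0 := fun z hz => image_eq_zero_of_notMem_tsupport fun h => by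
      have := hR h
      rw [mem_closedBall_zero_iff] at this
      linarith
    have h1 : avg κ (e k) g y = 0 := by
      rw [avg, ← integral_zero A B]
      congr 1
      ext t
      by_cases ht : t ∈ tsupport κ
      · rw [hz, smul_zero]
        have h2 := hsmall t ht
        have h3 := norm_sub_norm_le y (e k • t)
        have : |e k| * |S| ≤ 1 * |S| := by gcongr
        linarith
      · rw [image_eq_zero_of_notMem_tsupport ht, zero_smul]
    rw [Pi.sub_apply, h1, hz y (by linarith [abs_nonneg S]), sub_zero]
  have hind : avg κ (e k) g - g
      = (Metric.closedBall (0 : A) (R + |S|)).indicator (avg κ (e k) g - g) := by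
    rw [eq_comm, indicator_eq_self]
    intro y hy
    by_contra h
    exact hy (hsupp y h)
  have hle : ∀ y, ‖(avg κ (e k) g - g) y‖
      ≤ ‖(Metric.closedBall (0 : A) (R + |S|)).indicator (fun _ => δ) y‖ := by
    intro y
    by_cases hy : y ∈ Metric.closedBall (0 : A) (R + |S|)
    · rw [indicator_of_mem hy, Real.norm_of_nonneg hδ0.le]
      exact hpt y
    · rw [hsupp y hy, indicator_of_notMem hy]; simp
  calc _ ≤ _ := eLpNorm_mono hle
    _ ≤ ‖δ‖ₑ * μ (Metric.closedBall (0 : A) (R + |S|)) ^ (1 / (2 : ℝ≥0∞).toReal) :=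
        eLpNorm_indicator_const_le _ _
    _ ≤ η := by
      rw [← ofReal_norm, Real.norm_of_nonneg hδ0.le]
      simpa [hM] using hδ

/-- The averages of an `L²` function converge in `L²`. -/
lemma tendsto_avg (hκ : IsMollifier κ) [CompleteSpace B] [SecondCountableTopology A]
    [IsLocallyFiniteMeasure μ] (hC' : C ≠ ⊤) {e : ℕ → ℝ} (hC : ∀ k, AvgBound κ (e k) μ C)
    (he0 : Tendsto e atTop (𝓝 0)) {F : A → B} (hF : StronglyMeasurable F) (hF2 : MemLp F 2 μ) :
    Tendsto (fun k => eLpNorm (avg κ (e k) F - F) 2 μ) atTop (𝓝 0) := by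
  rw [ENNReal.tendsto_atTop_zero]
  intro η hη
  obtain ⟨δ, hδ0, hδ⟩ : ∃ δ : ℝ≥0∞, 0 < δ ∧ C * δ + δ + δ ≤ η := by
    by_cases hη' : η = ⊤
    · exact ⟨1, one_pos, by simp [hη']⟩
    · refine ⟨η / (C + 1 + 1), ENNReal.div_pos hη.ne' (by simp [hC']), ?_⟩
      calc _ = η / (C + 1 + 1) * (C + 1 + 1) := by ring
        _ ≤ η := (ENNReal.div_mul_cancel (by simp) (by simp [hC'])).le
  have : ProperSpace A := FiniteDimensional.proper ℝ A
  obtain ⟨g, hgc, hgF, hg, hg2⟩ :=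
    hF2.exists_hasCompactSupport_eLpNorm_sub_le (by simp) hδ0.ne'
  obtain ⟨N, hN⟩ := (ENNReal.tendsto_atTop_zero.1
    (tendsto_avg_of_continuous hκ he0 hg hgc (μ := μ))) δ hδ0
  refine ⟨N, fun k hk => ?_⟩
  have hmeas : ∀ G : A → B, StronglyMeasurable G → StronglyMeasurable (avg κ (e k) G) := by
    intro G hG
    refine StronglyMeasurable.integral_prod_right' (f := fun p : A × A => κ p.2 • G (p.1 - e k • p.2)) ?_
    exact (hκ.contDiff.continuous.stronglyMeasurable.comp_measurable measurable_snd).smul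
      (hG.comp_measurable (by fun_prop))
  have hgm := hg.stronglyMeasurable_of_hasCompactSupport hgc
  have hsub : (fun y => avg κ (e k) F y - F y) =ᵐ[μ]
      (avg κ (e k) (F - g) + (avg κ (e k) g - g)) + (g - F) := by
    filter_upwards [ae_integrable_avg hκ (hC k) hC' hF hF2,
      ae_integrable_avg hκ (hC k) hC' hgm hg2] with y h1 h2
    have : avg κ (e k) (F - g) y = avg κ (e k) F y - avg κ (e k) g y := by
      rw [avg, avg, avg, ← integral_sub h1 h2]
      simp only [Pi.sub_apply, smul_sub]
    simp only [Pi.add_apply, Pi.sub_apply, this]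
    abel
  calc _ = eLpNorm ((avg κ (e k) (F - g) + (avg κ (e k) g - g)) + (g - F)) 2 μ :=
        eLpNorm_congr_ae hsub
    _ ≤ eLpNorm (avg κ (e k) (F - g)) 2 μ + eLpNorm (avg κ (e k) g - g) 2 μ
          + eLpNorm (g - F) 2 μ := by
        refine (eLpNorm_add_le ?_ ?_ (by norm_num)).trans ?_
        · exact ((hmeas _ (hF.sub hgm)).add ((hmeas _ hgm).sub hgm)).aestronglyMeasurable
        · exact (hgm.sub hF).aestronglyMeasurable
        · gcongr
          exact eLpNorm_add_le (hmeas _ (hF.sub hgm)).aestronglyMeasurable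
            ((hmeas _ hgm).sub hgm).aestronglyMeasurable (by norm_num)
    _ ≤ C * δ + δ + δ := by
        gcongr
        · refine (eLpNorm_avg_le hκ (hC k) (hF.sub hgm)).trans ?_
          gcongr
        · exact hN k hk
        · rw [eLpNorm_sub_comm]; exact hgF
    _ ≤ η := hδ

end Averages

/-! ### Tools for `L²` limits -/

section Tools

lemma exists_memLp_two_limit {α : Type*} [MeasurableSpace α] {μ : Measure α} {B : Type*}
    [NormedAddCommGroup B] [CompleteSpace B] {f : ℕ → α → B} (hf : ∀ n, MemLp (f n) 2 μ)
    (hc : ∀ δ : ℝ≥0∞, 0 < δ → ∃ N, ∀ n ≥ N, ∀ m ≥ N, eLpNorm (f n - f m) 2 μ ≤ δ) :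
    ∃ F : α → B, StronglyMeasurable F ∧ MemLp F 2 μ ∧
      Tendsto (fun n => eLpNorm (f n - F) 2 μ) atTop (𝓝 0) := by
  have hcs : CauchySeq fun n => (hf n).toLp (f n) := by
    rw [EMetric.cauchySeq_iff]
    intro δ hδ
    obtain ⟨δ', h0, h1⟩ := exists_between hδ
    obtain ⟨N, hN⟩ := hc δ' h0
    refine ⟨N, fun m hm n hn => ?_⟩
    rw [Lp.edist_toLp_toLp]
    exact (hN m hm n hn).trans_lt h1
  obtain ⟨F, hF⟩ := cauchySeq_tendsto_of_complete hcs
  refine ⟨F, Lp.stronglyMeasurable F, Lp.memLp F, ?_⟩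
  have := (Lp.tendsto_Lp_iff_tendsto_eLpNorm' (f := fun n => (hf n).toLp (f n)) F).1 hF
  refine this.congr fun n => eLpNorm_congr_ae ?_
  filter_upwards [(hf n).coeFn_toLp] with x hx
  simp [hx]

lemma cauchy_of_tendsto_eLpNorm {α : Type*} [MeasurableSpace α] {μ : Measure α} {B : Type*}
    [NormedAddCommGroup B] {f : ℕ → α → B} {F : α → B} (hf : ∀ n, AEStronglyMeasurable (f n) μ)
    (hF : AEStronglyMeasurable F μ)
    (h : Tendsto (fun n => eLpNorm (f n - F) 2 μ) atTop (𝓝 0)) (δ : ℝ≥0∞) (hδ : 0 < δ) :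
    ∃ N, ∀ n ≥ N, ∀ m ≥ N, eLpNorm (f n - f m) 2 μ ≤ δ := by
  obtain ⟨N, hN⟩ := ENNReal.tendsto_atTop_zero.1 h (δ / 2) (ENNReal.half_pos hδ.ne')
  refine ⟨N, fun n hn m hm => ?_⟩
  have : f n - f m = (f n - F) + (F - f m) := by abel
  rw [this, ← ENNReal.add_halves δ]
  refine (eLpNorm_add_le ((hf n).sub hF) (hF.sub (hf m)) (by norm_num)).trans ?_
  rw [eLpNorm_sub_comm F]
  exact add_le_add (hN n hn) (hN m hm)

lemma exists_subseq_tendsto_ae {α : Type*} [MeasurableSpace α] {μ : Measure α} {B : Type*}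
    [NormedAddCommGroup B] {f : ℕ → α → B} {F : α → B} (hf : ∀ n, AEStronglyMeasurable (f n) μ)
    (hF : AEStronglyMeasurable F μ)
    (h : Tendsto (fun n => eLpNorm (f n - F) 2 μ) atTop (𝓝 0)) :
    ∃ ns : ℕ → ℕ, StrictMono ns ∧ ∀ᵐ x ∂μ, Tendsto (fun i => f (ns i) x) atTop (𝓝 (F x)) :=
  (tendstoInMeasure_of_tendsto_eLpNorm (by norm_num) hf hF h).exists_seq_tendsto_ae

lemma eLpNorm_le_of_tendsto_eLpNorm {α : Type*} [MeasurableSpace α] {μ : Measure α} {B : Type*}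
    [NormedAddCommGroup B] {f : ℕ → α → B} {F : α → B} (hf : ∀ n, AEStronglyMeasurable (f n) μ)
    (hF : AEStronglyMeasurable F μ) {c : ℕ → ℝ≥0∞} {c' : ℝ≥0∞} (hc : Tendsto c atTop (𝓝 c'))
    (h : Tendsto (fun n => eLpNorm (f n - F) 2 μ) atTop (𝓝 0))
    (hle : ∀ n, eLpNorm (f n) 2 μ ≤ c n) : eLpNorm F 2 μ ≤ c' := by
  have h1 : ∀ n, eLpNorm F 2 μ ≤ c n + eLpNorm (f n - F) 2 μ := by
    intro n
    have : F = f n - (f n - F) := by abel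
    calc eLpNorm F 2 μ = eLpNorm (f n - (f n - F)) 2 μ := by rw [← this]
      _ ≤ eLpNorm (f n) 2 μ + eLpNorm (f n - F) 2 μ :=
        eLpNorm_sub_le (hf n) ((hf n).sub hF) (by norm_num)
      _ ≤ _ := by gcongr; exact hle n
  have := hc.add h
  rw [add_zero] at this
  exact ge_of_tendsto' this h1

lemma tendsto_eLpNorm_of_tendsto {α : Type*} [MeasurableSpace α] {μ : Measure α} {B : Type*}
    [NormedAddCommGroup B] {f : ℕ → α → B} {F : α → B} (hf : ∀ n, AEStronglyMeasurable (f n) μ)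
    (hF : MemLp F 2 μ)
    (h : Tendsto (fun n => eLpNorm (f n - F) 2 μ) atTop (𝓝 0)) :
    Tendsto (fun n => eLpNorm (f n) 2 μ) atTop (𝓝 (eLpNorm F 2 μ)) := by
  have hu : ∀ n, eLpNorm (f n) 2 μ ≤ eLpNorm F 2 μ + eLpNorm (f n - F) 2 μ := by
    intro n
    calc _ = eLpNorm (F + (f n - F)) 2 μ := by congr 1; abel
      _ ≤ _ := eLpNorm_add_le hF.1 ((hf n).sub hF.1) (by norm_num)
  have hl : ∀ n, eLpNorm F 2 μ - eLpNorm (f n - F) 2 μ ≤ eLpNorm (f n) 2 μ := by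
    intro n
    rw [tsub_le_iff_right]
    calc eLpNorm F 2 μ = eLpNorm (f n - (f n - F)) 2 μ := by congr 1; abel
      _ ≤ eLpNorm (f n) 2 μ + eLpNorm (f n - F) 2 μ :=
        eLpNorm_sub_le (hf n) ((hf n).sub hF.1) (by norm_num)
  refine tendsto_of_tendsto_of_tendsto_of_le_of_le ?_ ?_ hl hu
  · have := ENNReal.Tendsto.sub (tendsto_const_nhds (x := eLpNorm F 2 μ)) h (Or.inl hF.2.ne)
    simpa using this
  · simpa using (tendsto_const_nhds (x := eLpNorm F 2 μ)).add h

/-- The quotient map by `W` annihilates the integrand and hence the integral; closedness makes the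
quotient a normed space. -/
lemma integral_mem_of_isClosed {α : Type*} [MeasurableSpace α] {μ : Measure α} {Z : Type*}
    [NormedAddCommGroup Z] [NormedSpace ℝ Z] [CompleteSpace Z] {W : Submodule ℝ Z}
    (hW : IsClosed (W : Set Z)) {F : α → Z} (hF : Integrable F μ) (hFW : ∀ᵐ x ∂μ, F x ∈ W) :
    ∫ x, F x ∂μ ∈ W := by
  have : IsClosed (W : Set Z) := hW
  have h := W.mkQL.integral_comp_comm hF
  have h0 : ∫ x, W.mkQL (F x) ∂μ = 0 := by
    rw [integral_eq_zero_of_ae]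
    filter_upwards [hFW] with x hx
    simpa using hx
  rw [h0] at h
  simpa using h.symm

end Tools

/-! ### One-sided averages in time -/

section TimeAverages

set_option linter.unusedSectionVars false

variable {B : Type*} [NormedAddCommGroup B] [NormedSpace ℝ B]

/-- `∫ ρ(x) F(s - x) dx`. -/
noncomputable def kerAvg {A : Type*} [MeasureSpace A] [Sub A] (ρ : A → ℝ) (F : A → B) (s : A) : B :=
  ∫ x, ρ x • F (s - x)

/-- A smooth kernel with compact support in the positive half line. -/
structure IsPastKernel (ρ : ℝ → ℝ) : Prop where
  contDiff : ContDiff ℝ ∞ ρ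
  hasCompactSupport : HasCompactSupport ρ
  tsupport_subset : tsupport ρ ⊆ Ioi 0

variable {ρ : ℝ → ℝ}

lemma IsPastKernel.deriv (hρ : IsPastKernel ρ) : IsPastKernel (deriv ρ) where
  contDiff := by
    have := hρ.contDiff
    exact (contDiff_infty_iff_deriv.1 this).2
  hasCompactSupport := hρ.hasCompactSupport.deriv
  tsupport_subset := (closure_mono (support_deriv_subset (f := ρ))).trans
    ((isClosed_tsupport ρ).closure_eq.subset.trans hρ.tsupport_subset)

lemma IsPastKernel.eq_zero (hρ : IsPastKernel ρ) {x : ℝ} (hx : x ≤ 0) : ρ x = 0 :=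
  image_eq_zero_of_notMem_tsupport fun h => not_lt.2 hx (hρ.tsupport_subset h)

/-- The average at `s` depends only on the times before `s`. Hence averages are defined on sets of
times that are closed downwards, and they vanish as long as `F` does. -/
lemma IsPastKernel.kerAvg_congr (hρ : IsPastKernel ρ) {F F' : ℝ → B} {s : ℝ}
    (h : ∀ τ < s, F τ = F' τ) : kerAvg ρ F s = kerAvg ρ F' s := by
  unfold kerAvg
  congr 1
  ext x
  rcases le_or_gt x 0 with hx | hx
  · simp [hρ.eq_zero hx]
  · rw [h _ (by linarith)]

lemma kerAvg_eq_convolution {A : Type*} [MeasureSpace A] [Sub A] (ρ : A → ℝ) (F : A → B) :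
    kerAvg ρ F = MeasureTheory.convolution ρ F (ContinuousLinearMap.lsmul ℝ ℝ) volume := rfl

/-- The solution is locally integrable only up to times before `s₂`. Truncation at `b` makes it
locally integrable on the line, and up to time `b` the average does not notice. -/
lemma IsPastKernel.kerAvg_indicator (hρ : IsPastKernel ρ) {F : ℝ → B} {b s : ℝ} (hs : s ≤ b) :
    kerAvg ρ ((Iic b).indicator F) s = kerAvg ρ F s :=
  hρ.kerAvg_congr fun τ hτ => indicator_of_mem (by simp; linarith) _

lemma IsPastKernel.integrable (hρ : IsPastKernel ρ) {F : ℝ → B} {b s : ℝ}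
    (hF : LocallyIntegrable ((Iic b).indicator F)) (hs : s ≤ b) :
    Integrable fun x => ρ x • F (s - x) := by
  have h : Integrable fun x => ρ x • (Iic b).indicator F (s - x) :=
    hρ.hasCompactSupport.convolutionExists_left (ContinuousLinearMap.lsmul ℝ ℝ)
      hρ.contDiff.continuous hF s
  convert h using 2 with x
  rcases le_or_gt x 0 with hx | hx
  · simp [hρ.eq_zero hx]
  · rw [indicator_of_mem (by simp; linarith)]

lemma IsPastKernel.hasDerivAt [CompleteSpace B] (hρ : IsPastKernel ρ) {F : ℝ → B} {b s : ℝ}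
    (hF : LocallyIntegrable ((Iic b).indicator F)) (hs : s < b) :
    HasDerivAt (kerAvg ρ F) (kerAvg (_root_.deriv ρ) F s) s := by
  have h := hρ.hasCompactSupport.hasDerivAt_convolution_left (ContinuousLinearMap.lsmul ℝ ℝ)
    (hρ.contDiff.of_le (by simp)) hF s
  rw [← kerAvg_eq_convolution, ← kerAvg_eq_convolution, hρ.deriv.kerAvg_indicator hs.le] at h
  refine h.congr_of_eventuallyEq ?_
  filter_upwards [Iio_mem_nhds hs] with r hr
  exact (hρ.kerAvg_indicator (le_of_lt hr)).symm

lemma IsPastKernel.continuousOn [CompleteSpace B] (hρ : IsPastKernel ρ) {F : ℝ → B} {b : ℝ}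
    (hF : LocallyIntegrable ((Iic b).indicator F)) : ContinuousOn (kerAvg ρ F) (Iic b) := by
  have h := hρ.hasCompactSupport.continuous_convolution_left (ContinuousLinearMap.lsmul ℝ ℝ)
    hρ.contDiff.continuous hF
  rw [← kerAvg_eq_convolution] at h
  exact h.continuousOn.congr fun s hs => (hρ.kerAvg_indicator hs).symm

lemma IsPastKernel.continuous [CompleteSpace B] (hρ : IsPastKernel ρ) {F : ℝ → B}
    (hF : LocallyIntegrable F) : Continuous (kerAvg ρ F) :=
  hρ.hasCompactSupport.continuous_convolution_left (ContinuousLinearMap.lsmul ℝ ℝ)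
    hρ.contDiff.continuous hF

lemma MeasureTheory.MemLp.locallyIntegrable_indicator_Iic {F : ℝ → B}
    (hF : MemLp F 2 volume) (b : ℝ) : LocallyIntegrable ((Iic b).indicator F) :=
  (hF.indicator measurableSet_Iic).locallyIntegrable (by norm_num)

lemma IsPastKernel.enorm_kerAvg_le (hρ : IsPastKernel ρ) {F : ℝ → B}
    (hF : AEStronglyMeasurable F volume) (s : ℝ) :
    ‖kerAvg ρ F s‖ₑ ≤ eLpNorm ρ 2 volume * eLpNorm F 2 volume := by
  calc ‖kerAvg ρ F s‖ₑ ≤ ∫⁻ x, ‖ρ x • F (s - x)‖ₑ := enorm_integral_le_lintegral_enorm _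
    _ = eLpNorm (fun x => ρ x • F (s - x)) 1 volume := eLpNorm_one_eq_lintegral_enorm.symm
    _ ≤ eLpNorm ρ 2 volume * eLpNorm (fun x => F (s - x)) 2 volume :=
        eLpNorm_smul_le_mul_eLpNorm (hF.comp_quasiMeasurePreserving
          (quasiMeasurePreserving_sub_left volume s))
          hρ.contDiff.continuous.aestronglyMeasurable
    _ = eLpNorm ρ 2 volume * eLpNorm F 2 volume := by
        congr 1
        exact eLpNorm_comp_measurePreserving hF (Measure.measurePreserving_sub_left volume s)

/-- For `F` with compact support the average has compact support. The Cauchy-Schwarz bound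
`IsPastKernel.enorm_kerAvg_le` extends this to the `L²` closure. It removes the boundary term of the
energy identity at time `-∞`. -/
lemma IsPastKernel.tendsto_zero [CompleteSpace B] (hρ : IsPastKernel ρ) {F : ℝ → B}
    (hF : MemLp F 2 volume) : Tendsto (kerAvg ρ F) (cocompact ℝ) (𝓝 0) := by
  have hρ2 : eLpNorm ρ 2 volume ≠ ⊤ :=
    (hρ.contDiff.continuous.memLp_of_hasCompactSupport hρ.hasCompactSupport).2.ne
  rw [Metric.tendsto_nhds]
  intro δ hδ
  set η : ℝ≥0∞ := ENNReal.ofReal (δ / 2) / (eLpNorm ρ 2 volume + 1) with hη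
  have hη0 : η ≠ 0 := (ENNReal.div_pos (by simpa using hδ) (by simp [hρ2])).ne'
  obtain ⟨g, hgc, hgF, hg, hg2⟩ := hF.exists_hasCompactSupport_eLpNorm_sub_le (by simp) hη0
  have hcs : HasCompactSupport (kerAvg ρ g) := by
    rw [kerAvg_eq_convolution]
    exact hρ.hasCompactSupport.convolution _ hgc
  have hev : ∀ᶠ s in cocompact ℝ, s ∉ tsupport (kerAvg ρ g) :=
    hcs.isCompact.compl_mem_cocompact
  filter_upwards [hev] with s hs
  have h1 : kerAvg ρ F s = kerAvg ρ (F - g) s := by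
    have h2 : kerAvg ρ (F - g) s = kerAvg ρ F s - kerAvg ρ g s := by
      unfold kerAvg
      rw [← integral_sub (hρ.integrable (hF.locallyIntegrable_indicator_Iic s) le_rfl)
        (hρ.integrable (hg2.locallyIntegrable_indicator_Iic s) le_rfl)]
      simp only [Pi.sub_apply, smul_sub]
    rw [h2, image_eq_zero_of_notMem_tsupport hs, sub_zero]
  rw [dist_zero_right]
  have h3 : ‖kerAvg ρ F s‖ₑ ≤ ENNReal.ofReal (δ / 2) := by
    rw [h1]
    calc _ ≤ eLpNorm ρ 2 volume * eLpNorm (F - g) 2 volume :=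
          hρ.enorm_kerAvg_le (hF.1.sub hg2.1) s
      _ ≤ (eLpNorm ρ 2 volume + 1) * η := by gcongr; exact le_self_add
      _ ≤ _ := (ENNReal.mul_div_cancel (by simp) (by simp [hρ2])).le
  rw [← ofReal_norm, ENNReal.ofReal_le_ofReal_iff (by positivity)] at h3
  linarith

lemma avg_eq_kerAvg (κ : ℝ → ℝ) {ε : ℝ} (hε : 0 < ε) (F : ℝ → B) :
    avg κ ε F = kerAvg (dil κ ε) F := funext fun s => avg_eq_convolution κ hε F s

lemma isPastKernel_dil {κ : ℝ → ℝ} (hκ : IsMollifier κ) (hκs : tsupport κ ⊆ Ioo 0 1) {ε : ℝ}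
    (hε : 0 < ε) : IsPastKernel (dil κ ε) where
  contDiff := contDiff_dil hκ.contDiff ε
  hasCompactSupport := hasCompactSupport_dil hκ.hasCompactSupport hε
  tsupport_subset := by
    have hcl : IsClosed ((fun x : ℝ => ε⁻¹ • x) ⁻¹' tsupport κ) :=
      (isClosed_tsupport κ).preimage (continuous_const_smul _)
    have h1 : Function.support (dil κ ε) ⊆ (fun x : ℝ => ε⁻¹ • x) ⁻¹' tsupport κ := by
      intro x hx
      refine subset_tsupport _ fun h0 => hx ?_
      have h0' : κ (ε⁻¹ • x) = 0 := h0
      simp [dil, h0', -smul_eq_mul]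
    intro x hx
    have := hκs (closure_minimal h1 hcl hx)
    simp only [smul_eq_mul, mem_Ioo] at this
    have h2 := this.1
    rw [mul_pos_iff_of_pos_left (by positivity)] at h2
    exact h2

lemma exists_isMollifier_Ioo : ∃ κ : ℝ → ℝ, IsMollifier κ ∧ tsupport κ ⊆ Ioo 0 1 := by
  let b : ContDiffBump (1 / 2 : ℝ) := ⟨1 / 8, 1 / 4, by norm_num, by norm_num⟩
  refine ⟨b.normed volume, ⟨b.contDiff_normed, b.hasCompactSupport_normed, b.nonneg_normed,
    b.integral_normed⟩, ?_⟩
  rw [b.tsupport_normed_eq, Real.closedBall_eq_Icc]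
  intro x hx
  simp only [b, mem_Icc] at hx
  constructor <;> norm_num at * <;> linarith

/-- Fubini, translation invariance and `∫ κ = 1`. -/
lemma avgBound_volume {κ : ℝ → ℝ} (hκ : IsMollifier κ) (ε : ℝ) :
    AvgBound κ ε (volume : Measure ℝ) 1 := by
  intro h hh
  have hm : Measurable fun t => ENNReal.ofReal (κ t) :=
    hκ.contDiff.continuous.measurable.ennreal_ofReal
  have hm2 : Measurable fun p : ℝ × ℝ => ENNReal.ofReal (κ p.2) * h (p.1 - ε • p.2) :=
    (hm.comp measurable_snd).mul (hh.comp (measurable_fst.sub (measurable_snd.const_smul ε)))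
  rw [lintegral_lintegral_swap hm2.aemeasurable]
  have : ∀ t, ∫⁻ y, ENNReal.ofReal (κ t) * h (y - ε • t) = ENNReal.ofReal (κ t) * ∫⁻ y, h y := by
    intro t
    have hh' : Measurable fun y => h (y - ε • t) := hh.comp (measurable_id.sub_const _)
    rw [lintegral_const_mul _ hh',
      lintegral_sub_right_eq_self (fun y => h y)]
  simp only [this]
  rw [lintegral_mul_const _ hm, hκ.lintegral_eq]
  simp

/-- The averages of a locally integrable function converge almost everywhere. -/
lemma ae_tendsto_avg [CompleteSpace B] {κ : ℝ → ℝ} (hκ : IsMollifier κ)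
    (hκs : tsupport κ ⊆ Ioo 0 1) {e : ℕ → ℝ} (he : ∀ k, 0 < e k) (he0 : Tendsto e atTop (𝓝 0))
    {F : ℝ → B} (hF : LocallyIntegrable F) :
    ∀ᵐ s, Tendsto (fun k => avg κ (e k) F s) atTop (𝓝 (F s)) := by
  obtain ⟨M, hM⟩ := hκ.contDiff.continuous.bounded_above_of_compact_support hκ.hasCompactSupport
  have hM0 : 0 ≤ M := (norm_nonneg _).trans (hM 0)
  filter_upwards [IsUnifLocDoublingMeasure.ae_tendsto_average_norm_sub volume hF 1] with s hs
  have hs' := hs (l := atTop) (fun _ : ℕ => s) e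
    (tendsto_nhdsWithin_iff.2 ⟨he0, Eventually.of_forall he⟩)
    (Eventually.of_forall fun k => Metric.mem_closedBall_self (by have := he k; linarith))
  rw [tendsto_iff_norm_sub_tendsto_zero]
  -- The dilated kernel is at most `M / e k` and lives in the ball of radius `e k`, of volume `2 * e
  -- k`. So the error is at most `2 * M` times the mean oscillation, which tends to zero at Lebesgue
  -- points.
  have hlim := hs'.const_mul (2 * M)
  rw [mul_zero] at hlim
  refine squeeze_zero (fun _ => norm_nonneg _) (fun k => ?_) hlim
  have hk := he k
  have hker := isPastKernel_dil hκ hκs hk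
  have hint : Integrable fun x => dil κ (e k) x • F (s - x) :=
    hker.hasCompactSupport.convolutionExists_left (ContinuousLinearMap.lsmul ℝ ℝ)
      hker.contDiff.continuous hF s
  have hdil : Integrable (dil κ (e k)) :=
    hker.contDiff.continuous.integrable_of_hasCompactSupport hker.hasCompactSupport
  have hone : ∫ x, dil κ (e k) x = 1 := by
    have h := avg_eq_convolution κ hk (fun _ => (1 : ℝ)) 0
    simp only [avg, smul_eq_mul, mul_one, hκ.integral_eq] at h
    exact h.symm
  have hdiff : avg κ (e k) F s - F s = ∫ x, dil κ (e k) (s - x) • (F x - F s) := by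
    rw [← integral_sub_left_eq_self _ volume s]
    simp only [sub_sub_cancel, smul_sub]
    rw [integral_sub hint (hdil.smul_const _), integral_smul_const, hone, one_smul,
      avg_eq_convolution κ hk]
  have hloc : IntegrableOn (fun x => ‖F x - F s‖) (Metric.closedBall s (e k)) := by
    have : LocallyIntegrable (fun x => F x - F s) := hF.sub (locallyIntegrable_const _)
    exact (this.integrableOn_isCompact (isCompact_closedBall _ _)).norm
  rw [hdiff]
  have hbd : ∀ x, ‖dil κ (e k) (s - x) • (F x - F s)‖
      ≤ (Metric.closedBall s (e k)).indicator (fun x => (e k)⁻¹ * M * ‖F x - F s‖) x := by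
    intro x
    by_cases hx : x ∈ Metric.closedBall s (e k)
    · rw [indicator_of_mem hx, norm_smul]
      gcongr
      rw [dil, norm_mul, Module.finrank_self, pow_one, Real.norm_of_nonneg (by positivity)]
      gcongr
      exact hM _
    · rw [indicator_of_notMem hx]
      have : dil κ (e k) (s - x) = 0 := by
        rw [dil, image_eq_zero_of_notMem_tsupport (f := κ), mul_zero]
        intro hmem
        have h2 := hκs hmem
        simp only [smul_eq_mul, mem_Ioo] at h2
        rw [mul_pos_iff_of_pos_left (by positivity), inv_mul_lt_iff₀ hk] at h2
        apply hx
        rw [Metric.mem_closedBall, Real.dist_eq, abs_le]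
        constructor <;> linarith [h2.1, h2.2]
      simp [this]
  calc _ ≤ ∫ x, (Metric.closedBall s (e k)).indicator
          (fun x => (e k)⁻¹ * M * ‖F x - F s‖) x := by
        refine norm_integral_le_of_norm_le ?_ (ae_of_all _ hbd)
        exact IntegrableOn.integrable_indicator (hloc.const_mul _) measurableSet_closedBall
    _ = (e k)⁻¹ * M * ∫ x in Metric.closedBall s (e k), ‖F x - F s‖ := by
        rw [integral_indicator measurableSet_closedBall, integral_const_mul]
    _ = _ := by
        rw [setAverage_eq, Real.volume_real_closedBall hk.le, smul_eq_mul]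
        field_simp

end TimeAverages

/-! ### Maximal regularity for weak evolution equations in Hilbert spaces -/

section Energy

variable {X Y : Type*} [NormedAddCommGroup X] [InnerProductSpace ℝ X]
  [NormedAddCommGroup Y] [InnerProductSpace ℝ Y]

lemma enorm_sq_eq_ofReal {Z : Type*} [NormedAddCommGroup Z] (z : Z) :
    ‖z‖ₑ ^ 2 = ENNReal.ofReal (‖z‖ ^ 2) := by
  rw [ENNReal.ofReal_pow (norm_nonneg _), ofReal_norm]

/-- The derivative of `‖g‖²` is `2 (g, g') = 2 (F, V) - 2 ‖V‖²`, which is at most `‖F‖² - ‖V‖²`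
because `‖F - V‖² ≥ 0`. Integrate from `a` to `b` and let `a → -∞`. -/
lemma enorm_sq_add_lintegral_le {g g' : ℝ → Y} {V F : ℝ → X} {b : ℝ}
    (hg : ∀ s, HasDerivAt g (g' s) s) (hg' : Continuous g') (hV : ContinuousOn V (Iic b))
    (hF : ContinuousOn F (Iic b))
    (heq : ∀ s ≤ b, inner ℝ (V s) (V s) + inner ℝ (g s) (g' s) = inner ℝ (F s) (V s))
    (hlim : Tendsto g atBot (𝓝 0)) :
    ‖g b‖ₑ ^ 2 + ∫⁻ s in Iic b, ‖V s‖ₑ ^ 2 ≤ ∫⁻ s, ‖F s‖ₑ ^ 2 := by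
  have hgc : Continuous g := continuous_iff_continuousAt.2 fun s => (hg s).continuousAt
  have step : ∀ a ≤ b, ‖g b‖ₑ ^ 2 + ∫⁻ s in Icc a b, ‖V s‖ₑ ^ 2
      ≤ ‖g a‖ₑ ^ 2 + ∫⁻ s, ‖F s‖ₑ ^ 2 := by
    intro a hab
    have hVc : ContinuousOn (fun s => ‖V s‖ ^ 2) (Icc a b) :=
      ((hV.mono Icc_subset_Iic_self).norm.pow 2)
    have hFc : ContinuousOn (fun s => ‖F s‖ ^ 2) (Icc a b) :=
      ((hF.mono Icc_subset_Iic_self).norm.pow 2)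
    have hftc := intervalIntegral.integral_eq_sub_of_hasDerivAt
      (f := fun s => ‖g s‖ ^ 2) (f' := fun s => 2 * inner ℝ (g s) (g' s)) (a := a) (b := b)
      (fun s _ => (hg s).norm_sq) (by
        refine Continuous.intervalIntegrable ?_ _ _
        exact continuous_const.mul (hgc.inner hg'))
    have hVi : IntegrableOn (fun s => ‖V s‖ ^ 2) (Icc a b) := hVc.integrableOn_Icc
    have hFi : IntegrableOn (fun s => ‖F s‖ ^ 2) (Icc a b) := hFc.integrableOn_Icc
    have hle : ∫ s in a..b, 2 * inner ℝ (g s) (g' s) ≤ ∫ s in a..b, (‖F s‖ ^ 2 - ‖V s‖ ^ 2) := by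
      refine intervalIntegral.integral_mono_on hab ?_ ?_ fun s hs => ?_
      · refine Continuous.intervalIntegrable ?_ _ _
        exact continuous_const.mul (hgc.inner hg')
      · rw [intervalIntegrable_iff_integrableOn_Icc_of_le hab]
        exact hFi.sub hVi
      · have h1 := heq s hs.2
        rw [real_inner_self_eq_norm_sq] at h1
        have h2 := norm_sub_sq_real (F s) (V s)
        nlinarith [sq_nonneg ‖F s - V s‖]
    rw [hftc, intervalIntegral.integral_of_le hab, ← integral_Icc_eq_integral_Ioc,
      integral_sub hFi hVi] at hle
    have hV2 : ∫⁻ s in Icc a b, ‖V s‖ₑ ^ 2 = ENNReal.ofReal (∫ s in Icc a b, ‖V s‖ ^ 2) := by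
      rw [ofReal_integral_eq_lintegral_ofReal hVi (ae_of_all _ fun s => sq_nonneg _)]
      simp only [enorm_sq_eq_ofReal]
    have hF2 : ∫⁻ s in Icc a b, ‖F s‖ₑ ^ 2 = ENNReal.ofReal (∫ s in Icc a b, ‖F s‖ ^ 2) := by
      rw [ofReal_integral_eq_lintegral_ofReal hFi (ae_of_all _ fun s => sq_nonneg _)]
      simp only [enorm_sq_eq_ofReal]
    have hVn : 0 ≤ ∫ s in Icc a b, ‖V s‖ ^ 2 := integral_nonneg fun s => sq_nonneg _
    have hFn : 0 ≤ ∫ s in Icc a b, ‖F s‖ ^ 2 := integral_nonneg fun s => sq_nonneg _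
    calc _ = ENNReal.ofReal (‖g b‖ ^ 2 + ∫ s in Icc a b, ‖V s‖ ^ 2) := by
          rw [hV2, enorm_sq_eq_ofReal, ENNReal.ofReal_add (sq_nonneg _) hVn]
      _ ≤ ENNReal.ofReal (‖g a‖ ^ 2 + ∫ s in Icc a b, ‖F s‖ ^ 2) :=
          ENNReal.ofReal_le_ofReal (by linarith)
      _ = ‖g a‖ₑ ^ 2 + ∫⁻ s in Icc a b, ‖F s‖ₑ ^ 2 := by
          rw [hF2, enorm_sq_eq_ofReal, ENNReal.ofReal_add (sq_nonneg _) hFn]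
      _ ≤ _ := by gcongr; exact Measure.restrict_le_self
  have hVm : AEMeasurable (fun s => ‖V s‖ₑ ^ 2) (volume.restrict (Iic b)) :=
    ((hV.aestronglyMeasurable measurableSet_Iic).enorm.pow_const 2)
  have hl1 : Tendsto (fun a : ℝ => ‖g b‖ₑ ^ 2 + ∫⁻ s in Icc a b, ‖V s‖ₑ ^ 2) atBot
      (𝓝 (‖g b‖ₑ ^ 2 + ∫⁻ s in Iic b, ‖V s‖ₑ ^ 2)) := by
    refine tendsto_const_nhds.add ?_
    have := (aecover_Ici (μ := volume.restrict (Iic b)) (l := atBot) (a := fun a : ℝ => a)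
      tendsto_id).lintegral_tendsto_of_countably_generated hVm
    refine this.congr fun a => ?_
    rw [Measure.restrict_restrict measurableSet_Ici, Ici_inter_Iic]
  have hl2 : Tendsto (fun a : ℝ => ‖g a‖ₑ ^ 2 + ∫⁻ s, ‖F s‖ₑ ^ 2) atBot
      (𝓝 (∫⁻ s, ‖F s‖ₑ ^ 2)) := by
    have h1 : Tendsto (fun a => ‖g a‖ₑ) atBot (𝓝 0) := by
      simpa [Function.comp_def] using (continuous_enorm.tendsto (0 : Y)).comp hlim
    simpa using (ENNReal.Tendsto.pow (n := 2) h1).add_const (∫⁻ s, ‖F s‖ₑ ^ 2)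
  exact le_of_tendsto_of_tendsto hl1 hl2 ((eventually_le_atBot b).mono step)

/-- An open lower set is a countable directed union of half lines with rational end points, so
monotone convergence applies. -/
lemma lintegral_le_of_forall_Iic {J : Set ℝ} (hJo : IsOpen J) (hJl : IsLowerSet J)
    {h : ℝ → ℝ≥0∞} {c : ℝ≥0∞} (hc : ∀ b ∈ J, ∫⁻ s in Iic b, h s ≤ c) : ∫⁻ s in J, h s ≤ c := by
  have hJ : J = ⋃ q : {q : ℚ // (q : ℝ) ∈ J}, Iic ((q : ℚ) : ℝ) := by
    ext s
    simp only [mem_iUnion, mem_Iic]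
    constructor
    · intro hs
      obtain ⟨δ, hδ, hball⟩ := Metric.isOpen_iff.1 hJo s hs
      obtain ⟨q, hq1, hq2⟩ := exists_rat_btwn (show s < s + δ by linarith)
      refine ⟨⟨q, hball ?_⟩, hq1.le⟩
      rw [Metric.mem_ball, Real.dist_eq, abs_lt]
      constructor <;> linarith
    · rintro ⟨q, hq⟩
      exact hJl hq q.2
  rw [hJ, setLIntegral_iUnion_of_directed]
  · exact iSup_le fun q => hc _ q.2
  · refine Monotone.directed_le fun p q hpq => Iic_subset_Iic.2 ?_
    exact_mod_cast hpq

end Energy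

section TimeAverages

variable {B : Type*} [NormedAddCommGroup B] [NormedSpace ℝ B]

/-- Differences of kernels turn an a priori bound into a Cauchy estimate. This is why `IsPastKernel`
requires neither a sign nor a normalization. -/
lemma IsPastKernel.sub {ρ₁ ρ₂ : ℝ → ℝ} (h₁ : IsPastKernel ρ₁) (h₂ : IsPastKernel ρ₂) :
    IsPastKernel (ρ₁ - ρ₂) where
  contDiff := h₁.contDiff.sub h₂.contDiff
  hasCompactSupport := h₁.hasCompactSupport.sub h₂.hasCompactSupport
  tsupport_subset := by
    refine (closure_mono (Function.support_sub _ _)).trans ?_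
    rw [closure_union]
    exact union_subset h₁.tsupport_subset h₂.tsupport_subset

lemma IsPastKernel.kerAvg_sub {ρ₁ ρ₂ : ℝ → ℝ} (h₁ : IsPastKernel ρ₁) (h₂ : IsPastKernel ρ₂)
    {F : ℝ → B} {s : ℝ} (hF : LocallyIntegrable ((Iic s).indicator F)) :
    kerAvg (ρ₁ - ρ₂) F s = kerAvg ρ₁ F s - kerAvg ρ₂ F s := by
  unfold kerAvg
  rw [← integral_sub (h₁.integrable hF le_rfl) (h₂.integrable hF le_rfl)]
  simp only [Pi.sub_apply, sub_smul]

end TimeAverages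

/-! ### The abstract weak evolution equation and its averages in time -/

section Evolution

set_option linter.unusedSectionVars false

variable {X Y : Type*} [NormedAddCommGroup X] [InnerProductSpace ℝ X] [CompleteSpace X]
  [NormedAddCommGroup Y] [InnerProductSpace ℝ Y] [CompleteSpace Y]

lemma integral_mul_inner {σ : ℝ → ℝ} {F : ℝ → X} {s : ℝ} {z : X}
    (hi : Integrable fun x => σ x • F (s - x)) :
    ∫ τ, σ (s - τ) * inner ℝ (F τ) z = inner ℝ (kerAvg σ F s) z := by
  rw [real_inner_comm, kerAvg, ← integral_inner hi, ← integral_sub_left_eq_self _ volume s]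
  congr 1
  ext x
  rw [sub_sub_cancel, real_inner_comm, inner_smul_right]

/-- `u` solves `∂ₛ u + A u = f` weakly on `J`, where `W` is the graph of an operator from `X` to
`Y`, the function `G` is the image of `u` under it, and `(A u, ζ) = (G, Z)` for `(ζ, Z) ∈ W`. -/
structure IsWeakEvolution (J : Set ℝ) (W : Submodule ℝ (X × Y)) (u : ℝ → X) (G : ℝ → Y)
    (f : ℝ → X) : Prop where
  isOpen : IsOpen J
  isLowerSet : IsLowerSet J
  nonempty : J.Nonempty
  isClosed : IsClosed (W : Set (X × Y))
  locallyIntegrable : ∀ b ∈ J, LocallyIntegrable ((Iic b).indicator u)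
  memLp_grad : MemLp G 2 volume
  memLp_rhs : MemLp f 2 volume
  stronglyMeasurable_rhs : StronglyMeasurable f
  mem : ∀ᵐ s, (u s, G s) ∈ W
  weak : ∃ D : Set (X × Y), (W : Set (X × Y)) ⊆ closure D ∧ ∀ p ∈ D, ∀ ψ : ℝ → ℝ,
    ContDiff ℝ ∞ ψ → HasCompactSupport ψ → tsupport ψ ⊆ J →
      -(∫ s, deriv ψ s * inner ℝ (u s) p.1) + ∫ s, ψ s * inner ℝ (G s) p.2
        = ∫ s, ψ s * inner ℝ (f s) p.1

namespace IsWeakEvolution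

variable {J : Set ℝ} {W : Submodule ℝ (X × Y)} {u f : ℝ → X} {G : ℝ → Y} {ρ : ℝ → ℝ}

/-- Averaging commutes with the operator because its graph `W` is a closed subspace. -/
lemma mem_kerAvg (h : IsWeakEvolution J W u G f) (hρ : IsPastKernel ρ) {s : ℝ} (hs : s ∈ J) :
    (kerAvg ρ u s, kerAvg ρ G s) ∈ W := by
  have hu := hρ.integrable (h.locallyIntegrable s hs) le_rfl
  have hG := hρ.integrable (h.memLp_grad.locallyIntegrable_indicator_Iic s) le_rfl
  have : (kerAvg ρ u s, kerAvg ρ G s) = ∫ x, (ρ x • u (s - x), ρ x • G (s - x)) :=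
    (integral_pair hu hG).symm
  rw [this]
  refine integral_mem_of_isClosed h.isClosed (hu.prodMk hG) ?_
  filter_upwards [(quasiMeasurePreserving_sub_left volume s).ae h.mem] with x hx
  exact W.smul_mem (ρ x) hx

/-- The function `τ ↦ ρ (s - τ)` is supported in times before `s`, hence in `J`, and can be used in
the weak equation; its derivative turns the kernel into `deriv ρ`. Both sides are continuous in `p`,
so the identity passes from the dense test set to `W`. -/
lemma inner_kerAvg (h : IsWeakEvolution J W u G f) (hρ : IsPastKernel ρ) {s : ℝ} (hs : s ∈ J)
    {p : X × Y} (hp : p ∈ W) :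
    inner ℝ (kerAvg (deriv ρ) u s) p.1 + inner ℝ (kerAvg ρ G s) p.2
      = inner ℝ (kerAvg ρ f s) p.1 := by
  obtain ⟨D, hD, hweak⟩ := h.weak
  have hcl : IsClosed {p : X × Y | inner ℝ (kerAvg (deriv ρ) u s) p.1
      + inner ℝ (kerAvg ρ G s) p.2 = inner ℝ (kerAvg ρ f s) p.1} :=
    isClosed_eq (by fun_prop) (by fun_prop)
  refine closure_minimal (fun p hp => ?_) hcl (hD hp)
  have hw := hweak p hp (fun τ => ρ (s - τ)) (hρ.contDiff.comp (contDiff_const.sub contDiff_id))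
    (hρ.hasCompactSupport.comp_homeomorph (Homeomorph.subLeft s)) (by
      intro τ hτ
      have : s - τ ∈ tsupport ρ := by
        have h1 := tsupport_comp_subset_preimage ρ (f := fun τ : ℝ => s - τ) (by fun_prop) hτ
        exact h1
      have h2 := hρ.tsupport_subset this
      simp only [mem_Ioi, sub_pos] at h2
      exact h.isLowerSet h2.le hs)
  have hd : ∀ τ, deriv (fun τ => ρ (s - τ)) τ = - deriv ρ (s - τ) := fun τ =>
    deriv_comp_const_sub _ _ _
  simp only [hd, neg_mul, integral_neg, neg_neg] at hw
  rw [integral_mul_inner (hρ.deriv.integrable (h.locallyIntegrable s hs) le_rfl),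
    integral_mul_inner (hρ.integrable (h.memLp_grad.locallyIntegrable_indicator_Iic s) le_rfl),
    integral_mul_inner (hρ.integrable (h.memLp_rhs.locallyIntegrable_indicator_Iic s) le_rfl)] at hw
  exact hw

/-- The averages of `u` and `G` against `deriv ρ` form an element of `W`, so the time derivative of
the averaged solution may serve as a test function. As `G` is square integrable on the whole line,
its average is differentiable everywhere and vanishes at `-∞`. -/
lemma energy (h : IsWeakEvolution J W u G f) (hρ : IsPastKernel ρ) {b : ℝ} (hb : b ∈ J) :
    ‖kerAvg ρ G b‖ₑ ^ 2 + ∫⁻ s in Iic b, ‖kerAvg (deriv ρ) u s‖ₑ ^ 2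
      ≤ eLpNorm (kerAvg ρ f) 2 volume ^ 2 := by
  have hG : LocallyIntegrable G := h.memLp_grad.locallyIntegrable (by norm_num)
  rw [eLpNorm_two_sq]
  refine enorm_sq_add_lintegral_le (g' := kerAvg (deriv ρ) G) (fun s => ?_)
    (hρ.deriv.continuous hG) (hρ.deriv.continuousOn (h.locallyIntegrable b hb))
    (hρ.continuousOn (h.memLp_rhs.locallyIntegrable_indicator_Iic b)) (fun s hs => ?_)
    ((hρ.tendsto_zero h.memLp_grad).mono_left atBot_le_cocompact)
  · exact hρ.hasDerivAt (h.memLp_grad.locallyIntegrable_indicator_Iic (s + 1)) (by linarith)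
  · have hs' := h.isLowerSet hs hb
    exact h.inner_kerAvg hρ hs' (h.mem_kerAvg hρ.deriv hs')

lemma energy_deriv (h : IsWeakEvolution J W u G f) (hρ : IsPastKernel ρ) :
    eLpNorm (kerAvg (deriv ρ) u) 2 (volume.restrict J) ≤ eLpNorm (kerAvg ρ f) 2 volume := by
  rw [← ENNReal.pow_le_pow_left_iff two_ne_zero, eLpNorm_two_sq]
  exact lintegral_le_of_forall_Iic h.isOpen h.isLowerSet fun b hb =>
    le_add_self.trans (h.energy hρ hb)

/-- The average of `G` is continuous on the line, so the bound extends from `J` to its end point. -/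
lemma energy_grad (h : IsWeakEvolution J W u G f) (hρ : IsPastKernel ρ) {s : ℝ}
    (hs : s ∈ closure J) : ‖kerAvg ρ G s‖ₑ ≤ eLpNorm (kerAvg ρ f) 2 volume := by
  have hG : LocallyIntegrable G := h.memLp_grad.locallyIntegrable (by norm_num)
  have hcl : IsClosed {s | ‖kerAvg ρ G s‖ₑ ≤ eLpNorm (kerAvg ρ f) 2 volume} :=
    isClosed_le (hρ.continuous hG).enorm continuous_const
  refine closure_minimal (fun b hb => ?_) hcl hs
  have := le_self_add.trans (h.energy hρ hb)
  exact (ENNReal.pow_le_pow_left_iff two_ne_zero).1 this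

lemma continuousOn_kerAvg (h : IsWeakEvolution J W u G f) (hρ : IsPastKernel ρ) :
    ContinuousOn (kerAvg ρ u) J := by
  intro s hs
  obtain ⟨δ, hδ, hball⟩ := Metric.isOpen_iff.1 h.isOpen s hs
  have hb : s + δ / 2 ∈ J := hball (by
    rw [Metric.mem_ball, Real.dist_eq, abs_lt]; constructor <;> linarith)
  exact ((hρ.continuousOn (h.locallyIntegrable _ hb)).continuousAt
    (Iic_mem_nhds (by linarith))).continuousWithinAt

lemma hasDerivAt_kerAvg (h : IsWeakEvolution J W u G f) (hρ : IsPastKernel ρ) {s : ℝ}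
    (hs : s ∈ J) : HasDerivAt (kerAvg ρ u) (kerAvg (deriv ρ) u s) s := by
  obtain ⟨δ, hδ, hball⟩ := Metric.isOpen_iff.1 h.isOpen s hs
  have hb : s + δ / 2 ∈ J := hball (by
    rw [Metric.mem_ball, Real.dist_eq, abs_lt]; constructor <;> linarith)
  exact hρ.hasDerivAt (h.locallyIntegrable _ hb) (by linarith)

end IsWeakEvolution

/-- Hölder on a bounded interval: `L²` convergence of derivatives gives locally uniform convergence
of primitives. -/
lemma enorm_intervalIntegral_le {F : ℝ → X} {J : Set ℝ} {a b r s : ℝ}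
    (hF : AEStronglyMeasurable F (volume.restrict J)) (hJ : Icc a b ⊆ J)
    (hr : r ∈ Icc a b) (hs : s ∈ Icc a b) :
    ‖∫ t in r..s, F t‖ₑ ≤ eLpNorm F 2 (volume.restrict J) * ENNReal.ofReal (b - a) ^ (1 / 2 : ℝ) := by
  have hsub : uIoc r s ⊆ Icc a b := uIoc_subset_uIcc.trans (ordConnected_Icc.uIcc_subset hr hs)
  have h1 : ‖∫ t in r..s, F t‖ₑ = ‖∫ t in uIoc r s, F t‖ₑ := by
    rw [← ofReal_norm, ← ofReal_norm, intervalIntegral.norm_integral_eq_norm_integral_uIoc]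
  have hFm : AEStronglyMeasurable F (volume.restrict (Icc a b)) :=
    hF.mono_measure (Measure.restrict_mono hJ le_rfl)
  calc _ ≤ ∫⁻ t in uIoc r s, ‖F t‖ₑ := h1 ▸ enorm_integral_le_lintegral_enorm _
    _ ≤ ∫⁻ t in Icc a b, ‖F t‖ₑ := lintegral_mono_set hsub
    _ = eLpNorm F 1 (volume.restrict (Icc a b)) := eLpNorm_one_eq_lintegral_enorm.symm
    _ ≤ eLpNorm F 2 (volume.restrict (Icc a b)) * (volume.restrict (Icc a b)) univ
          ^ (1 / (1 : ℝ≥0∞).toReal - 1 / (2 : ℝ≥0∞).toReal) :=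
        eLpNorm_le_eLpNorm_mul_rpow_measure_univ (by norm_num) hFm
    _ ≤ _ := by
        rw [Measure.restrict_apply_univ, Real.volume_Icc]
        have : (1 / (1 : ℝ≥0∞).toReal - 1 / (2 : ℝ≥0∞).toReal) = (1 / 2 : ℝ) := by norm_num
        rw [this]
        gcongr ?_ * _
        exact eLpNorm_mono_measure _ (Measure.restrict_mono hJ le_rfl)

end Evolution

/-! ### Passage to the limit in the averages -/

section Evolution

set_option linter.unusedSectionVars false

variable {X Y : Type*} [NormedAddCommGroup X] [InnerProductSpace ℝ X] [CompleteSpace X]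
  [NormedAddCommGroup Y] [InnerProductSpace ℝ Y] [CompleteSpace Y]

namespace IsWeakEvolution

variable {J : Set ℝ} {W : Submodule ℝ (X × Y)} {u f : ℝ → X} {G : ℝ → Y}

/-- Lebesgue points are taken for the truncations of `u` at the rational times of `J`. These are
countably many, and each time of `J` lies below one of them. -/
lemma ae_tendsto_kerAvg (h : IsWeakEvolution J W u G f) {κ : ℝ → ℝ} (hκ : IsMollifier κ)
    (hκs : tsupport κ ⊆ Ioo 0 1) {e : ℕ → ℝ} (he : ∀ k, 0 < e k) (he0 : Tendsto e atTop (𝓝 0)) :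
    ∀ᵐ s ∂volume.restrict J, Tendsto (fun k => kerAvg (dil κ (e k)) u s) atTop (𝓝 (u s)) := by
  have h1 : ∀ q : {q : ℚ // (q : ℝ) ∈ J}, ∀ᵐ s, Tendsto
      (fun k => avg κ (e k) ((Iic ((q : ℚ) : ℝ)).indicator u) s) atTop
        (𝓝 ((Iic ((q : ℚ) : ℝ)).indicator u s)) := fun q =>
    ae_tendsto_avg hκ hκs he he0 (h.locallyIntegrable _ q.2)
  rw [ae_restrict_iff' h.isOpen.measurableSet]
  filter_upwards [ae_all_iff.2 h1] with s hs hsJ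
  obtain ⟨δ, hδ, hball⟩ := Metric.isOpen_iff.1 h.isOpen s hsJ
  obtain ⟨q, hq1, hq2⟩ := exists_rat_btwn (show s < s + δ by linarith)
  have hq : (q : ℝ) ∈ J := hball (by
    rw [Metric.mem_ball, Real.dist_eq, abs_lt]; constructor <;> linarith)
  have := hs ⟨q, hq⟩
  rw [indicator_of_mem (by exact hq1.le)] at this
  refine this.congr fun k => ?_
  rw [avg_eq_kerAvg κ (he k), (isPastKernel_dil hκ hκs (he k)).kerAvg_indicator hq1.le]

/-- Maximal regularity. -/
theorem maximal_regularity (h : IsWeakEvolution J W u G f) :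
    ∃ (V U : ℝ → X) (G' : ℝ → Y),
      MemLp V 2 (volume.restrict J) ∧ eLpNorm V 2 (volume.restrict J) ≤ eLpNorm f 2 volume ∧
      (∀ᵐ s ∂volume.restrict J, U s = u s) ∧ ContinuousOn U (closure J) ∧
      (∀ᵐ s ∂volume.restrict J, G' s = G s) ∧ ContinuousOn G' (closure J) ∧
      (∀ s ∈ closure J, (U s, G' s) ∈ W) ∧
      (∀ ψ : ℝ → ℝ, ContDiff ℝ ∞ ψ → HasCompactSupport ψ → tsupport ψ ⊆ J →
        ∫ s in J, deriv ψ s • U s = - ∫ s in J, ψ s • V s) ∧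
      (∀ᵐ s ∂volume.restrict J, ∀ p ∈ W,
        inner ℝ (V s) p.1 + inner ℝ (G' s) p.2 = inner ℝ (f s) p.1) ∧
      Tendsto G' atBot (𝓝 0) ∧ (J = univ → Tendsto G' atTop (𝓝 0)) ∧
      (∀ s ∈ closure J, (∀ τ < s, G τ = 0) → G' s = 0) := by
  obtain ⟨κ, hκ, hκs⟩ := exists_isMollifier_Ioo
  set e : ℕ → ℝ := fun k => 1 / ((k : ℝ) + 1) with he_def
  have he : ∀ k, 0 < e k := fun k => by positivity
  have he0 : Tendsto e atTop (𝓝 0) := tendsto_one_div_add_atTop_nhds_zero_nat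
  set ρ : ℕ → ℝ → ℝ := fun k => dil κ (e k) with hρ_def
  have hρ : ∀ k, IsPastKernel (ρ k) := fun k => isPastKernel_dil hκ hκs (he k)
  have hJm := h.isOpen.measurableSet
  have hGloc : LocallyIntegrable G := h.memLp_grad.locallyIntegrable (by norm_num)
  have hfloc : LocallyIntegrable f := h.memLp_rhs.locallyIntegrable (by norm_num)
  -- the averages of the right hand side
  have hfk : Tendsto (fun k => eLpNorm (kerAvg (ρ k) f - f) 2 volume) atTop (𝓝 0) := by
    have := tendsto_avg hκ ENNReal.one_ne_top (fun k => avgBound_volume hκ (e k)) he0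
      h.stronglyMeasurable_rhs h.memLp_rhs
    simpa only [avg_eq_kerAvg κ (he _)] using this
  have hfm : ∀ k, AEStronglyMeasurable (kerAvg (ρ k) f) volume := fun k =>
    ((hρ k).continuous hfloc).aestronglyMeasurable
  have hfnorm := tendsto_eLpNorm_of_tendsto hfm h.memLp_rhs hfk
  have hfc := cauchy_of_tendsto_eLpNorm hfm h.memLp_rhs.1 hfk
  have hfsub : ∀ n m, kerAvg (ρ n) f - kerAvg (ρ m) f = kerAvg (ρ n - ρ m) f := fun n m =>
    funext fun s => ((hρ n).kerAvg_sub (hρ m) (h.memLp_rhs.locallyIntegrable_indicator_Iic s)).symm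
  -- the time derivatives
  have hVm : ∀ k, AEStronglyMeasurable (kerAvg (deriv (ρ k)) u) (volume.restrict J) := fun k =>
    (h.continuousOn_kerAvg (hρ k).deriv).aestronglyMeasurable hJm
  have hfk2 : ∀ k, eLpNorm (kerAvg (ρ k) f) 2 volume < ⊤ := fun k => by
    have := eLpNorm_avg_le hκ (avgBound_volume hκ (e k)) h.stronglyMeasurable_rhs
    rw [avg_eq_kerAvg κ (he k), one_mul] at this
    exact this.trans_lt h.memLp_rhs.2
  have hVL : ∀ k, MemLp (kerAvg (deriv (ρ k)) u) 2 (volume.restrict J) := fun k =>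
    ⟨hVm k, (h.energy_deriv (hρ k)).trans_lt (hfk2 k)⟩
  have hderiv_sub : ∀ n m, deriv (ρ n - ρ m) = deriv (ρ n) - deriv (ρ m) := fun n m =>
    funext fun x => deriv_sub ((hρ n).contDiff.differentiable (by simp) x)
      ((hρ m).contDiff.differentiable (by simp) x)
  -- By linearity in the kernel, the energy estimate for `ρ n - ρ m` bounds the differences by those
  -- of the averaged right hand sides, which are Cauchy.
  have hVc : ∀ n m, eLpNorm (kerAvg (deriv (ρ n)) u - kerAvg (deriv (ρ m)) u) 2
      (volume.restrict J) ≤ eLpNorm (kerAvg (ρ n) f - kerAvg (ρ m) f) 2 volume := by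
    intro n m
    rw [hfsub]
    refine le_trans (le_of_eq (eLpNorm_congr_ae ?_)) (h.energy_deriv ((hρ n).sub (hρ m)))
    filter_upwards [ae_restrict_mem hJm] with s hs
    rw [hderiv_sub, (hρ n).deriv.kerAvg_sub (hρ m).deriv (h.locallyIntegrable s hs), Pi.sub_apply]
  obtain ⟨V, hVsm, hVmem, hVlim⟩ := exists_memLp_two_limit hVL (fun δ hδ => by
    obtain ⟨N, hN⟩ := hfc δ hδ
    exact ⟨N, fun n hn m hm => (hVc n m).trans (hN n hn m hm)⟩)
  have hVle : eLpNorm V 2 (volume.restrict J) ≤ eLpNorm f 2 volume :=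
    eLpNorm_le_of_tendsto_eLpNorm hVm hVmem.1 hfnorm hVlim fun k => h.energy_deriv (hρ k)
  -- the gradients
  have hGc : ∀ n m, ∀ s ∈ closure J, edist (kerAvg (ρ n) G s) (kerAvg (ρ m) G s)
      ≤ eLpNorm (kerAvg (ρ n) f - kerAvg (ρ m) f) 2 volume := by
    intro n m s hs
    rw [hfsub, edist_eq_enorm_sub,
      ← (hρ n).kerAvg_sub (hρ m) (h.memLp_grad.locallyIntegrable_indicator_Iic s)]
    exact h.energy_grad ((hρ n).sub (hρ m)) hs
  have hGcs : ∀ s ∈ closure J, CauchySeq fun k => kerAvg (ρ k) G s := by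
    intro s hs
    rw [EMetric.cauchySeq_iff]
    intro δ hδ
    obtain ⟨δ', h0, h1⟩ := exists_between hδ
    obtain ⟨N, hN⟩ := hfc δ' h0
    exact ⟨N, fun n hn m hm => ((hGc n m s hs).trans (hN n hn m hm)).trans_lt h1⟩
  have hGex : ∀ s, ∃ g, s ∈ closure J → Tendsto (fun k => kerAvg (ρ k) G s) atTop (𝓝 g) := by
    intro s
    by_cases hs : s ∈ closure J
    · obtain ⟨g, hg⟩ := cauchySeq_tendsto_of_complete (hGcs s hs)
      exact ⟨g, fun _ => hg⟩
    · exact ⟨0, fun h => absurd h hs⟩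
  choose G' hG' using hGex
  have hGunif : TendstoUniformlyOn (fun k => kerAvg (ρ k) G) G' atTop (closure J) := by
    refine UniformCauchySeqOn.tendstoUniformlyOn_of_tendsto ?_ hG'
    rw [Metric.uniformCauchySeqOn_iff]
    intro δ hδ
    obtain ⟨δ', h0, h1⟩ := exists_between (ENNReal.ofReal_pos.2 hδ)
    obtain ⟨N, hN⟩ := hfc δ' h0
    refine ⟨N, fun n hn m hm s hs => edist_lt_ofReal.1 ?_⟩
    exact ((hGc n m s hs).trans (hN n hn m hm)).trans_lt h1
  have hG'cont : ContinuousOn G' (closure J) :=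
    hGunif.continuousOn (Frequently.of_forall fun k => ((hρ k).continuous hGloc).continuousOn)
  -- the continuous representative
  have hune := ae_tendsto_kerAvg h hκ hκs he he0
  -- A time at which the averages of `u` converge serves as an anchor; the continuous representative
  -- is the primitive of `V` through `u r`.
  obtain ⟨r, hrJ, hr⟩ : ∃ r ∈ J, Tendsto (fun k => kerAvg (ρ k) u r) atTop (𝓝 (u r)) := by
    have : NeBot (ae (volume.restrict J)) := by
      rw [ae_neBot, ne_eq, Measure.restrict_eq_zero]
      exact (h.isOpen.measure_pos volume h.nonempty).ne'
    obtain ⟨r, hr, hrJ⟩ := (hune.and (ae_restrict_mem hJm)).exists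
    exact ⟨r, hrJ, hr⟩
  -- Extended by zero, `V` is square integrable on the line, and its primitive is continuous also at
  -- the end point of `J`.
  set V' := J.indicator V with hV'
  have hV'mem : MemLp V' 2 volume := (memLp_indicator_iff_restrict hJm).2 hVmem
  have hV'loc : LocallyIntegrable V' := hV'mem.locallyIntegrable (by norm_num)
  have hV'int : ∀ a b, IntervalIntegrable V' volume a b := fun a b =>
    (hV'loc.integrableOn_isCompact isCompact_uIcc).intervalIntegrable
  set U : ℝ → X := fun s => u r + ∫ t in r..s, V' t with hU
  have hUcont : Continuous U :=
    continuous_const.add (intervalIntegral.continuous_primitive hV'int r)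
  have hV'eq : ∀ k, eLpNorm (kerAvg (deriv (ρ k)) u - V') 2 (volume.restrict J)
      = eLpNorm (kerAvg (deriv (ρ k)) u - V) 2 (volume.restrict J) := fun k =>
    eLpNorm_congr_ae (by
      filter_upwards [ae_restrict_mem hJm] with s hs
      rw [Pi.sub_apply, Pi.sub_apply, hV', indicator_of_mem hs])
  have hV'lim : Tendsto (fun k => eLpNorm (kerAvg (deriv (ρ k)) u - V') 2 (volume.restrict J))
      atTop (𝓝 0) := by simpa only [hV'eq] using hVlim
  have hVint : ∀ k a b, Icc a b ⊆ J → ∀ s ∈ Icc a b, ∀ t ∈ Icc a b,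
      IntervalIntegrable (kerAvg (deriv (ρ k)) u) volume s t := fun k a b hab s hs t ht =>
    ((h.continuousOn_kerAvg (hρ k).deriv).mono
      ((ordConnected_Icc.uIcc_subset hs ht).trans hab)).intervalIntegrable
  have hUk : ∀ a b, Icc a b ⊆ J → r ∈ Icc a b → ∀ k, ∀ s ∈ Icc a b,
      ‖kerAvg (ρ k) u s - U s‖ₑ ≤ ‖kerAvg (ρ k) u r - u r‖ₑ
        + eLpNorm (kerAvg (deriv (ρ k)) u - V') 2 (volume.restrict J)
          * ENNReal.ofReal (b - a) ^ (1 / 2 : ℝ) := by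
    intro a b hab hra k s hs
    have hftc := intervalIntegral.integral_eq_sub_of_hasDerivAt (a := r) (b := s)
      (fun t ht => h.hasDerivAt_kerAvg (hρ k) (hab (ordConnected_Icc.uIcc_subset hra hs ht)))
      (hVint k a b hab r hra s hs)
    have : kerAvg (ρ k) u s - U s = (kerAvg (ρ k) u r - u r)
        + ∫ t in r..s, (kerAvg (deriv (ρ k)) u - V') t := by
      simp only [Pi.sub_apply]
      rw [intervalIntegral.integral_sub (hVint k a b hab r hra s hs) (hV'int r s), hftc, hU]
      simp only
      abel
    rw [this]
    refine (enorm_add_le _ _).trans ?_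
    gcongr
    exact enorm_intervalIntegral_le ((hVm k).sub hV'mem.1.restrict) hab hra hs
  have hUk0 : ∀ a b : ℝ, Tendsto (fun k => ‖kerAvg (ρ k) u r - u r‖ₑ
        + eLpNorm (kerAvg (deriv (ρ k)) u - V') 2 (volume.restrict J)
          * ENNReal.ofReal (b - a) ^ (1 / 2 : ℝ)) atTop (𝓝 0) := by
    intro a b
    have h1 : Tendsto (fun k => ‖kerAvg (ρ k) u r - u r‖ₑ) atTop (𝓝 0) := by
      have := (hr.sub_const (u r)).enorm
      simpa using this
    have h2 := ENNReal.Tendsto.mul_const (b := ENNReal.ofReal (b - a) ^ (1 / 2 : ℝ)) hV'lim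
      (Or.inr (ENNReal.rpow_ne_top_of_nonneg (by norm_num) ENNReal.ofReal_ne_top))
    simpa using h1.add h2
  have hUpt : ∀ s ∈ J, Tendsto (fun k => kerAvg (ρ k) u s) atTop (𝓝 (U s)) := by
    intro s hs
    have hab : Icc (min r s) (max r s) ⊆ J := fun t ht =>
      h.isLowerSet ht.2 (by rcases max_choice r s with h | h <;> rw [h] <;> assumption)
    rw [tendsto_iff_edist_tendsto_0]
    refine tendsto_of_tendsto_of_tendsto_of_le_of_le tendsto_const_nhds
      (hUk0 (min r s) (max r s)) (fun _ => zero_le) fun k => ?_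
    rw [edist_eq_enorm_sub]
    exact hUk _ _ hab ⟨min_le_left _ _, le_max_left _ _⟩ k s ⟨min_le_right _ _, le_max_right _ _⟩
  have hUu : ∀ᵐ s ∂volume.restrict J, U s = u s := by
    filter_upwards [hune, ae_restrict_mem hJm] with s hs hsJ
    exact tendsto_nhds_unique (hUpt s hsJ) hs
  have hG'G : ∀ᵐ s ∂volume.restrict J, G' s = G s := by
    filter_upwards [ae_restrict_of_ae (ae_tendsto_avg hκ hκs he he0 hGloc),
      ae_restrict_mem hJm] with s hs hsJ
    simp only [avg_eq_kerAvg κ (he _)] at hs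
    exact tendsto_nhds_unique (hG' s (subset_closure hsJ)) hs
  -- In `J` the pair is a limit of elements of the closed set `W`; continuity of both components
  -- carries membership to the end point.
  have hmem : ∀ s ∈ closure J, (U s, G' s) ∈ W := by
    have h1 : MapsTo (fun s => (U s, G' s)) J W := fun s hs =>
      h.isClosed.mem_of_tendsto ((hUpt s hs).prodMk_nhds (hG' s (subset_closure hs)))
        (Eventually.of_forall fun k => h.mem_kerAvg (hρ k) hs)
    have h2 := h1.closure_of_continuousOn (hUcont.continuousOn.prodMk hG'cont)
    rw [h.isClosed.closure_eq] at h2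
    exact fun s hs => h2 hs
  -- A uniform limit of functions that vanish at infinity vanishes at infinity.
  have hzero : ∀ l : Filter ℝ, l ≤ cocompact ℝ → (∀ᶠ s in l, s ∈ closure J) →
      Tendsto G' l (𝓝 0) := by
    intro l hl hlJ
    rw [Metric.tendsto_nhds]
    intro δ hδ
    obtain ⟨k, hk⟩ := (Metric.tendstoUniformlyOn_iff.1 hGunif (δ / 2) (by positivity)).exists
    filter_upwards [hlJ, Metric.tendsto_nhds.1
      (((hρ k).tendsto_zero h.memLp_grad).mono_left hl) (δ / 2) (by positivity)] with s h1 h2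
    calc _ ≤ _ := dist_triangle _ (kerAvg (ρ k) G s) _
      _ < δ / 2 + δ / 2 := add_lt_add (hk s h1) h2
      _ = δ := add_halves δ
  refine ⟨V, U, G', hVmem, hVle, hUu, hUcont.continuousOn, hG'G, hG'cont, hmem, ?_, ?_,
    hzero _ atBot_le_cocompact ?_, fun hJ => hzero _ atTop_le_cocompact (by simp [hJ]), ?_⟩
  · intro ψ hψ hψc hψJ
    -- The interval has to contain `r` as well as the support of `ψ`, since the uniform control of
    -- the averages starts at `r`.
    obtain ⟨a, b, hab, hra, hsupp⟩ : ∃ a b, Icc a b ⊆ J ∧ r ∈ Icc a b ∧ tsupport ψ ⊆ Ioo a b := by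
      obtain ⟨M, hM⟩ := (hψc.isCompact.insert r).exists_isGreatest (insert_nonempty _ _)
      obtain ⟨m, hm⟩ := (hψc.isCompact.insert r).exists_isLeast (insert_nonempty _ _)
      have hMJ : M ∈ J := insert_subset hrJ hψJ hM.1
      obtain ⟨δ, hδ, hball⟩ := Metric.isOpen_iff.1 h.isOpen M hMJ
      have hb : M + δ / 2 ∈ J := hball (by
        rw [Metric.mem_ball, Real.dist_eq, abs_lt]; constructor <;> linarith)
      refine ⟨m - 1, M + δ / 2, fun t ht => h.isLowerSet ht.2 hb, ?_, fun t ht => ?_⟩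
      · have h1 := hM.2 (mem_insert r _)
        have h2 := hm.2 (mem_insert r _)
        constructor <;> linarith
      · have h1 := hM.2 (mem_insert_of_mem r ht)
        have h2 := hm.2 (mem_insert_of_mem r ht)
        constructor <;> linarith
    have hle : a ≤ b := hra.1.trans hra.2
    have haJ := left_mem_Icc.2 hle
    have hbJ := right_mem_Icc.2 hle
    have hψ0 : ∀ t, t ∉ Ioo a b → ψ t = 0 := fun t ht =>
      image_eq_zero_of_notMem_tsupport fun h => ht (hsupp h)
    have hψ'0 : ∀ t, t ∉ Ioo a b → deriv ψ t = 0 := fun t ht =>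
      image_eq_zero_of_notMem_tsupport fun h => ht (hsupp (closure_minimal
        (support_deriv_subset) (isClosed_tsupport ψ) h))
    have hψ'c : Continuous (deriv ψ) := hψ.continuous_deriv (by simp)
    have hset : ∀ F : ℝ → X, (∀ t, t ∉ Ioo a b → F t = 0) → ∫ s in J, F s = ∫ s in a..b, F s := by
      intro F hF
      rw [intervalIntegral.integral_of_le hle]
      refine setIntegral_eq_of_subset_of_forall_sdiff_eq_zero hJm
        (Ioc_subset_Icc_self.trans hab) fun t ht => hF t fun h => ht.2 (Ioo_subset_Ioc_self h)
    have hJV : ∫ s in J, ψ s • V s = ∫ s in J, ψ s • V' s :=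
      setIntegral_congr_fun hJm fun s hs => by simp only [hV', indicator_of_mem hs]
    rw [hJV, hset _ fun t ht => by rw [hψ'0 t ht, zero_smul],
      hset _ fun t ht => by rw [hψ0 t ht, zero_smul], ← add_eq_zero_iff_eq_neg]
    have hk : ∀ k, (∫ s in a..b, deriv ψ s • kerAvg (ρ k) u s)
        + ∫ s in a..b, ψ s • kerAvg (deriv (ρ k)) u s = 0 := by
      intro k
      have hi1 : IntervalIntegrable (fun s => deriv ψ s • kerAvg (ρ k) u s) volume a b := by
        refine ContinuousOn.intervalIntegrable ?_
        rw [uIcc_of_le hle]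
        exact hψ'c.continuousOn.smul ((h.continuousOn_kerAvg (hρ k)).mono hab)
      have hi2 : IntervalIntegrable (fun s => ψ s • kerAvg (deriv (ρ k)) u s) volume a b := by
        refine ContinuousOn.intervalIntegrable ?_
        rw [uIcc_of_le hle]
        exact hψ.continuous.continuousOn.smul ((h.continuousOn_kerAvg (hρ k).deriv).mono hab)
      rw [← intervalIntegral.integral_add hi1 hi2]
      have := intervalIntegral.integral_eq_sub_of_hasDerivAt (a := a) (b := b)
        (f := fun s => ψ s • kerAvg (ρ k) u s)
        (f' := fun s => deriv ψ s • kerAvg (ρ k) u s + ψ s • kerAvg (deriv (ρ k)) u s)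
        (fun t ht => by
          rw [uIcc_of_le hle] at ht
          have := ((hψ.differentiable (by simp) t).hasDerivAt).smul
            (h.hasDerivAt_kerAvg (hρ k) (hab ht))
          rwa [add_comm] at this) (hi1.add hi2)
      rw [this, hψ0 b (by simp), hψ0 a (by simp), zero_smul, zero_smul, sub_zero]
    have hl1 : Tendsto (fun k => ∫ s in a..b, deriv ψ s • kerAvg (ρ k) u s) atTop
        (𝓝 (∫ s in a..b, deriv ψ s • U s)) := by
      have hev : ∀ᶠ k in atTop, ∀ s ∈ Icc a b, ‖kerAvg (ρ k) u s - U s‖ ≤ 1 := by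
        filter_upwards [(hUk0 a b).eventually_lt_const (u := 1) (by simp)] with k hk s hs
        have := (hUk a b hab hra k s hs).trans hk.le
        rwa [← ofReal_norm, ENNReal.ofReal_le_one] at this
      refine intervalIntegral.tendsto_integral_filter_of_dominated_convergence
        (fun s => ‖deriv ψ s‖ * (1 + ‖U s‖)) ?_ ?_ ?_ ?_
      · refine Eventually.of_forall fun k => ContinuousOn.aestronglyMeasurable ?_
          measurableSet_uIoc
        rw [uIoc_of_le hle]
        exact hψ'c.continuousOn.smul ((h.continuousOn_kerAvg (hρ k)).mono
          (Ioc_subset_Icc_self.trans hab))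
      · filter_upwards [hev] with k hk
        refine ae_of_all _ fun s hs => ?_
        rw [uIoc_of_le hle] at hs
        rw [norm_smul]
        gcongr
        have h1 := hk s (Ioc_subset_Icc_self hs)
        have h2 := norm_le_norm_sub_add (kerAvg (ρ k) u s) (U s)
        linarith
      · exact (hψ'c.norm.mul (continuous_const.add hUcont.norm)).intervalIntegrable _ _
      · refine ae_of_all _ fun s hs => ?_
        rw [uIoc_of_le hle] at hs
        exact (hUpt s (hab (Ioc_subset_Icc_self hs))).const_smul _
    have hl2 : Tendsto (fun k => ∫ s in a..b, ψ s • kerAvg (deriv (ρ k)) u s) atTop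
        (𝓝 (∫ s in a..b, ψ s • V' s)) := by
      obtain ⟨C, hC⟩ := hψ.continuous.bounded_above_of_compact_support hψc
      have hlim := ENNReal.Tendsto.mul_const (b := ENNReal.ofReal (b - a) ^ (1 / 2 : ℝ))
        (ENNReal.Tendsto.const_mul (a := ENNReal.ofReal C) hV'lim (Or.inr ENNReal.ofReal_ne_top))
        (Or.inr (ENNReal.rpow_ne_top_of_nonneg (by norm_num) ENNReal.ofReal_ne_top))
      rw [mul_zero, zero_mul] at hlim
      rw [tendsto_iff_edist_tendsto_0]
      refine tendsto_of_tendsto_of_tendsto_of_le_of_le tendsto_const_nhds hlim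
        (fun _ => zero_le) fun k => ?_
      have hi1 : IntervalIntegrable (fun s => ψ s • kerAvg (deriv (ρ k)) u s) volume a b := by
        refine ContinuousOn.intervalIntegrable ?_
        rw [uIcc_of_le hle]
        exact hψ.continuous.continuousOn.smul ((h.continuousOn_kerAvg (hρ k).deriv).mono hab)
      have hi2 : IntervalIntegrable (fun s => ψ s • V' s) volume a b :=
        (hV'int a b).continuousOn_smul hψ.continuous.continuousOn
      simp only
      rw [edist_eq_enorm_sub, ← intervalIntegral.integral_sub hi1 hi2]
      simp only [← smul_sub]
      refine (enorm_intervalIntegral_le (J := J) ?_ hab haJ hbJ).trans ?_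
      · exact hψ.continuous.aestronglyMeasurable.smul ((hVm k).sub hV'mem.1.restrict)
      · gcongr
        refine eLpNorm_le_mul_eLpNorm_of_ae_le_mul (ae_of_all _ fun s => ?_) 2
        rw [norm_smul]
        exact mul_le_mul_of_nonneg_right (hC s) (norm_nonneg _)
    have := hl1.add hl2
    simp only [hk] at this
    exact (tendsto_nhds_unique this tendsto_const_nhds)
  -- Along a subsequence all three averages converge at almost every time, and the exceptional set
  -- does not depend on `p`.
  · obtain ⟨ns, hns, hnsV⟩ := exists_subseq_tendsto_ae hVm hVmem.1 hVlim
    filter_upwards [hnsV, ae_restrict_of_ae (ae_tendsto_avg hκ hκs he he0 hfloc),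
      ae_restrict_mem hJm] with s h1 h2 hsJ p hp
    simp only [avg_eq_kerAvg κ (he _)] at h2
    have h3 := (hG' s (subset_closure hsJ)).comp hns.tendsto_atTop
    have h4 := h2.comp hns.tendsto_atTop
    have hl := (Tendsto.inner (𝕜 := ℝ) h1 (tendsto_const_nhds (x := p.1))).add
      (Tendsto.inner (𝕜 := ℝ) h3 (tendsto_const_nhds (x := p.2)))
    have hr := Tendsto.inner (𝕜 := ℝ) h4 (tendsto_const_nhds (x := p.1))
    refine tendsto_nhds_unique (hl.congr fun k => ?_) hr
    exact h.inner_kerAvg (hρ (ns k)) hsJ hp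
  · filter_upwards [eventually_le_atBot r] with s hs
    exact subset_closure (h.isLowerSet hs hrJ)
  -- Every average at `s` sees only times before `s`, where `G` vanishes.
  · intro s hs hz
    refine tendsto_nhds_unique (hG' s hs) (tendsto_const_nhds.congr fun k => ?_)
    rw [(hρ k).kerAvg_congr (F' := fun _ => 0) hz]
    simp [kerAvg]

end IsWeakEvolution

end Evolution

namespace HalfSpace

/-! ### The weighted measures -/

/-- The weight `r ^ τ` on the positive half line, extended by zero. -/
noncomputable def wt (τ r : ℝ) : ℝ≥0∞ := (Ioi (0 : ℝ)).indicator (fun r => ENNReal.ofReal (r ^ τ)) r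

lemma measurable_wt (τ : ℝ) : Measurable (wt τ) :=
  (measurable_id.pow_const τ).ennreal_ofReal.indicator measurableSet_Ioi

lemma wt_of_pos (τ : ℝ) {r : ℝ} (hr : 0 < r) : wt τ r = ENNReal.ofReal (r ^ τ) :=
  indicator_of_mem (by exact hr) _

lemma wt_of_nonpos (τ : ℝ) {r : ℝ} (hr : r ≤ 0) : wt τ r = 0 :=
  indicator_of_notMem (by simpa using hr) _

lemma wt_mul (τ : ℝ) {ε : ℝ} (hε : 0 < ε) (r : ℝ) :
    wt τ (ε * r) = ENNReal.ofReal (ε ^ τ) * wt τ r := by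
  rcases le_or_gt r 0 with hr | hr
  · rw [wt_of_nonpos τ hr, wt_of_nonpos τ (mul_nonpos_of_nonneg_of_nonpos hε.le hr), mul_zero]
  · rw [wt_of_pos τ hr, wt_of_pos τ (mul_pos hε hr), Real.mul_rpow hε.le hr.le,
      ENNReal.ofReal_mul (by positivity)]

variable {d : ℕ}

lemma isOpen_openHalf : IsOpen (openHalf d) :=
  isOpen_lt continuous_const (by fun_prop)

lemma measurable_last : Measurable fun y : E d => y (Fin.last d) := by fun_prop

lemma lintegral_mu (τ : ℝ) {h : E d → ℝ≥0∞} (hh : Measurable h) :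
    ∫⁻ y, h y ∂mu d τ = ∫⁻ y, wt τ (y (Fin.last d)) * h y := by
  rw [mu, lintegral_withDensity_eq_lintegral_mul _
    ((measurable_last.pow_const τ).ennreal_ofReal) hh,
    ← lintegral_indicator isOpen_openHalf.measurableSet]
  congr 1
  ext y
  by_cases hy : y ∈ openHalf d
  · rw [indicator_of_mem hy, wt_of_pos τ hy, Pi.mul_apply]
  · rw [indicator_of_notMem hy, wt_of_nonpos τ (by simpa [openHalf] using hy), zero_mul]

lemma mu_absolutelyContinuous (τ : ℝ) : mu d τ ≪ volume.restrict (openHalf d) :=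
  withDensity_absolutelyContinuous _ _

/-- The weight is positive on `H`. All weighted measures thus have the null sets of Lebesgue measure
on `H`, so elements of spaces with different exponents can be compared almost everywhere. -/
lemma absolutelyContinuous_mu (τ : ℝ) : volume.restrict (openHalf d) ≪ mu d τ := by
  refine withDensity_absolutelyContinuous' (measurable_last.pow_const τ).ennreal_ofReal.aemeasurable
    ?_
  filter_upwards [ae_restrict_mem isOpen_openHalf.measurableSet] with y hy
  exact (ENNReal.ofReal_pos.2 (Real.rpow_pos_of_pos hy τ)).ne'

lemma ae_mu_mem (τ : ℝ) : ∀ᵐ y ∂mu d τ, y ∈ openHalf d :=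
  mu_absolutelyContinuous τ (ae_restrict_mem isOpen_openHalf.measurableSet)

lemma abs_apply_le_norm (y : E d) (i : Fin (d + 1)) : |y i| ≤ ‖y‖ := by
  simpa using PiLp.norm_apply_le y i

/-- The ball lies in a box, over which the weight is a product of functions of one variable; `r ^ τ`
is integrable at zero because `τ > -1`. -/
lemma mu_closedBall_lt_top {τ : ℝ} (hτ : -1 < τ) (R : ℝ) :
    mu d τ (Metric.closedBall 0 R) < ⊤ := by
  let f : Fin (d + 1) → ℝ → ℝ := fun i => if i = Fin.last d then
    (Ioc 0 R).indicator (fun t => t ^ τ) else (Icc (-R) R).indicator fun _ => 1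
  have hf : ∀ i, Integrable (f i) := by
    intro i
    by_cases hi : i = Fin.last d
    · simp only [f, hi, if_true]
      refine IntegrableOn.integrable_indicator ?_ measurableSet_Ioc
      rcases le_or_gt 0 R with hR | hR
      · exact (intervalIntegrable_iff_integrableOn_Ioc_of_le hR).1
          (intervalIntegral.intervalIntegrable_rpow' hτ)
      · rw [Ioc_eq_empty (by linarith)]; exact integrableOn_empty
    · simp only [f, hi, if_false]
      refine IntegrableOn.integrable_indicator ?_ measurableSet_Icc
      exact integrableOn_const (by simp)
  have hf0 : ∀ i t, 0 ≤ f i t := by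
    intro i t
    by_cases hi : i = Fin.last d
    · simp only [f, hi, if_true]
      exact indicator_nonneg (fun t ht => Real.rpow_nonneg ht.1.le τ) t
    · simp only [f, hi, if_false]
      exact indicator_nonneg (fun t ht => zero_le_one) t
  have hprod : Integrable fun y : E d => ∏ i, f i (y i) :=
    (PiLp.volume_preserving_ofLp (Fin (d + 1))).integrable_comp_of_integrable
      (Integrable.fintype_prod hf)
  have hle : ∀ y : E d, wt τ (y (Fin.last d)) * (Metric.closedBall (0 : E d) R).indicator 1 y
      ≤ ENNReal.ofReal (∏ i, f i (y i)) := by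
    intro y
    by_cases hy : y ∈ Metric.closedBall (0 : E d) R
    · rcases le_or_gt (y (Fin.last d)) 0 with h0 | h0
      · rw [wt_of_nonpos τ h0, zero_mul]; exact zero_le
      · rw [indicator_of_mem hy, Pi.one_apply, mul_one, wt_of_pos τ h0]
        refine ENNReal.ofReal_le_ofReal (le_of_eq ?_)
        rw [mem_closedBall_zero_iff] at hy
        have hyi : ∀ i, |y i| ≤ R := fun i => (abs_apply_le_norm y i).trans hy
        rw [Finset.prod_eq_single (Fin.last d)]
        · simp only [f, if_true]
          rw [indicator_of_mem (show _ ∈ Ioc 0 R from ⟨h0, (abs_le.1 (hyi _)).2⟩)]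
        · intro i _ hi
          simp only [f, hi, if_false]
          rw [indicator_of_mem (show _ ∈ Icc (-R) R from abs_le.1 (hyi i))]
        · simp
    · rw [indicator_of_notMem hy, mul_zero]; exact zero_le
  have hB : MeasurableSet (Metric.closedBall (0 : E d) R) := measurableSet_closedBall
  calc mu d τ (Metric.closedBall 0 R)
      = ∫⁻ y, (Metric.closedBall (0 : E d) R).indicator 1 y ∂mu d τ := by
        rw [lintegral_indicator_one hB]
    _ = ∫⁻ y, wt τ (y (Fin.last d)) * (Metric.closedBall (0 : E d) R).indicator 1 y :=
        lintegral_mu τ (measurable_one.indicator hB)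
    _ ≤ ∫⁻ y : E d, ENNReal.ofReal (∏ i, f i (y i)) := lintegral_mono hle
    _ < ⊤ := by
        rw [← ofReal_integral_eq_lintegral_ofReal hprod
          (ae_of_all _ fun y => Finset.prod_nonneg fun i _ => hf0 i _)]
        exact ENNReal.ofReal_lt_top

lemma isLocallyFiniteMeasure_mu {τ : ℝ} (hτ : -1 < τ) : IsLocallyFiniteMeasure (mu d τ) where
  finiteAtNhds x := ⟨Metric.closedBall 0 (‖x‖ + 1),
    mem_of_superset (Metric.ball_mem_nhds x one_pos) fun y hy => by
      rw [mem_closedBall_zero_iff]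
      have := norm_le_norm_add_norm_sub' y x
      rw [Metric.mem_ball, dist_eq_norm] at hy
      rw [norm_sub_rev] at this
      linarith [norm_sub_rev x y], mu_closedBall_lt_top hτ _⟩

/-! ### Averages in the upward direction -/

/-- A mollifier on `ℝⁿ` such that `avg κ ε F y` only looks at points above `y`. -/
structure IsUpKernel (κ : E d → ℝ) : Prop extends IsMollifier κ where
  last_mem : ∀ t ∈ tsupport κ, t (Fin.last d) ∈ Icc (-2 : ℝ) (-1)

lemma exists_isUpKernel (d : ℕ) : ∃ κ : E d → ℝ, IsUpKernel κ := by
  -- A bump of outer radius `1/2` about height `-3/2` has heights between `-2` and `-1`.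
  let c : E d := EuclideanSpace.single (Fin.last d) (-(3 / 2) : ℝ)
  let b : ContDiffBump c := ⟨1 / 4, 1 / 2, by norm_num, by norm_num⟩
  refine ⟨b.normed volume, ⟨b.contDiff_normed, b.hasCompactSupport_normed, b.nonneg_normed,
    b.integral_normed⟩, fun t ht => ?_⟩
  rw [b.tsupport_normed_eq, Metric.mem_closedBall, dist_eq_norm] at ht
  have h1 := (abs_apply_le_norm (t - c) (Fin.last d)).trans ht
  simp only [PiLp.sub_apply, c, PiLp.single_apply, if_true, b] at h1
  rw [abs_le] at h1
  constructor <;> linarith [h1.1, h1.2]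

/-- For `τ ≥ 0` the weight decreases downwards and the constant is one. For `τ < 0` and `a ≥ 4` the
shifted height is still at least `a / 2`. For `0 < a < 4` the left side is bounded by the mass of a
fixed ball, while the weight at `a` is at least `4 ^ τ`. -/
lemma exists_lintegral_wt_le {κ : E d → ℝ} (hκ : IsUpKernel κ) {τ : ℝ} (hτ : -1 < τ) :
    ∃ C : ℝ≥0∞, C ≠ ⊤ ∧ ∀ a, ∫⁻ t, ENNReal.ofReal (κ t) * wt τ (a + t (Fin.last d)) ≤ C * wt τ a := by
  have hpt : ∀ (K : ℝ≥0∞) (a : ℝ),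
      (∀ t ∈ tsupport κ, wt τ (a + t (Fin.last d)) ≤ K * wt τ a) →
      ∫⁻ t, ENNReal.ofReal (κ t) * wt τ (a + t (Fin.last d)) ≤ K * wt τ a := by
    intro K a h
    calc _ ≤ ∫⁻ t, ENNReal.ofReal (κ t) * (K * wt τ a) := lintegral_mono fun t => by
          by_cases ht : t ∈ tsupport κ
          · exact mul_le_mul_right (h t ht) _
          · simp [image_eq_zero_of_notMem_tsupport ht]
      _ = _ := by
          rw [lintegral_mul_const _ hκ.contDiff.continuous.measurable.ennreal_ofReal,
            hκ.lintegral_eq, one_mul]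
  have hneg : ∀ a ≤ 0, ∀ (K : ℝ≥0∞), ∫⁻ t, ENNReal.ofReal (κ t) * wt τ (a + t (Fin.last d))
      ≤ K * wt τ a := fun a ha K => hpt K a fun t ht => by
    rw [wt_of_nonpos τ (by linarith [(hκ.last_mem t ht).2])]; exact zero_le
  rcases le_or_gt 0 τ with hτ0 | hτ0
  · refine ⟨1, ENNReal.one_ne_top, fun a => ?_⟩
    rcases le_or_gt a 0 with ha | ha
    · exact hneg a ha 1
    refine hpt 1 a fun t ht => ?_
    rw [one_mul]
    rcases le_or_gt (a + t (Fin.last d)) 0 with h | h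
    · rw [wt_of_nonpos τ h]; exact zero_le
    · rw [wt_of_pos τ h, wt_of_pos τ ha]
      exact ENNReal.ofReal_le_ofReal (Real.rpow_le_rpow h.le
        (by linarith [(hκ.last_mem t ht).2]) hτ0)
  · obtain ⟨R, hR⟩ := hκ.hasCompactSupport.isCompact.isBounded.subset_closedBall 0
    obtain ⟨M, hM⟩ := hκ.contDiff.continuous.bounded_above_of_compact_support hκ.hasCompactSupport
    set K₁ : ℝ≥0∞ := ENNReal.ofReal M * mu d τ (Metric.closedBall 0 (R + 4)) with hK₁
    have hK₁' : K₁ ≠ ⊤ := ENNReal.mul_ne_top ENNReal.ofReal_ne_top (mu_closedBall_lt_top hτ _).ne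
    set K₂ : ℝ≥0∞ := ENNReal.ofReal (2 ^ (-τ)) with hK₂
    set K₃ : ℝ≥0∞ := K₁ * ENNReal.ofReal (4 ^ (-τ)) with hK₃
    refine ⟨K₂ + K₃, by finiteness, fun a => ?_⟩
    rcases le_or_gt a 0 with ha | ha
    · exact hneg a ha _
    rcases le_or_gt 4 a with ha4 | ha4
    · refine (hpt K₂ a fun t ht => ?_).trans (mul_le_mul_left le_self_add _)
      have h1 := (hκ.last_mem t ht).1
      rw [wt_of_pos τ (by linarith), wt_of_pos τ ha, hK₂,
        ← ENNReal.ofReal_mul (by positivity)]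
      refine ENNReal.ofReal_le_ofReal ?_
      calc _ ≤ (a / 2) ^ τ := Real.rpow_le_rpow_of_nonpos (by positivity) (by linarith) hτ0.le
        _ = _ := by
          rw [Real.div_rpow ha.le (by norm_num), Real.rpow_neg (by norm_num)]
          field_simp
    · have hB : MeasurableSet (Metric.closedBall (0 : E d) (R + 4)) := measurableSet_closedBall
      have h1 : ∫⁻ t, ENNReal.ofReal (κ t) * wt τ (a + t (Fin.last d)) ≤ K₁ := by
        set e : E d := EuclideanSpace.single (Fin.last d) a
        calc _ ≤ ∫⁻ t : E d, ENNReal.ofReal M * (wt τ ((t + e) (Fin.last d))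
                * (Metric.closedBall (0 : E d) (R + 4)).indicator 1 (t + e)) := by
              refine lintegral_mono fun t => ?_
              by_cases ht : t ∈ tsupport κ
              · have h2 : t + e ∈ Metric.closedBall (0 : E d) (R + 4) := by
                  have := hR ht
                  rw [mem_closedBall_zero_iff] at this ⊢
                  refine (norm_add_le _ _).trans (add_le_add this ?_)
                  simp only [e, PiLp.norm_single, Real.norm_eq_abs, abs_of_pos ha]
                  exact ha4.le
                rw [indicator_of_mem h2, Pi.one_apply, mul_one]
                have h3 : (t + e) (Fin.last d) = a + t (Fin.last d) := by
                  simp [e, add_comm]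
                rw [h3]
                gcongr
                exact (le_abs_self _).trans (hM t)
              · simp [image_eq_zero_of_notMem_tsupport ht]
          _ = ∫⁻ t : E d, ENNReal.ofReal M * (wt τ (t (Fin.last d))
                * (Metric.closedBall (0 : E d) (R + 4)).indicator 1 t) :=
              lintegral_add_right_eq_self (μ := (volume : Measure (E d)))
                (fun t => ENNReal.ofReal M * (wt τ (t (Fin.last d))
                * (Metric.closedBall (0 : E d) (R + 4)).indicator 1 t)) e
          _ = K₁ := by
              have hmB : Measurable fun t : E d => wt τ (t (Fin.last d))
                  * (Metric.closedBall (0 : E d) (R + 4)).indicator 1 t :=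
                ((measurable_wt τ).comp measurable_last).mul (measurable_one.indicator hB)
              rw [lintegral_const_mul _ hmB, ← lintegral_mu τ (measurable_one.indicator hB),
                lintegral_indicator_one hB]
      refine h1.trans ?_
      calc K₁ ≤ K₁ * (ENNReal.ofReal (4 ^ (-τ)) * wt τ a) := by
            refine le_mul_of_one_le_right' ?_
            rw [wt_of_pos τ ha, ← ENNReal.ofReal_mul (by positivity), ← ENNReal.ofReal_one]
            refine ENNReal.ofReal_le_ofReal ?_
            have := Real.rpow_le_rpow_of_nonpos ha ha4.le hτ0.le
            rw [Real.rpow_neg (by norm_num), ← div_eq_inv_mul, one_le_div (by positivity)]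
            exact this
        _ = K₃ * wt τ a := by rw [hK₃]; ring
        _ ≤ _ := mul_le_mul_left le_add_self _

/-- Fubini moves the translation onto the weight. By the homogeneity `wt_mul` the scale `ε` drops
out, so one constant serves all `ε`. -/
lemma exists_avgBound_mu {κ : E d → ℝ} (hκ : IsUpKernel κ) {τ : ℝ} (hτ : -1 < τ) :
    ∃ C : ℝ≥0∞, C ≠ ⊤ ∧ ∀ ε, 0 < ε → AvgBound κ ε (mu d τ) C := by
  obtain ⟨K, hK, hKle⟩ := exists_lintegral_wt_le hκ hτ
  -- `K ≤ (K + 1) ^ 2` replaces taking a square root of `K`.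
  refine ⟨K + 1, by finiteness, fun ε hε h hh => ?_⟩
  have hm : Measurable fun t => ENNReal.ofReal (κ t) :=
    hκ.contDiff.continuous.measurable.ennreal_ofReal
  have hw := measurable_wt τ
  have hl : Measurable fun y : E d => y (Fin.last d) := measurable_last
  have hm2 : Measurable fun p : E d × E d => ENNReal.ofReal (κ p.2) * h (p.1 - ε • p.2) :=
    (hm.comp measurable_snd).mul (hh.comp (measurable_fst.sub (measurable_snd.const_smul ε)))
  have hm3 : Measurable fun p : E d × E d => wt τ (p.1 (Fin.last d)) *
      (ENNReal.ofReal (κ p.2) * h (p.1 - ε • p.2)) :=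
    (hw.comp (hl.comp measurable_fst)).mul hm2
  have hm4 : Measurable fun p : E d × E d => wt τ ((p.1 + ε • p.2) (Fin.last d)) *
      (ENNReal.ofReal (κ p.2) * h p.1) :=
    (hw.comp (hl.comp (measurable_fst.add (measurable_snd.const_smul ε)))).mul
      ((hm.comp measurable_snd).mul (hh.comp measurable_fst))
  calc ∫⁻ y, (∫⁻ t, ENNReal.ofReal (κ t) * h (y - ε • t)) ∂mu d τ
      = ∫⁻ y : E d, ∫⁻ t, wt τ (y (Fin.last d)) * (ENNReal.ofReal (κ t) * h (y - ε • t)) := by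
        rw [lintegral_mu τ hm2.lintegral_prod_right']
        refine lintegral_congr fun y => ?_
        have hmy : Measurable fun t => ENNReal.ofReal (κ t) * h (y - ε • t) :=
          hm2.comp measurable_prodMk_left
        rw [lintegral_const_mul _ hmy]
    _ = ∫⁻ t, ∫⁻ y : E d, wt τ (y (Fin.last d)) * (ENNReal.ofReal (κ t) * h (y - ε • t)) :=
        lintegral_lintegral_swap hm3.aemeasurable
    _ = ∫⁻ t, ∫⁻ y : E d, wt τ ((y + ε • t) (Fin.last d)) * (ENNReal.ofReal (κ t) * h y) := by
        refine lintegral_congr fun t => ?_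
        rw [← lintegral_add_right_eq_self _ (ε • t)]
        simp only [add_sub_cancel_right]
    _ = ∫⁻ y : E d, ∫⁻ t, wt τ ((y + ε • t) (Fin.last d)) * (ENNReal.ofReal (κ t) * h y) :=
        (lintegral_lintegral_swap hm4.aemeasurable).symm
    _ ≤ ∫⁻ y : E d, K * (wt τ (y (Fin.last d)) * h y) := by
        refine lintegral_mono fun y => ?_
        have h1 : ∀ t : E d, wt τ ((y + ε • t) (Fin.last d)) * (ENNReal.ofReal (κ t) * h y)
            = ENNReal.ofReal (ε ^ τ) * h y * (ENNReal.ofReal (κ t)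
              * wt τ (ε⁻¹ * y (Fin.last d) + t (Fin.last d))) := by
          intro t
          have : (y + ε • t) (Fin.last d)
              = ε * (ε⁻¹ * y (Fin.last d) + t (Fin.last d)) := by
            simp only [PiLp.add_apply, PiLp.smul_apply, smul_eq_mul]
            field_simp
          rw [this, wt_mul τ hε]
          ring
        have hmm : Measurable fun t : E d => ENNReal.ofReal (κ t)
              * wt τ (ε⁻¹ * y (Fin.last d) + t (Fin.last d)) :=
          hm.mul (hw.comp (measurable_const.add hl))
        simp only [h1]
        rw [lintegral_const_mul _ hmm]
        calc _ ≤ ENNReal.ofReal (ε ^ τ) * h y * (K * wt τ (ε⁻¹ * y (Fin.last d))) := by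
              gcongr; exact hKle _
          _ = K * (ENNReal.ofReal (ε ^ τ) * wt τ (ε⁻¹ * y (Fin.last d)) * h y) := by ring
          _ = _ := by rw [← wt_mul τ hε, mul_inv_cancel_left₀ hε.ne']
    _ = K * ∫⁻ y, h y ∂mu d τ := by
        have hmh : Measurable fun y : E d => wt τ (y (Fin.last d)) * h y := (hw.comp hl).mul hh
        rw [lintegral_const_mul _ hmh, lintegral_mu τ hh]
    _ ≤ (K + 1) ^ 2 * ∫⁻ y, h y ∂mu d τ := by
        gcongr
        calc K ≤ K + 1 := le_self_add
          _ ≤ (K + 1) ^ 2 := le_self_pow₀ le_add_self two_ne_zero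

end HalfSpace

namespace HalfSpace

variable {d : ℕ}

/-! ### Classical derivatives -/

lemma contDiff_pd {φ : E d → ℝ} (hφ : ContDiff ℝ ∞ φ) (i : Fin (d + 1)) :
    ContDiff ℝ ∞ (pd i φ) :=
  (hφ.fderiv_right (m := ∞) (by simp)).clm_apply contDiff_const

lemma tsupport_pd_subset (φ : E d → ℝ) (i : Fin (d + 1)) : tsupport (pd i φ) ⊆ tsupport φ :=
  tsupport_fderiv_apply_subset ℝ _

lemma hasCompactSupport_pd {φ : E d → ℝ} (hφ : HasCompactSupport φ) (i : Fin (d + 1)) :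
    HasCompactSupport (pd i φ) :=
  hφ.of_isClosed_subset (isClosed_tsupport _) (tsupport_pd_subset φ i)

lemma IsTestOnHalf.pd {φ : E d → ℝ} (hφ : IsTestOnHalf φ) (i : Fin (d + 1)) :
    IsTestOnHalf (pd i φ) :=
  ⟨contDiff_pd hφ.1 i, hasCompactSupport_pd hφ.2.1 i, (tsupport_pd_subset φ i).trans hφ.2.2⟩

lemma pd_congr {φ ψ : E d → ℝ} {y : E d} (h : φ =ᶠ[𝓝 y] ψ) (i : Fin (d + 1)) :
    pd i φ y = pd i ψ y := by
  rw [pd, pd, h.fderiv_eq]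

lemma pd_mul {φ ψ : E d → ℝ} (hφ : ContDiff ℝ ∞ φ) (hψ : ContDiff ℝ ∞ ψ) (i : Fin (d + 1)) :
    pd i (fun y => φ y * ψ y) = fun y => φ y * pd i ψ y + pd i φ y * ψ y := by
  ext y
  rw [pd, fderiv_fun_mul (hφ.differentiable (by simp) y) (hψ.differentiable (by simp) y)]
  simp [pd]
  ring

lemma pd_add {φ ψ : E d → ℝ} (hφ : ContDiff ℝ ∞ φ) (hψ : ContDiff ℝ ∞ ψ) (i : Fin (d + 1)) :
    pd i (fun y => φ y + ψ y) = fun y => pd i φ y + pd i ψ y := by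
  ext y
  rw [pd, fderiv_fun_add (hφ.differentiable (by simp) y) (hψ.differentiable (by simp) y)]
  simp [pd]

lemma pd_sub {φ ψ : E d → ℝ} (hφ : ContDiff ℝ ∞ φ) (hψ : ContDiff ℝ ∞ ψ) (i : Fin (d + 1)) :
    pd i (fun y => φ y - ψ y) = fun y => pd i φ y - pd i ψ y := by
  ext y
  rw [pd, fderiv_fun_sub (hφ.differentiable (by simp) y) (hψ.differentiable (by simp) y)]
  simp [pd]

lemma pd_const_mul {φ : E d → ℝ} (hφ : ContDiff ℝ ∞ φ) (c : ℝ) (i : Fin (d + 1)) :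
    pd i (fun y => c * φ y) = fun y => c * pd i φ y := by
  ext y
  rw [pd, fderiv_const_mul (hφ.differentiable (by simp) y)]
  simp [pd]

lemma pd_comp_smul {φ : E d → ℝ} (hφ : ContDiff ℝ ∞ φ) (c : ℝ) (i : Fin (d + 1)) :
    pd i (fun y => φ (c • y)) = fun y => c * pd i φ (c • y) := by
  ext y
  have h := (hφ.differentiable (by simp) (c • y)).hasFDerivAt.comp y
    ((hasFDerivAt_id y).const_smul c)
  have h2 : fderiv ℝ (fun y => φ (c • y)) y
      = (fderiv ℝ φ (c • y)).comp (c • ContinuousLinearMap.id ℝ (E d)) := h.fderiv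
  rw [pd, h2]
  simp [pd]

lemma pd_comp_sub_left {φ : E d → ℝ} (hφ : ContDiff ℝ ∞ φ) (x : E d) (i : Fin (d + 1)) :
    pd i (fun y => φ (x - y)) = fun y => - pd i φ (x - y) := by
  ext y
  have h := (hφ.differentiable (by simp) (x - y)).hasFDerivAt.comp y
    ((hasFDerivAt_id y).const_sub x)
  have h2 : fderiv ℝ (fun y => φ (x - y)) y
      = (fderiv ℝ φ (x - y)).comp (- ContinuousLinearMap.id ℝ (E d)) := h.fderiv
  rw [pd, h2]
  simp [pd]

lemma pd_comm {φ : E d → ℝ} (hφ : ContDiff ℝ ∞ φ) (i j : Fin (d + 1)) :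
    pd i (pd j φ) = pd j (pd i φ) := by
  ext y
  have hd : DifferentiableAt ℝ (fderiv ℝ φ) y :=
    (hφ.fderiv_right (m := ∞) (by simp)).differentiable (by simp) y
  have h : ∀ i j : Fin (d + 1), pd i (pd j φ) y
      = fderiv ℝ (fderiv ℝ φ) y (EuclideanSpace.single i 1) (EuclideanSpace.single j 1) := by
    intro i j
    have : pd j φ = fun z => fderiv ℝ φ z (EuclideanSpace.single j 1) := rfl
    rw [pd, this, fderiv_clm_apply hd (differentiableAt_const _)]
    simp
  rw [h, h]
  exact (hφ.contDiffAt.isSymmSndFDerivAt (by simp; exact ENat.LEInfty.out)).eq _ _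

/-- The classical gradient. -/
noncomputable def grad (φ : E d → ℝ) (y : E d) : E d := WithLp.toLp 2 fun i => pd i φ y

/-- The classical Laplacian. -/
noncomputable def lap (φ : E d → ℝ) (y : E d) : ℝ := ∑ i, pd i (pd i φ) y

/-- The classical Hessian. -/
noncomputable def hess (φ : E d → ℝ) (y : E d) : EuclideanSpace ℝ (Fin (d + 1) × Fin (d + 1)) :=
  WithLp.toLp 2 fun p => pd p.1 (pd p.2 φ) y

@[simp] lemma grad_apply (φ : E d → ℝ) (y : E d) (i : Fin (d + 1)) : grad φ y i = pd i φ y := rfl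

@[simp] lemma hess_apply (φ : E d → ℝ) (y : E d) (p : Fin (d + 1) × Fin (d + 1)) :
    hess φ y p = pd p.1 (pd p.2 φ) y := rfl

lemma fderiv_apply_eq_inner (φ : E d → ℝ) (y w : E d) :
    fderiv ℝ φ y w = inner ℝ (grad φ y) w := by
  have hw : w = ∑ i, w i • EuclideanSpace.single i (1 : ℝ) := by
    ext j
    simp [Pi.single_apply]
  conv_lhs => rw [hw]
  rw [map_sum, PiLp.inner_apply]
  simp [pd]

lemma contDiff_grad {φ : E d → ℝ} (hφ : ContDiff ℝ ∞ φ) : ContDiff ℝ ∞ (grad φ) :=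
  contDiff_euclidean.2 fun i => contDiff_pd hφ i

lemma contDiff_hess {φ : E d → ℝ} (hφ : ContDiff ℝ ∞ φ) : ContDiff ℝ ∞ (hess φ) :=
  contDiff_euclidean.2 fun p => contDiff_pd (contDiff_pd hφ p.2) p.1

lemma contDiff_lap {φ : E d → ℝ} (hφ : ContDiff ℝ ∞ φ) : ContDiff ℝ ∞ (lap φ) :=
  ContDiff.sum fun i _ => contDiff_pd (contDiff_pd hφ i) i

lemma hasCompactSupport_grad {φ : E d → ℝ} (hφ : HasCompactSupport φ) :
    HasCompactSupport (grad φ) := by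
  refine hφ.mono' fun y hy => ?_
  by_contra h
  refine hy (PiLp.ext fun i => ?_)
  exact image_eq_zero_of_notMem_tsupport (f := pd i φ) fun h' => h (tsupport_pd_subset φ i h')

lemma hasCompactSupport_hess {φ : E d → ℝ} (hφ : HasCompactSupport φ) :
    HasCompactSupport (hess φ) := by
  refine hφ.mono' fun y hy => ?_
  by_contra h
  refine hy (PiLp.ext fun p => ?_)
  exact image_eq_zero_of_notMem_tsupport (f := pd p.1 (pd p.2 φ)) fun h' => h
    (tsupport_pd_subset φ p.2 (tsupport_pd_subset _ p.1 h'))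

lemma hasCompactSupport_lap {φ : E d → ℝ} (hφ : HasCompactSupport φ) :
    HasCompactSupport (lap φ) := by
  refine hφ.mono' fun y hy => ?_
  by_contra h
  refine hy (Finset.sum_eq_zero fun i _ => ?_)
  exact image_eq_zero_of_notMem_tsupport fun h' => h
    (tsupport_pd_subset φ i (tsupport_pd_subset _ i h'))

lemma memLp_mu_of_hasCompactSupport {B : Type*} [NormedAddCommGroup B] {τ : ℝ} (hτ : -1 < τ)
    {F : E d → B} (hF : Continuous F) (hFc : HasCompactSupport F) : MemLp F 2 (mu d τ) :=
  have := isLocallyFiniteMeasure_mu (d := d) hτ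
  hF.memLp_of_hasCompactSupport hFc

/-! ### Local integrability -/

/-- On a compact subset of the open half space the weight is bounded from below. -/
lemma integrableOn_of_memLp_mu {B : Type*} [NormedAddCommGroup B] {τ : ℝ} {F : E d → B}
    (hF : MemLp F 2 (mu d τ)) {K : Set (E d)} (hK : IsCompact K) (hKH : K ⊆ openHalf d) :
    IntegrableOn F K := by
  obtain ⟨C, hC⟩ : ∃ C : ℝ, ∀ y ∈ K, y (Fin.last d) ^ (-τ) ≤ C := by
    have hc : ContinuousOn (fun y : E d => y (Fin.last d) ^ (-τ)) K := by
      refine ContinuousOn.rpow_const (by fun_prop) fun y hy => Or.inl (ne_of_gt (hKH hy))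
    obtain ⟨C, hC⟩ := hK.bddAbove_image hc
    exact ⟨C, fun y hy => hC (mem_image_of_mem _ hy)⟩
  have hle : volume.restrict K ≤ ENNReal.ofReal C • mu d τ := by
    refine Measure.le_iff.2 fun s hs => ?_
    rw [Measure.smul_apply, smul_eq_mul, ← lintegral_indicator_one (μ := mu d τ) hs,
      lintegral_mu τ (measurable_one.indicator hs), ← lintegral_const_mul' _ _ ENNReal.ofReal_ne_top,
      Measure.restrict_apply hs, ← lintegral_indicator_one (hs.inter hK.measurableSet)]
    refine lintegral_mono fun y => ?_
    by_cases hy : y ∈ s ∩ K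
    · have h0 : 0 < y (Fin.last d) := hKH hy.2
      rw [indicator_of_mem hy, indicator_of_mem hy.1, Pi.one_apply, mul_one, wt_of_pos τ h0,
        ← ENNReal.ofReal_mul ((Real.rpow_nonneg h0.le _).trans (hC y hy.2)), ← ENNReal.ofReal_one]
      refine ENNReal.ofReal_le_ofReal ?_
      calc (1 : ℝ) = y (Fin.last d) ^ (-τ) * y (Fin.last d) ^ τ := by
            rw [← Real.rpow_add h0]; simp
        _ ≤ _ := by gcongr; exact hC y hy.2
    · rw [indicator_of_notMem hy]; exact zero_le
  have hFK : MemLp F 2 (volume.restrict K) := hF.of_measure_le_smul ENNReal.ofReal_ne_top hle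
  have : IsFiniteMeasure (volume.restrict K) := ⟨by simpa using hK.measure_lt_top⟩
  exact hFK.integrable (by norm_num)

lemma locallyIntegrableOn_of_memLp_mu {B : Type*} [NormedAddCommGroup B] {τ : ℝ} {F : E d → B}
    (hF : MemLp F 2 (mu d τ)) : LocallyIntegrableOn F (openHalf d) :=
  (locallyIntegrableOn_iff isOpen_openHalf.isLocallyClosed).2 fun _ hKH hK =>
    integrableOn_of_memLp_mu hF hK hKH

/-- Nothing is known about integrability near the boundary. Cutting off below height `ε` gives a
locally integrable function on `ℝⁿ`, which can be convolved. -/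
lemma locallyIntegrable_indicator_last {B : Type*} [NormedAddCommGroup B] {F : E d → B}
    (hF : LocallyIntegrableOn F (openHalf d)) {ε : ℝ} (hε : 0 < ε) :
    LocallyIntegrable ({y : E d | ε ≤ y (Fin.last d)}.indicator F) := by
  have hcl : IsClosed {y : E d | ε ≤ y (Fin.last d)} := isClosed_le continuous_const (by fun_prop)
  rw [locallyIntegrable_iff]
  intro K hK
  rw [integrableOn_indicator_iff hcl.measurableSet, inter_comm]
  exact hF.integrableOn_compact_subset
    (fun y hy => lt_of_lt_of_le hε hy.2) (hK.inter_right hcl)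

/-! ### Smoothing -/

/-- A smooth kernel with compact support in the lower half space. -/
structure IsLowKernel (ρ : E d → ℝ) (ε : ℝ) : Prop where
  contDiff : ContDiff ℝ ∞ ρ
  hasCompactSupport : HasCompactSupport ρ
  last_le : ∀ t ∈ tsupport ρ, t (Fin.last d) ≤ -ε

variable {ρ : E d → ℝ} {ε : ℝ} {B : Type*} [NormedAddCommGroup B] [NormedSpace ℝ B]

lemma IsLowKernel.pd (hρ : IsLowKernel ρ ε) (i : Fin (d + 1)) : IsLowKernel (pd i ρ) ε :=
  ⟨contDiff_pd hρ.contDiff i, hasCompactSupport_pd hρ.hasCompactSupport i,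
    fun t ht => hρ.last_le t (tsupport_pd_subset ρ i ht)⟩

lemma IsUpKernel.isLowKernel_dil {κ : E d → ℝ} (hκ : IsUpKernel κ) (hε : 0 < ε) :
    IsLowKernel (dil κ ε) ε where
  contDiff := contDiff_dil hκ.contDiff ε
  hasCompactSupport := hasCompactSupport_dil hκ.hasCompactSupport hε
  last_le := by
    have hcl : IsClosed ((fun x : E d => ε⁻¹ • x) ⁻¹' tsupport κ) :=
      (isClosed_tsupport κ).preimage (continuous_const_smul _)
    have h1 : Function.support (dil κ ε) ⊆ (fun x : E d => ε⁻¹ • x) ⁻¹' tsupport κ := by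
      intro x hx
      refine subset_tsupport _ fun h0 => hx ?_
      have h0' : κ (ε⁻¹ • x) = 0 := h0
      simp [dil, h0']
    intro x hx
    have := (hκ.last_mem _ (closure_minimal h1 hcl hx)).2
    simp only [PiLp.smul_apply, smul_eq_mul] at this
    rw [inv_mul_le_iff₀ hε] at this
    linarith

/-- From a point of nonnegative height the kernel looks only at heights of at least `ε`, so the
truncation is invisible up to and including the boundary. -/
lemma IsLowKernel.smul_indicator (hρ : IsLowKernel ρ ε) (F : E d → B) {y : E d}
    (hy : 0 ≤ y (Fin.last d)) (t : E d) :
    ρ t • {y : E d | ε ≤ y (Fin.last d)}.indicator F (y - t) = ρ t • F (y - t) := by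
  by_cases ht : t ∈ tsupport ρ
  · rw [indicator_of_mem]
    have := hρ.last_le t ht
    simp only [mem_ofPred_eq, PiLp.sub_apply]
    linarith
  · simp [image_eq_zero_of_notMem_tsupport ht]

lemma IsLowKernel.kerAvg_indicator (hρ : IsLowKernel ρ ε) (F : E d → B) {y : E d}
    (hy : 0 ≤ y (Fin.last d)) :
    kerAvg ρ ({y : E d | ε ≤ y (Fin.last d)}.indicator F) y = kerAvg ρ F y := by
  simp only [kerAvg, hρ.smul_indicator F hy]

lemma IsLowKernel.integrable (hρ : IsLowKernel ρ ε) (hε : 0 < ε) {F : E d → B}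
    (hF : LocallyIntegrableOn F (openHalf d)) {y : E d} (hy : 0 ≤ y (Fin.last d)) :
    Integrable fun t => ρ t • F (y - t) := by
  have h : Integrable fun t => ρ t • {y : E d | ε ≤ y (Fin.last d)}.indicator F (y - t) :=
    hρ.hasCompactSupport.convolutionExists_left (ContinuousLinearMap.lsmul ℝ ℝ)
      hρ.contDiff.continuous (locallyIntegrable_indicator_last hF hε) y
  simpa only [hρ.smul_indicator F hy] using h

lemma contDiff_kerAvg [CompleteSpace B] (hρ : IsLowKernel ρ ε) {F : E d → B}
    (hF : LocallyIntegrable F) : ContDiff ℝ ∞ (kerAvg ρ F) :=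
  hρ.hasCompactSupport.contDiff_convolution_left (ContinuousLinearMap.lsmul ℝ ℝ) hρ.contDiff hF

lemma pd_kerAvg (hρ : IsLowKernel ρ ε) {F : E d → ℝ} (hF : LocallyIntegrable F)
    (i : Fin (d + 1)) : pd i (kerAvg ρ F) = kerAvg (pd i ρ) F := by
  ext y
  have h := hρ.hasCompactSupport.hasFDerivAt_convolution_left (ContinuousLinearMap.lsmul ℝ ℝ)
    (hρ.contDiff.of_le (by simp)) hF y
  rw [← kerAvg_eq_convolution] at h
  rw [pd, h.fderiv, convolution_def, ContinuousLinearMap.integral_apply]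
  · rfl
  · exact (hρ.hasCompactSupport.fderiv ℝ).convolutionExists_left _
      (hρ.contDiff.continuous_fderiv (by simp)) hF y

/-- Even for `y` on the boundary this is a test function with support in the open half space.
Distributional identities on `H` therefore become pointwise identities for the averages up to the
boundary, without any boundary condition. -/
lemma IsLowKernel.isTestOnHalf (hρ : IsLowKernel ρ ε) (hε : 0 < ε) {y : E d}
    (hy : 0 ≤ y (Fin.last d)) : IsTestOnHalf fun z => ρ (y - z) := by
  refine ⟨hρ.contDiff.comp (contDiff_const.sub contDiff_id),
    hρ.hasCompactSupport.comp_homeomorph (Homeomorph.subLeft y), fun z hz => ?_⟩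
  have h1 := tsupport_comp_subset_preimage ρ (f := fun z : E d => y - z) (by fun_prop) hz
  have h2 := hρ.last_le _ h1
  simp only [PiLp.sub_apply] at h2
  simp only [openHalf, mem_ofPred_eq]
  linarith

lemma IsLowKernel.kerAvg_eq (hρ : IsLowKernel ρ ε) (hε : 0 < ε) (F : E d → B) {y : E d}
    (hy : 0 ≤ y (Fin.last d)) : kerAvg ρ F y = ∫ z in openHalf d, ρ (y - z) • F z := by
  rw [setIntegral_eq_integral_of_forall_compl_eq_zero, kerAvg,
    ← integral_sub_left_eq_self _ volume y]
  · simp only [sub_sub_cancel]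
  · intro z hz
    rw [image_eq_zero_of_notMem_tsupport (f := fun z => ρ (y - z)), zero_smul]
    exact fun h => hz ((hρ.isTestOnHalf hε hy).2.2 h)

lemma kerAvg_apply (hρ : IsLowKernel ρ ε) (hε : 0 < ε) {G : E d → E d}
    (hG : LocallyIntegrableOn G (openHalf d)) {y : E d} (hy : 0 ≤ y (Fin.last d))
    (i : Fin (d + 1)) : kerAvg ρ G y i = kerAvg ρ (fun z => G z i) y := by
  have h := (EuclideanSpace.proj (𝕜 := ℝ) i : E d →L[ℝ] ℝ).integral_comp_comm
    (hρ.integrable hε hG hy)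
  simpa [kerAvg] using h.symm

lemma HasWeakGradient.kerAvg_pd {v : E d → ℝ} {G : E d → E d} (h : HasWeakGradient v G)
    (hρ : IsLowKernel ρ ε) (hε : 0 < ε) {y : E d} (hy : 0 ≤ y (Fin.last d)) (i : Fin (d + 1)) :
    kerAvg (pd i ρ) v y = kerAvg ρ G y i := by
  rw [kerAvg_apply hρ hε h.2.1 hy, (hρ.pd i).kerAvg_eq hε v hy, hρ.kerAvg_eq hε _ hy]
  have h1 := h.2.2 _ (hρ.isTestOnHalf hε hy) i
  rw [pd_comp_sub_left hρ.contDiff] at h1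
  simp only [mul_neg, integral_neg, neg_inj] at h1
  simpa only [smul_eq_mul, mul_comm] using h1

/-- `q = Δv` on `H` in the sense of distributions. -/
def HasWeakLaplacian (v q : E d → ℝ) : Prop :=
  LocallyIntegrableOn q (openHalf d) ∧ ∀ φ : E d → ℝ, IsTestOnHalf φ →
    ∫ y in openHalf d, v y * lap φ y = ∫ y in openHalf d, q y * φ y

lemma HasWeakLaplacian.kerAvg_lap {v q : E d → ℝ} (h : HasWeakLaplacian v q)
    (hv : LocallyIntegrableOn v (openHalf d))
    (hρ : IsLowKernel ρ ε) (hε : 0 < ε) {y : E d} (hy : 0 ≤ y (Fin.last d)) :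
    ∑ i, kerAvg (pd i (pd i ρ)) v y = kerAvg ρ q y := by
  have h1 := h.2 _ (hρ.isTestOnHalf hε hy)
  have h2 : ∀ z, lap (fun z => ρ (y - z)) z = ∑ i, pd i (pd i ρ) (y - z) := by
    intro z
    refine Finset.sum_congr rfl fun i _ => ?_
    rw [pd_comp_sub_left hρ.contDiff]
    have h3 : (fun z => - pd i ρ (y - z)) = fun z => (-1) * pd i ρ (y - z) := by ext z; ring
    rw [h3, pd_const_mul, pd_comp_sub_left (contDiff_pd hρ.contDiff i)]
    · ring
    · exact (contDiff_pd hρ.contDiff i).comp (contDiff_const.sub contDiff_id)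
  rw [hρ.kerAvg_eq hε _ hy]
  simp only [smul_eq_mul, mul_comm (ρ _)]
  rw [← h1]
  simp only [h2, Finset.mul_sum]
  rw [integral_finsetSum]
  · refine Finset.sum_congr rfl fun i _ => ?_
    rw [((hρ.pd i).pd i).kerAvg_eq hε v hy]
    simp only [smul_eq_mul, mul_comm]
  · intro i _
    have := ((hρ.pd i).pd i).integrable hε hv hy
    have h4 := (integrable_comp_sub_left (fun t => pd i (pd i ρ) t • v (y - t)) y).2 this
    simp only [sub_sub_cancel, smul_eq_mul, mul_comm] at h4
    exact h4.integrableOn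

end HalfSpace

/-! ### Limits in `L²` of products with bounded multipliers -/

lemma tendsto_eLpNorm_smul_zero {α : Type*} [MeasurableSpace α] {μ : Measure α} {B : Type*}
    [NormedAddCommGroup B] [NormedSpace ℝ B] {m : ℕ → α → ℝ} {F : ℕ → α → B} {F' : α → B}
    (hm : ∀ k, StronglyMeasurable (m k)) (hm1 : ∀ k x, |m k x| ≤ 1)
    (hm0 : ∀ x, Tendsto (fun k => m k x) atTop (𝓝 0))
    (hF : ∀ k, AEStronglyMeasurable (F k) μ) (hF' : MemLp F' 2 μ)
    (h : Tendsto (fun k => eLpNorm (F k - F') 2 μ) atTop (𝓝 0)) :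
    Tendsto (fun k => eLpNorm (fun x => m k x • F k x) 2 μ) atTop (𝓝 0) := by
  have h1 : Tendsto (fun k => eLpNorm (fun x => m k x • F' x) 2 μ) atTop (𝓝 0) := by
    have h2 : Tendsto (fun k => eLpNorm (fun x => m k x • F' x) 2 μ ^ 2) atTop (𝓝 0) := by
      simp only [eLpNorm_two_sq]
      have h3 := tendsto_lintegral_of_dominated_convergence' (μ := μ)
        (F := fun k x => ‖m k x • F' x‖ₑ ^ 2) (f := fun _ => 0) (fun x => ‖F' x‖ₑ ^ 2)
        (fun k => ((hm k).aestronglyMeasurable.smul hF'.1).enorm.pow_const 2)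
        (fun k => ae_of_all _ fun x => by
          simp only
          gcongr
          rw [enorm_smul, ← ofReal_norm, Real.norm_eq_abs]
          refine mul_le_of_le_one_left' ?_
          rw [← ENNReal.ofReal_one]
          exact ENNReal.ofReal_le_ofReal (hm1 k x))
        (by rw [← eLpNorm_two_sq]; exact (ENNReal.pow_lt_top hF'.2).ne)
        (ae_of_all _ fun x => by
          have h4 := ((hm0 x).smul_const (F' x)).enorm
          simp only [zero_smul, enorm_zero] at h4
          simpa using ENNReal.Tendsto.pow (n := 2) h4)
      simpa using h3
    rw [ENNReal.tendsto_atTop_zero] at h2 ⊢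
    intro δ hδ
    obtain ⟨N, hN⟩ := h2 (δ ^ 2) (ENNReal.pow_pos hδ 2)
    exact ⟨N, fun n hn => (ENNReal.pow_le_pow_left_iff two_ne_zero).1 (hN n hn)⟩
  have h2 := h.add h1
  rw [add_zero] at h2
  refine tendsto_of_tendsto_of_tendsto_of_le_of_le tendsto_const_nhds h2 (fun _ => zero_le)
    fun k => ?_
  have h3 : (fun x => m k x • F k x)
      = (fun x => m k x • (F k - F') x) + fun x => m k x • F' x := by
    ext x; simp [smul_sub]
  simp only
  rw [h3]
  refine (eLpNorm_add_le ((hm k).aestronglyMeasurable.smul ((hF k).sub hF'.1))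
    ((hm k).aestronglyMeasurable.smul hF'.1) (by norm_num)).trans (add_le_add ?_ le_rfl)
  refine eLpNorm_mono fun x => ?_
  rw [Pi.smul_apply', norm_smul]
  exact mul_le_of_le_one_left (norm_nonneg _) (hm1 k x)

lemma tendsto_eLpNorm_smul_sub {α : Type*} [MeasurableSpace α] {μ : Measure α} {B : Type*}
    [NormedAddCommGroup B] [NormedSpace ℝ B] {m : ℕ → α → ℝ} {F : ℕ → α → B} {F' : α → B}
    (hm : ∀ k, StronglyMeasurable (m k)) (hm1 : ∀ k x, m k x ∈ Icc (0 : ℝ) 1)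
    (hm0 : ∀ x, Tendsto (fun k => m k x) atTop (𝓝 1))
    (hF : ∀ k, AEStronglyMeasurable (F k) μ) (hF' : MemLp F' 2 μ)
    (h : Tendsto (fun k => eLpNorm (F k - F') 2 μ) atTop (𝓝 0)) :
    Tendsto (fun k => eLpNorm (fun x => m k x • F k x - F' x) 2 μ) atTop (𝓝 0) := by
  have h1 := tendsto_eLpNorm_smul_zero (m := fun k x => m k x - 1)
    (fun k => (hm k).sub stronglyMeasurable_const)
    (fun k x => by have := hm1 k x; rw [abs_le]; constructor <;> linarith [this.1, this.2])
    (fun x => by simpa using (hm0 x).sub_const 1) hF hF' h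
  have h2 := h.add h1
  rw [add_zero] at h2
  refine tendsto_of_tendsto_of_tendsto_of_le_of_le tendsto_const_nhds h2 (fun _ => zero_le)
    fun k => ?_
  have h3 : (fun x => m k x • F k x - F' x) = (F k - F') + fun x => (m k x - 1) • F k x := by
    ext x; simp [sub_smul]
  simp only
  rw [h3]
  exact eLpNorm_add_le ((hF k).sub hF'.1)
    (((hm k).sub stronglyMeasurable_const).aestronglyMeasurable.smul (hF k)) (by norm_num)

/-! ### Cutoffs and density of smooth functions in the weighted spaces -/

namespace HalfSpace

variable {d : ℕ}

lemma eLpNorm_mu_le_of_le {B B' : Type*} [NormedAddCommGroup B] [NormedAddCommGroup B']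
    {F : E d → B} {F' : E d → B'} (hF : StronglyMeasurable F) (hF' : StronglyMeasurable F')
    {τ σ : ℝ} (h : ∀ y ∈ openHalf d,
      ‖F y‖ ^ 2 * y (Fin.last d) ^ τ ≤ ‖F' y‖ ^ 2 * y (Fin.last d) ^ σ) :
    eLpNorm F 2 (mu d τ) ≤ eLpNorm F' 2 (mu d σ) := by
  rw [← ENNReal.pow_le_pow_left_iff two_ne_zero, eLpNorm_two_sq, eLpNorm_two_sq,
    lintegral_mu _ (hF.enorm.pow_const 2), lintegral_mu _ (hF'.enorm.pow_const 2)]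
  refine lintegral_mono fun y => ?_
  rcases le_or_gt (y (Fin.last d)) 0 with hy | hy
  · rw [wt_of_nonpos _ hy, zero_mul]; exact zero_le
  · rw [wt_of_pos _ hy, wt_of_pos _ hy, ← ofReal_norm, ← ofReal_norm,
      ← ENNReal.ofReal_pow (norm_nonneg _), ← ENNReal.ofReal_pow (norm_nonneg _),
      ← ENNReal.ofReal_mul (by positivity), ← ENNReal.ofReal_mul (by positivity)]
    refine ENNReal.ofReal_le_ofReal ?_
    rw [mul_comm, mul_comm (_ ^ σ)]
    exact h y hy

/-- A smooth cutoff function with bounds on its derivatives. -/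
structure IsCutoff (χ : E d → ℝ) (C₁ C₂ : ℝ) : Prop where
  contDiff : ContDiff ℝ ∞ χ
  hasCompactSupport : HasCompactSupport χ
  mem_Icc : ∀ y, χ y ∈ Icc (0 : ℝ) 1
  eq_one : ∀ y, ‖y‖ < 1 → χ y = 1
  norm_le : ∀ y ∈ tsupport χ, ‖y‖ ≤ 2
  norm_grad_le : ∀ y, ‖grad χ y‖ ≤ C₁
  norm_lap_le : ∀ y, ‖lap χ y‖ ≤ C₂

lemma exists_isCutoff (d : ℕ) : ∃ (χ : E d → ℝ) (C₁ C₂ : ℝ), IsCutoff χ C₁ C₂ := by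
  let b : ContDiffBump (0 : E d) := ⟨1, 2, by norm_num, by norm_num⟩
  have hb : ContDiff ℝ ∞ (b : E d → ℝ) := b.contDiff
  obtain ⟨C₁, hC₁⟩ := (contDiff_grad hb).continuous.bounded_above_of_compact_support
    (hasCompactSupport_grad b.hasCompactSupport)
  obtain ⟨C₂, hC₂⟩ := (contDiff_lap hb).continuous.bounded_above_of_compact_support
    (hasCompactSupport_lap b.hasCompactSupport)
  refine ⟨b, C₁, C₂, hb, b.hasCompactSupport, fun y => ⟨b.nonneg, b.le_one⟩, fun y hy =>
    b.one_of_mem_closedBall ?_, fun y hy => ?_, hC₁, hC₂⟩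
  · simpa [b] using hy.le
  · rw [b.tsupport_eq] at hy
    simpa [b] using hy

namespace IsCutoff

variable {χ : E d → ℝ} {C₁ C₂ : ℝ}

lemma nonneg_left (h : IsCutoff χ C₁ C₂) : 0 ≤ C₁ := (norm_nonneg _).trans (h.norm_grad_le 0)

lemma nonneg_right (h : IsCutoff χ C₁ C₂) : 0 ≤ C₂ := (norm_nonneg _).trans (h.norm_lap_le 0)

lemma grad_eq_zero (h : IsCutoff χ C₁ C₂) {z : E d} (hz : 2 < ‖z‖) : grad χ z = 0 :=
  PiLp.ext fun i => image_eq_zero_of_notMem_tsupport (f := pd i χ) fun h' =>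
    not_lt.2 (h.norm_le z (tsupport_pd_subset χ i h')) hz

lemma lap_eq_zero (h : IsCutoff χ C₁ C₂) {z : E d} (hz : 2 < ‖z‖) : lap χ z = 0 :=
  Finset.sum_eq_zero fun i _ => image_eq_zero_of_notMem_tsupport (f := pd i (pd i χ)) fun h' =>
    not_lt.2 (h.norm_le z (tsupport_pd_subset χ i (tsupport_pd_subset _ i h'))) hz

lemma grad_eq_zero_of_lt (h : IsCutoff χ C₁ C₂) {z : E d} (hz : ‖z‖ < 1) : grad χ z = 0 :=
  PiLp.ext fun i => by
    have : χ =ᶠ[𝓝 z] fun _ => 1 := by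
      filter_upwards [(isOpen_lt continuous_norm continuous_const).mem_nhds hz] with x hx
      exact h.eq_one x hx
    rw [grad_apply, pd_congr this]
    simp [pd]

lemma contDiff_scaled (h : IsCutoff χ C₁ C₂) (e : ℝ) : ContDiff ℝ ∞ fun y => χ (e • y) :=
  h.contDiff.comp (contDiff_const_smul e)

end IsCutoff

lemma mul_last_le {e : ℝ} {y : E d} (h : ‖e • y‖ ≤ 2) : e * y (Fin.last d) ≤ 2 := by
  have := (le_abs_self _).trans ((abs_apply_le_norm (e • y) (Fin.last d)).trans h)
  simpa using this

lemma grad_mul {φ ψ : E d → ℝ} (hφ : ContDiff ℝ ∞ φ) (hψ : ContDiff ℝ ∞ ψ) (y : E d) :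
    grad (fun y => φ y * ψ y) y = φ y • grad ψ y + ψ y • grad φ y := by
  ext i
  simp [pd_mul hφ hψ, mul_comm]

lemma lap_mul {φ ψ : E d → ℝ} (hφ : ContDiff ℝ ∞ φ) (hψ : ContDiff ℝ ∞ ψ) (y : E d) :
    lap (fun y => φ y * ψ y) y
      = φ y * lap ψ y + 2 * inner ℝ (grad φ y) (grad ψ y) + lap φ y * ψ y := by
  simp only [lap, PiLp.inner_apply, Finset.mul_sum, Finset.sum_mul, ← Finset.sum_add_distrib]
  refine Finset.sum_congr rfl fun i _ => ?_
  rw [pd_mul hφ hψ, pd_add (hφ.mul (contDiff_pd hψ i)) ((contDiff_pd hφ i).mul hψ),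
    pd_mul hφ (contDiff_pd hψ i), pd_mul (contDiff_pd hφ i) hψ]
  simp
  ring

lemma grad_comp_smul {φ : E d → ℝ} (hφ : ContDiff ℝ ∞ φ) (c : ℝ) (y : E d) :
    grad (fun y => φ (c • y)) y = c • grad φ (c • y) := by
  ext i
  simp [pd_comp_smul hφ]

lemma lap_comp_smul {φ : E d → ℝ} (hφ : ContDiff ℝ ∞ φ) (c : ℝ) (y : E d) :
    lap (fun y => φ (c • y)) y = c ^ 2 * lap φ (c • y) := by
  simp only [lap, Finset.mul_sum]
  refine Finset.sum_congr rfl fun i _ => ?_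
  rw [pd_comp_smul hφ, pd_const_mul, pd_comp_smul (contDiff_pd hφ i)]
  · ring
  · exact (contDiff_pd hφ i).comp (contDiff_const_smul c)

section CutoffErrors

variable {χ A : E d → ℝ} {C₁ C₂ e : ℝ}

lemma stronglyMeasurable_mul_grad (h : IsCutoff χ C₁ C₂) (hA : ContDiff ℝ ∞ A) (e : ℝ) :
    StronglyMeasurable fun y => (A y * e) • grad χ (e • y) :=
  ((hA.continuous.mul continuous_const).smul
    ((contDiff_grad h.contDiff).continuous.comp (continuous_const_smul e))).stronglyMeasurable

lemma stronglyMeasurable_inner_grad (h : IsCutoff χ C₁ C₂) (hA : ContDiff ℝ ∞ A) (e : ℝ) :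
    StronglyMeasurable fun y => 2 * inner ℝ (e • grad χ (e • y)) (grad A y) :=
  (continuous_const.mul ((((contDiff_grad h.contDiff).continuous.comp
    (continuous_const_smul e)).const_smul e).inner (contDiff_grad hA).continuous)).stronglyMeasurable

lemma stronglyMeasurable_lap_mul (h : IsCutoff χ C₁ C₂) (hA : ContDiff ℝ ∞ A) (e : ℝ) :
    StronglyMeasurable fun y => e ^ 2 * lap χ (e • y) * A y :=
  ((continuous_const.mul ((contDiff_lap h.contDiff).continuous.comp
    (continuous_const_smul e))).mul hA.continuous).stronglyMeasurable

/-- On the support `y_n ≤ 2 / e`. Lowering the exponent by at most one costs a factor `2 / e`, the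
derivative of the cutoff gains `e ^ 2` in the square, and `2 * e` remains. -/
lemma eLpNorm_mul_grad_le (h : IsCutoff χ C₁ C₂) (hA : ContDiff ℝ ∞ A) (he : 0 < e) (he1 : e ≤ 1)
    {σ τ : ℝ} (hτ : τ ∈ Icc σ (1 + σ)) :
    eLpNorm (fun y => (A y * e) • grad χ (e • y)) 2 (mu d τ)
      ≤ eLpNorm (fun y => Real.sqrt (2 * e) * C₁ * A y) 2 (mu d σ) := by
  refine eLpNorm_mu_le_of_le (stronglyMeasurable_mul_grad h hA e)
    (hA.continuous.stronglyMeasurable.const_mul (Real.sqrt (2 * e) * C₁)) fun y hy => ?_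
  have hy0 : 0 < y (Fin.last d) := hy
  have hC₁0 := h.nonneg_left
  rcases lt_or_ge 2 ‖e • y‖ with hy2 | hy2
  · rw [h.grad_eq_zero hy2, smul_zero, norm_zero, zero_pow two_ne_zero, zero_mul]
    positivity
  have hy3 := mul_last_le hy2
  have hpow : y (Fin.last d) ^ τ ≤ 2 / e * y (Fin.last d) ^ σ := by
    have h4 : y (Fin.last d) ≤ 2 / e := by
      rw [le_div_iff₀ he]; linarith
    have h5 : 1 ≤ 2 / e := by
      rw [le_div_iff₀ he]; linarith
    calc y (Fin.last d) ^ τ = y (Fin.last d) ^ (τ - σ) * y (Fin.last d) ^ σ := by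
          rw [← Real.rpow_add hy0]; congr 1; ring
      _ ≤ (2 / e) ^ (τ - σ) * y (Fin.last d) ^ σ := by
          gcongr
          linarith [hτ.1]
      _ ≤ (2 / e) ^ (1 : ℝ) * y (Fin.last d) ^ σ := by
          gcongr ?_ * _
          exact Real.rpow_le_rpow_of_exponent_le h5 (by linarith [hτ.2])
      _ = _ := by rw [Real.rpow_one]
  calc ‖(A y * e) • grad χ (e • y)‖ ^ 2 * y (Fin.last d) ^ τ
      ≤ (|A y| * e * C₁) ^ 2 * (2 / e * y (Fin.last d) ^ σ) := by
        rw [norm_smul, norm_mul, Real.norm_eq_abs, Real.norm_of_nonneg he.le]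
        gcongr
        exact h.norm_grad_le _
    _ = ‖Real.sqrt (2 * e) * C₁ * A y‖ ^ 2 * y (Fin.last d) ^ σ := by
        rw [norm_mul, norm_mul, Real.norm_of_nonneg (Real.sqrt_nonneg _),
          Real.norm_of_nonneg hC₁0, Real.norm_eq_abs, mul_pow, mul_pow, mul_pow, mul_pow,
          Real.sq_sqrt (by positivity)]
        field_simp

lemma rpow_two_add {r : ℝ} (hr : 0 < r) (σ : ℝ) : r ^ (2 + σ) = r ^ 2 * r ^ σ := by
  rw [Real.rpow_add hr, Real.rpow_two]

/-- The two extra powers of `y_n` just use up the factor `e ^ 2`, since `e y_n ≤ 2`. Smallness comes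
instead from the region `1 ≤ ‖e y‖`, which disappears as `e → 0`; this requires the gradient in the
space with exponent `σ`. -/
lemma eLpNorm_inner_grad_le (h : IsCutoff χ C₁ C₂) (hA : ContDiff ℝ ∞ A) (he : 0 < e) (σ : ℝ) :
    eLpNorm (fun y => 2 * inner ℝ (e • grad χ (e • y)) (grad A y)) 2 (mu d (2 + σ))
      ≤ eLpNorm (fun y => (4 * C₁) • ({y : E d | 1 ≤ ‖e • y‖}.indicator (fun _ => (1 : ℝ)) y
        • grad A y)) 2 (mu d σ) := by
  have hm : StronglyMeasurable ({y : E d | 1 ≤ ‖e • y‖}.indicator fun _ => (1 : ℝ)) :=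
    stronglyMeasurable_const.indicator
      (isClosed_le continuous_const (by fun_prop)).measurableSet
  refine eLpNorm_mu_le_of_le (stronglyMeasurable_inner_grad h hA e)
    (F' := fun y => (4 * C₁) • ({y : E d | 1 ≤ ‖e • y‖}.indicator (fun _ => (1 : ℝ)) y
      • grad A y))
    ((hm.smul (contDiff_grad hA).continuous.stronglyMeasurable).const_smul (4 * C₁)) fun y hy => ?_
  have hy0 : 0 < y (Fin.last d) := hy
  have hC₁0 := h.nonneg_left
  rcases lt_or_ge 2 ‖e • y‖ with hy2 | hy2
  · rw [h.grad_eq_zero hy2, smul_zero, inner_zero_left, mul_zero, norm_zero,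
      zero_pow two_ne_zero, zero_mul]
    positivity
  rcases lt_or_ge ‖e • y‖ 1 with hy1 | hy1
  · rw [h.grad_eq_zero_of_lt hy1, smul_zero, inner_zero_left, mul_zero, norm_zero,
      zero_pow two_ne_zero, zero_mul]
    positivity
  have hy3 := mul_last_le hy2
  rw [indicator_of_mem (by exact hy1), one_smul, rpow_two_add hy0, ← mul_assoc, ← mul_pow]
  gcongr
  calc ‖2 * inner ℝ (e • grad χ (e • y)) (grad A y)‖ * y (Fin.last d)
      ≤ 2 * (e * C₁ * ‖grad A y‖) * y (Fin.last d) := by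
        rw [norm_mul, Real.norm_of_nonneg (zero_le_two (α := ℝ))]
        gcongr
        refine (norm_inner_le_norm _ _).trans ?_
        rw [norm_smul, Real.norm_of_nonneg he.le]
        gcongr
        exact h.norm_grad_le _
    _ = 2 * C₁ * ‖grad A y‖ * (e * y (Fin.last d)) := by ring
    _ ≤ 2 * C₁ * ‖grad A y‖ * 2 := by gcongr
    _ = _ := by
        rw [norm_smul, Real.norm_of_nonneg (by positivity)]; ring

/-- Two derivatives fall on the cutoff: `e ^ 2 y_n ≤ 2 e` leaves one factor `e` to spare. -/
lemma eLpNorm_lap_mul_le (h : IsCutoff χ C₁ C₂) (hA : ContDiff ℝ ∞ A) (he : 0 < e) (σ : ℝ) :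
    eLpNorm (fun y => e ^ 2 * lap χ (e • y) * A y) 2 (mu d (2 + σ))
      ≤ eLpNorm (fun y => 2 * C₂ * e * A y) 2 (mu d σ) := by
  refine eLpNorm_mu_le_of_le (stronglyMeasurable_lap_mul h hA e)
    (hA.continuous.stronglyMeasurable.const_mul (2 * C₂ * e)) fun y hy => ?_
  have hy0 : 0 < y (Fin.last d) := hy
  have hC₂0 := h.nonneg_right
  rcases lt_or_ge 2 ‖e • y‖ with hy2 | hy2
  · rw [h.lap_eq_zero hy2, mul_zero, zero_mul, norm_zero, zero_pow two_ne_zero, zero_mul]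
    positivity
  have hy3 := mul_last_le hy2
  rw [rpow_two_add hy0, ← mul_assoc, ← mul_pow]
  gcongr
  calc ‖e ^ 2 * lap χ (e • y) * A y‖ * y (Fin.last d)
      ≤ e ^ 2 * C₂ * ‖A y‖ * y (Fin.last d) := by
        rw [norm_mul, norm_mul, Real.norm_of_nonneg (sq_nonneg e)]
        gcongr
        exact h.norm_lap_le _
    _ = C₂ * e * ‖A y‖ * (e * y (Fin.last d)) := by ring
    _ ≤ C₂ * e * ‖A y‖ * 2 := by gcongr
    _ = _ := by
        rw [norm_mul, Real.norm_of_nonneg (by positivity : (0 : ℝ) ≤ 2 * C₂ * e)]; ring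

end CutoffErrors

/-- Smoothing up to the boundary. -/
lemma exists_contDiff_approx {σ : ℝ} (hσ : -1 < σ) {v : E d → ℝ} {G : E d → E d}
    (hvm : StronglyMeasurable v) (hGm : StronglyMeasurable G) (hv : MemLp v 2 (mu d σ))
    (hvG : HasWeakGradient v G) {e : ℕ → ℝ} (he : ∀ k, 0 < e k) (he0 : Tendsto e atTop (𝓝 0)) :
    ∃ A : ℕ → E d → ℝ, (∀ k, ContDiff ℝ ∞ (A k)) ∧
      Tendsto (fun k => eLpNorm (A k - v) 2 (mu d σ)) atTop (𝓝 0) ∧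
      (∀ τ, -1 < τ → MemLp G 2 (mu d τ) →
        Tendsto (fun k => eLpNorm (grad (A k) - G) 2 (mu d τ)) atTop (𝓝 0)) ∧
      (∀ q, StronglyMeasurable q → HasWeakLaplacian v q → ∀ τ, -1 < τ → MemLp q 2 (mu d τ) →
        Tendsto (fun k => eLpNorm (lap (A k) - q) 2 (mu d τ)) atTop (𝓝 0)) := by
  obtain ⟨κ, hκ⟩ := exists_isUpKernel d
  have hker : ∀ k, IsLowKernel (dil κ (e k)) (e k) := fun k => hκ.isLowKernel_dil (he k)
  have hvloc : ∀ k, LocallyIntegrable ({y : E d | e k ≤ y (Fin.last d)}.indicator v) := fun k =>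
    locallyIntegrable_indicator_last hvG.1 (he k)
  have havg : ∀ {B : Type} [NormedAddCommGroup B] [NormedSpace ℝ B] [CompleteSpace B] {τ : ℝ}
      (_ : -1 < τ) {F : E d → B} (_ : StronglyMeasurable F) (_ : MemLp F 2 (mu d τ))
      (A' : ℕ → E d → B) (_ : ∀ k, ∀ y ∈ openHalf d, A' k y = avg κ (e k) F y),
      Tendsto (fun k => eLpNorm (A' k - F) 2 (mu d τ)) atTop (𝓝 0) := by
    intro B _ _ _ τ hτ F hFm hF A' hA'
    have := isLocallyFiniteMeasure_mu (d := d) hτ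
    obtain ⟨C, hC, hCb⟩ := exists_avgBound_mu hκ hτ
    refine (tendsto_avg hκ.toIsMollifier hC (fun k => hCb (e k) (he k)) he0 hFm hF).congr
      fun k => eLpNorm_congr_ae ?_
    filter_upwards [ae_mu_mem τ] with y hy
    rw [Pi.sub_apply, Pi.sub_apply, hA' k y hy]
  -- Truncation at height `e k` makes the approximation smooth on all of `ℝⁿ`; on `H` it agrees with
  -- the average of `v`, and its derivatives with the averages of `G` and `q`.
  refine ⟨fun k => kerAvg (dil κ (e k)) ({y : E d | e k ≤ y (Fin.last d)}.indicator v),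
    fun k => contDiff_kerAvg (hker k) (hvloc k), havg hσ hvm hv _ fun k y hy => ?_,
    fun τ hτ hG => havg hτ hGm hG _ fun k y hy => ?_,
    fun q hqm hq τ hτ hq2 => havg hτ hqm hq2 _ fun k y hy => ?_⟩
  · rw [avg_eq_convolution κ (he k)]
    exact (hker k).kerAvg_indicator v (le_of_lt hy)
  · ext i
    rw [grad_apply, pd_kerAvg (hker k) (hvloc k),
      ((hker k).pd i).kerAvg_indicator v (le_of_lt hy), hvG.kerAvg_pd (hker k) (he k) (le_of_lt hy),
      avg_eq_convolution κ (he k)]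
    rfl
  · rw [avg_eq_convolution κ (he k)]
    refine Eq.trans ?_ (hq.kerAvg_lap hvG.1 (hker k) (he k) (le_of_lt hy))
    refine Finset.sum_congr rfl fun i _ => ?_
    rw [pd_kerAvg (hker k) (hvloc k), pd_kerAvg ((hker k).pd i) (hvloc k),
      (((hker k).pd i).pd i).kerAvg_indicator v (le_of_lt hy)]

/-- Functions in `C_c^∞(ℝⁿ)` are dense in the weighted Sobolev spaces. -/
theorem exists_smooth_approx {σ : ℝ} (hσ : -1 < σ) {v : E d → ℝ} {G : E d → E d}
    (hvm : StronglyMeasurable v) (hGm : StronglyMeasurable G) (hv : MemLp v 2 (mu d σ))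
    (hvG : HasWeakGradient v G) :
    ∃ w : ℕ → E d → ℝ, (∀ k, ContDiff ℝ ∞ (w k)) ∧ (∀ k, HasCompactSupport (w k)) ∧
      Tendsto (fun k => eLpNorm (w k - v) 2 (mu d σ)) atTop (𝓝 0) ∧
      (∀ τ ∈ Icc σ (1 + σ), MemLp G 2 (mu d τ) →
        Tendsto (fun k => eLpNorm (grad (w k) - G) 2 (mu d τ)) atTop (𝓝 0)) ∧
      (∀ q, StronglyMeasurable q → HasWeakLaplacian v q → MemLp q 2 (mu d (2 + σ)) →
        MemLp G 2 (mu d σ) →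
        Tendsto (fun k => eLpNorm (lap (w k) - q) 2 (mu d (2 + σ))) atTop (𝓝 0)) := by
  obtain ⟨χ, C₁, C₂, hχ⟩ := exists_isCutoff d
  obtain ⟨e, he, he1, he0⟩ : ∃ e : ℕ → ℝ, (∀ k, 0 < e k) ∧ (∀ k, e k ≤ 1) ∧
      Tendsto e atTop (𝓝 0) := by
    refine ⟨fun k => 1 / ((k : ℝ) + 1), fun k => by positivity, fun k => ?_,
      tendsto_one_div_add_atTop_nhds_zero_nat⟩
    rw [div_le_one (by positivity)]
    linarith [(Nat.cast_nonneg k : (0 : ℝ) ≤ k)]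
  obtain ⟨A, hA, hlimA, hlimG, hlimq⟩ := exists_contDiff_approx hσ hvm hGm hv hvG he he0
  have hAm : ∀ k, StronglyMeasurable (A k) := fun k => (hA k).continuous.stronglyMeasurable
  have hgm : ∀ k, StronglyMeasurable (grad (A k)) := fun k =>
    (contDiff_grad (hA k)).continuous.stronglyMeasurable
  have hlm : ∀ k, StronglyMeasurable (lap (A k)) := fun k =>
    (contDiff_lap (hA k)).continuous.stronglyMeasurable
  have hχk := fun k => hχ.contDiff_scaled (e k)
  have hχm : ∀ k, StronglyMeasurable fun y => χ (e k • y) := fun k =>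
    (hχk k).continuous.stronglyMeasurable
  have hek : ∀ y : E d, ∀ᶠ k in atTop, ‖e k • y‖ < 1 := fun y => by
    have : Tendsto (fun k => ‖e k • y‖) atTop (𝓝 0) := by
      simpa using (he0.smul_const y).norm
    exact this.eventually_lt_const one_pos
  have hχlim : ∀ y, Tendsto (fun k => χ (e k • y)) atTop (𝓝 1) := fun y =>
    tendsto_const_nhds.congr' (by filter_upwards [hek y] with k hk; exact (hχ.eq_one _ hk).symm)
  have hvnorm := tendsto_eLpNorm_of_tendsto (fun k => (hAm k).aestronglyMeasurable) hv hlimA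
  have hsmall : ∀ c : ℕ → ℝ, Tendsto c atTop (𝓝 0) →
      Tendsto (fun k => eLpNorm (fun y => c k * A k y) 2 (mu d σ)) atTop (𝓝 0) := by
    intro c hc
    have h1 : ∀ k, eLpNorm (fun y => c k * A k y) 2 (mu d σ) = ‖c k‖ₑ * eLpNorm (A k) 2 (mu d σ) :=
      fun k => eLpNorm_const_smul (c k) (A k) 2 (mu d σ)
    simp only [h1]
    have h2 := hc.enorm
    rw [enorm_zero] at h2
    simpa using ENNReal.Tendsto.mul h2 (Or.inr hv.2.ne) hvnorm (Or.inr ENNReal.zero_ne_top)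
  -- A single parameter governs smoothing at length `e k` and cutting off at distance `1 / e k`.
  refine ⟨fun k y => χ (e k • y) * A k y, fun k => (hχk k).mul (hA k), fun k => ?_, ?_,
    fun τ hτ hG => ?_, fun q hqm hq hq2 hG => ?_⟩
  · exact HasCompactSupport.mul_right
      (hχ.hasCompactSupport.comp_homeomorph (Homeomorph.smulOfNeZero (e k) (he k).ne'))
  · exact tendsto_eLpNorm_smul_sub hχm (fun k y => hχ.mem_Icc _) hχlim
      (fun k => (hAm k).aestronglyMeasurable) hv hlimA
  · have h1 := tendsto_eLpNorm_smul_sub hχm (fun k y => hχ.mem_Icc _) hχlim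
      (fun k => (hgm k).aestronglyMeasurable (μ := mu d τ)) hG
      (hlimG τ (by linarith [hτ.1]) hG)
    have hcc : Tendsto (fun k => Real.sqrt (2 * e k) * C₁) atTop (𝓝 0) := by
      have := ((he0.const_mul 2).sqrt).mul_const C₁
      simpa using this
    have h2 := h1.add (hsmall _ hcc)
    rw [add_zero] at h2
    refine tendsto_of_tendsto_of_tendsto_of_le_of_le tendsto_const_nhds h2 (fun _ => zero_le)
      fun k => ?_
    have h3 : grad (fun y => χ (e k • y) * A k y) - G
        = (fun y => χ (e k • y) • grad (A k) y - G y)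
          + fun y => (A k y * e k) • grad χ (e k • y) := by
      ext1 y
      simp only [Pi.sub_apply, Pi.add_apply]
      rw [grad_mul (hχk k) (hA k), grad_comp_smul hχ.contDiff, smul_smul]
      abel
    simp only
    rw [h3]
    exact (eLpNorm_add_le (((hχm k).smul (hgm k)).sub hGm).aestronglyMeasurable
      (stronglyMeasurable_mul_grad hχ (hA k) (e k)).aestronglyMeasurable (by norm_num)).trans
      (add_le_add le_rfl (eLpNorm_mul_grad_le hχ (hA k) (he k) (he1 k) hτ))
  · have h1 := tendsto_eLpNorm_smul_sub hχm (fun k y => hχ.mem_Icc _) hχlim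
      (fun k => (hlm k).aestronglyMeasurable (μ := mu d (2 + σ))) hq2
      (hlimq q hqm hq (2 + σ) (by linarith) hq2)
    have h2 : Tendsto (fun k => eLpNorm (fun y => {y : E d | 1 ≤ ‖e k • y‖}.indicator
        (fun _ => (1 : ℝ)) y • grad (A k) y) 2 (mu d σ)) atTop (𝓝 0) := by
      refine tendsto_eLpNorm_smul_zero (fun k => ?_) (fun k y => ?_) (fun y => ?_)
        (fun k => (hgm k).aestronglyMeasurable (μ := mu d σ)) hG (hlimG σ hσ hG)
      · exact stronglyMeasurable_const.indicator
          (isClosed_le continuous_const (by fun_prop)).measurableSet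
      · rw [indicator_apply]; split_ifs <;> simp
      · refine tendsto_const_nhds.congr' ?_
        filter_upwards [hek y] with k hk
        exact (indicator_of_notMem (by simpa using hk) _).symm
    have h2' : Tendsto (fun k => eLpNorm (fun y => (4 * C₁) • ({y : E d | 1 ≤ ‖e k • y‖}.indicator
        (fun _ => (1 : ℝ)) y • grad (A k) y)) 2 (mu d σ)) atTop (𝓝 0) := by
      have := ENNReal.Tendsto.const_mul (a := ‖4 * C₁‖ₑ) h2 (Or.inr enorm_ne_top)
      rw [mul_zero] at this
      exact this.congr fun k => (eLpNorm_const_smul (4 * C₁) _ 2 (mu d σ)).symm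
    have hcc : Tendsto (fun k => 2 * C₂ * e k) atTop (𝓝 0) := by
      simpa using he0.const_mul (2 * C₂)
    have h3 := (h1.add h2').add (hsmall _ hcc)
    rw [add_zero, add_zero] at h3
    refine tendsto_of_tendsto_of_tendsto_of_le_of_le tendsto_const_nhds h3 (fun _ => zero_le)
      fun k => ?_
    have h4 : lap (fun y => χ (e k • y) * A k y) - q
        = ((fun y => χ (e k • y) • lap (A k) y - q y)
          + fun y => 2 * inner ℝ (e k • grad χ (e k • y)) (grad (A k) y))
          + fun y => e k ^ 2 * lap χ (e k • y) * A k y := by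
      ext1 y
      simp only [Pi.sub_apply, Pi.add_apply]
      rw [lap_mul (hχk k) (hA k), grad_comp_smul hχ.contDiff, lap_comp_smul hχ.contDiff,
        smul_eq_mul]
      ring
    have hm1 : StronglyMeasurable fun y => χ (e k • y) • lap (A k) y - q y :=
      ((hχm k).smul (hlm k)).sub hqm
    have hm2 := stronglyMeasurable_inner_grad hχ (hA k) (e k)
    have hm3 := stronglyMeasurable_lap_mul hχ (hA k) (e k)
    simp only
    rw [h4]
    refine (eLpNorm_add_le (hm1.add hm2).aestronglyMeasurable hm3.aestronglyMeasurable
      (by norm_num)).trans ?_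
    exact add_le_add ((eLpNorm_add_le hm1.aestronglyMeasurable hm2.aestronglyMeasurable
      (by norm_num)).trans (add_le_add le_rfl (eLpNorm_inner_grad_le hχ (hA k) (he k) σ)))
      (eLpNorm_lap_mul_le hχ (hA k) (he k) σ)

end HalfSpace

namespace HalfSpace

variable {d : ℕ}

/-! ### Weak gradients: linearity and translations -/

lemma integrable_mul_of_tsupport_subset {v φ : E d → ℝ} (hv : LocallyIntegrableOn v (openHalf d))
    (hφ : Continuous φ) (hφc : HasCompactSupport φ) (hφH : tsupport φ ⊆ openHalf d) :
    Integrable fun y => v y * φ y := by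
  have h : IntegrableOn (fun y => v y * φ y) (tsupport φ) :=
    (hv.integrableOn_compact_subset hφH hφc).mul_continuousOn hφ.continuousOn hφc
  refine (integrableOn_iff_integrable_of_support_subset fun y hy => ?_).1 h
  exact subset_tsupport φ fun h0 => hy (by simp [h0])

lemma IsTestOnHalf.integrable_mul {v φ : E d → ℝ} (hφ : IsTestOnHalf φ)
    (hv : LocallyIntegrableOn v (openHalf d)) : Integrable fun y => v y * φ y :=
  integrable_mul_of_tsupport_subset hv hφ.1.continuous hφ.2.1 hφ.2.2

lemma IsTestOnHalf.setIntegral_eq {φ : E d → ℝ} (hφ : IsTestOnHalf φ) (v : E d → ℝ) :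
    ∫ y in openHalf d, v y * φ y = ∫ y, v y * φ y :=
  setIntegral_eq_integral_of_forall_compl_eq_zero fun y hy => by
    rw [image_eq_zero_of_notMem_tsupport fun h => hy (hφ.2.2 h), mul_zero]

lemma locallyIntegrableOn_apply {ι : Type*} [Fintype ι] {G : E d → EuclideanSpace ℝ ι}
    {s : Set (E d)} (hG : LocallyIntegrableOn G s) (i : ι) :
    LocallyIntegrableOn (fun y => G y i) s := by
  intro x hx
  obtain ⟨t, ht, hi⟩ := hG x hx
  exact ⟨t, ht, (EuclideanSpace.proj (𝕜 := ℝ) i : EuclideanSpace ℝ ι →L[ℝ] ℝ).integrable_comp hi⟩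

lemma HasWeakGradient.add {v v' : E d → ℝ} {G G' : E d → E d} (h : HasWeakGradient v G)
    (h' : HasWeakGradient v' G') : HasWeakGradient (v + v') (G + G') := by
  refine ⟨h.1.add h'.1, h.2.1.add h'.2.1, fun φ hφ i => ?_⟩
  simp only [Pi.add_apply, PiLp.add_apply, add_mul]
  rw [integral_add ((hφ.pd i).integrable_mul h.1).integrableOn
      ((hφ.pd i).integrable_mul h'.1).integrableOn,
    integral_add (hφ.integrable_mul (locallyIntegrableOn_apply h.2.1 i)).integrableOn
      (hφ.integrable_mul (locallyIntegrableOn_apply h'.2.1 i)).integrableOn,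
    h.2.2 φ hφ i, h'.2.2 φ hφ i, neg_add]

lemma HasWeakGradient.const_smul {v : E d → ℝ} {G : E d → E d} (h : HasWeakGradient v G) (c : ℝ) :
    HasWeakGradient (c • v) (c • G) := by
  refine ⟨h.1.smul c, h.2.1.smul c, fun φ hφ i => ?_⟩
  simp only [Pi.smul_apply, PiLp.smul_apply, smul_eq_mul, mul_assoc]
  rw [integral_const_mul, integral_const_mul, h.2.2 φ hφ i, mul_neg]

lemma HasWeakGradient.congr {v v' : E d → ℝ} {G G' : E d → E d} (h : HasWeakGradient v G)
    (hv : v =ᵐ[volume.restrict (openHalf d)] v') (hG : G =ᵐ[volume.restrict (openHalf d)] G') :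
    HasWeakGradient v' G' := by
  refine ⟨h.1.congr hv, h.2.1.congr hG, fun φ hφ i => ?_⟩
  rw [← integral_congr_ae (hv.mono fun y hy => by simp only [hy] :
      (fun y => v y * HalfSpace.pd i φ y) =ᵐ[_] fun y => v' y * HalfSpace.pd i φ y),
    ← integral_congr_ae (hG.mono fun y hy => by simp only [hy] :
      (fun y => G y i * φ y) =ᵐ[_] fun y => G' y i * φ y)]
  exact h.2.2 φ hφ i

lemma pd_comp_sub {φ : E d → ℝ} (w : E d) (i : Fin (d + 1)) :
    pd i (fun y => φ (y - w)) = fun y => pd i φ (y - w) := by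
  ext y
  simp [pd, fderiv_comp_sub]

lemma IsTestOnHalf.comp_sub {φ : E d → ℝ} (hφ : IsTestOnHalf φ) {w : E d}
    (hw : 0 ≤ w (Fin.last d)) : IsTestOnHalf fun y => φ (y - w) := by
  refine ⟨hφ.1.comp (contDiff_id.sub contDiff_const),
    hφ.2.1.comp_homeomorph (Homeomorph.subRight w), fun y hy => ?_⟩
  have h1 := hφ.2.2 (tsupport_comp_subset_preimage φ (f := fun z : E d => z - w) (by fun_prop) hy)
  have h2 : 0 < (y - w) (Fin.last d) := h1
  rw [PiLp.sub_apply] at h2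
  exact (by linarith : 0 < y (Fin.last d))

lemma locallyIntegrableOn_comp_add {B : Type*} [NormedAddCommGroup B] {F : E d → B}
    (hF : LocallyIntegrableOn F (openHalf d)) {w : E d} (hw : 0 ≤ w (Fin.last d)) :
    LocallyIntegrableOn (fun y => F (y + w)) (openHalf d) := by
  rw [locallyIntegrableOn_iff isOpen_openHalf.isLocallyClosed]
  intro K hKH hK
  have hK' : IsCompact ((fun y => y - w) ⁻¹' K) :=
    (Homeomorph.subRight w).isCompact_preimage.2 hK
  have h1 : IntegrableOn F ((fun y => y - w) ⁻¹' K) := by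
    refine hF.integrableOn_compact_subset (fun y hy => ?_) hK'
    have h2 : 0 < (y - w) (Fin.last d) := hKH hy
    rw [PiLp.sub_apply] at h2
    exact (by linarith : 0 < y (Fin.last d))
  have h2 := ((measurePreserving_add_right volume w).integrableOn_comp_preimage
    (measurableEmbedding_addRight w)).2 h1
  have h3 : (fun x => x + w) ⁻¹' ((fun y => y - w) ⁻¹' K) = K := by
    ext y
    simp only [mem_preimage, add_sub_cancel_right]
  rw [h3] at h2
  exact h2

lemma HasWeakGradient.comp_add {v : E d → ℝ} {G : E d → E d} (h : HasWeakGradient v G) {w : E d}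
    (hw : 0 ≤ w (Fin.last d)) : HasWeakGradient (fun y => v (y + w)) fun y => G (y + w) := by
  refine ⟨locallyIntegrableOn_comp_add h.1 hw, locallyIntegrableOn_comp_add h.2.1 hw,
    fun φ hφ i => ?_⟩
  have h1 := h.2.2 _ (hφ.comp_sub hw) i
  rw [((hφ.comp_sub hw).pd i).setIntegral_eq, (hφ.comp_sub hw).setIntegral_eq, pd_comp_sub] at h1
  rw [(hφ.pd i).setIntegral_eq, hφ.setIntegral_eq, ← integral_sub_right_eq_self _ w,
    ← integral_sub_right_eq_self (fun y => G (y + w) i * φ y) w]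
  simpa using h1

/-! ### Differences in the normal direction -/

/-- The weight `∫₀ʰ (z - t)₊ ^ σ dt`. -/
noncomputable def slab (σ h z : ℝ) : ℝ≥0∞ := ∫⁻ t in Ioc 0 h, wt σ (z - t)

lemma measurable_slab (σ h : ℝ) : Measurable (slab σ h) := by
  refine Measurable.lintegral_prod_right' (f := fun p : ℝ × ℝ => wt σ (p.1 - p.2)) ?_
  exact (measurable_wt σ).comp (measurable_fst.sub measurable_snd)

/-- The fundamental theorem of calculus for `t ↦ (z - t)₊ ^ (1 + σ)` on `[0, h]`. It measures
exactly how much of the weight is lost by a translation. -/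
lemma slab_add_wt {σ : ℝ} (hσ : -1 < σ) {h : ℝ} (hh : 0 < h) (z : ℝ) :
    ENNReal.ofReal (1 + σ) * slab σ h z + wt (1 + σ) (z - h) = wt (1 + σ) z := by
  rcases le_or_gt z 0 with hz | hz
  · rw [wt_of_nonpos _ hz, wt_of_nonpos _ (by linarith), slab,
      setLIntegral_congr_fun (g := fun _ => 0) measurableSet_Ioc fun t ht =>
        wt_of_nonpos _ (by linarith [ht.1])]
    simp
  -- After the substitution `r = z - t` this is the lower limit of integration, because the weight
  -- vanishes for `r ≤ 0`.
  set a := max 0 (z - h) with ha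
  have ha0 : 0 ≤ a := le_max_left _ _
  have haz : a ≤ z := max_le hz.le (by linarith)
  have h1 : slab σ h z = ∫⁻ r in Ioc a z, ENNReal.ofReal (r ^ σ) := by
    have h2 : slab σ h z = ∫⁻ r in Ico a z, wt σ r := by
      rw [slab, ← lintegral_indicator measurableSet_Ioc, ← lintegral_indicator measurableSet_Ico,
        ← lintegral_sub_left_eq_self _ z]
      congr 1
      ext r
      simp only [indicator_apply, mem_Ioc, mem_Ico, sub_sub_cancel]
      by_cases hr : 0 < r
      · refine if_congr ?_ rfl rfl
        rw [ha, max_le_iff]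
        constructor
        · exact fun h => ⟨⟨hr.le, by linarith [h.2]⟩, by linarith [h.1]⟩
        · exact fun h => ⟨by linarith [h.2], by linarith [h.1.2]⟩
      · simp [wt_of_nonpos σ (not_lt.1 hr)]
    rw [h2, setLIntegral_congr Ico_ae_eq_Ioc]
    exact setLIntegral_congr_fun measurableSet_Ioc fun r hr => wt_of_pos σ (ha0.trans_lt hr.1)
  have h3 : slab σ h z = ENNReal.ofReal ((z ^ (σ + 1) - a ^ (σ + 1)) / (σ + 1)) := by
    rw [h1, ← integral_rpow (Or.inl hσ), intervalIntegral.integral_of_le haz,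
      ofReal_integral_eq_lintegral_ofReal]
    · exact (intervalIntegrable_iff_integrableOn_Ioc_of_le haz).1
        (intervalIntegral.intervalIntegrable_rpow' hσ)
    · filter_upwards [ae_restrict_mem measurableSet_Ioc] with r hr
      exact Real.rpow_nonneg (ha0.trans hr.1.le) _
  have h4 : wt (1 + σ) (z - h) = ENNReal.ofReal (a ^ (σ + 1)) := by
    rcases le_or_gt (z - h) 0 with h5 | h5
    · rw [wt_of_nonpos _ h5, ha, max_eq_left h5, Real.zero_rpow (by linarith), ENNReal.ofReal_zero]
    · rw [wt_of_pos _ h5, ha, max_eq_right h5.le, add_comm 1 σ]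
  have h6 : a ^ (σ + 1) ≤ z ^ (σ + 1) := Real.rpow_le_rpow ha0 haz (by linarith)
  have h7 : 0 ≤ a ^ (σ + 1) := Real.rpow_nonneg ha0 _
  rw [h3, h4, wt_of_pos _ hz, ← ENNReal.ofReal_mul (by linarith), ← ENNReal.ofReal_add
    (mul_nonneg (by linarith) (div_nonneg (by linarith) (by linarith))) h7, add_comm 1 σ]
  have h8 : σ + 1 ≠ 0 := by linarith
  congr 1
  field_simp
  ring

/-- For `z ≥ 2 h` the ratio `(z - t) / z` lies in `[1/2, 1]`; the exponent `|σ|` treats both signs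
of `σ` at once. -/
lemma le_slab (σ : ℝ) {h z : ℝ} (hh : 0 < h) (hz : 2 * h ≤ z) :
    ENNReal.ofReal (h * (1 / 2) ^ |σ|) * wt σ z ≤ slab σ h z := by
  have hz0 : 0 < z := by linarith
  calc ENNReal.ofReal (h * (1 / 2) ^ |σ|) * wt σ z
      = ∫⁻ _ in Ioc 0 h, ENNReal.ofReal ((1 / 2) ^ |σ| * z ^ σ) := by
        rw [setLIntegral_const, Real.volume_Ioc, sub_zero, wt_of_pos σ hz0,
          ← ENNReal.ofReal_mul (by positivity), ← ENNReal.ofReal_mul (by positivity)]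
        congr 1; ring
    _ ≤ slab σ h z := by
        refine setLIntegral_mono' measurableSet_Ioc fun t ht => ?_
        have h1 : 0 < z - t := by linarith [ht.2]
        rw [wt_of_pos σ h1]
        refine ENNReal.ofReal_le_ofReal ?_
        have h2 : (1 / 2 : ℝ) ≤ (z - t) / z := by rw [le_div_iff₀ hz0]; linarith [ht.2]
        have h3 : (z - t) / z ≤ 1 := by rw [div_le_one hz0]; linarith [ht.1]
        calc (1 / 2 : ℝ) ^ |σ| * z ^ σ ≤ ((z - t) / z) ^ |σ| * z ^ σ := by gcongr
          _ ≤ ((z - t) / z) ^ σ * z ^ σ := by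
              gcongr ?_ * _
              exact Real.rpow_le_rpow_of_exponent_ge (by linarith) h3 (le_abs_self σ)
          _ = (z - t) ^ σ := by
              rw [← Real.mul_rpow (by linarith) hz0.le, div_mul_cancel₀ _ hz0.ne']

lemma sq_setLIntegral_Ioc_le (h : ℝ) {k : ℝ → ℝ≥0∞} (hk : Measurable k) :
    (∫⁻ t in Ioc 0 h, k t) ^ 2 ≤ ENNReal.ofReal h * ∫⁻ t in Ioc 0 h, k t ^ 2 := by
  have key := ENNReal.lintegral_mul_le_Lp_mul_Lq (volume.restrict (Ioc 0 h))
    Real.HolderConjugate.two_two (f := fun _ => 1) (g := k) (by fun_prop) hk.aemeasurable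
  simp only [Pi.mul_apply, one_mul, ENNReal.rpow_two, one_pow, setLIntegral_const,
    Real.volume_Ioc, sub_zero] at key
  refine (pow_le_pow_left' key 2).trans (le_of_eq ?_)
  rw [mul_pow, ← ENNReal.rpow_natCast, ← ENNReal.rpow_natCast, ← ENNReal.rpow_mul,
    ← ENNReal.rpow_mul]
  norm_num

/-- The unit vector in the normal direction, times `h`. -/
noncomputable def normal (d : ℕ) (h : ℝ) : E d := h • EuclideanSpace.single (Fin.last d) 1

lemma normal_last (d : ℕ) (h : ℝ) : normal d h (Fin.last d) = h := by simp [normal]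

lemma continuous_normal (d : ℕ) : Continuous (normal d) :=
  continuous_id.smul continuous_const

lemma enorm_sub_sq_le {w : E d → ℝ} (hw : ContDiff ℝ ∞ w) {h : ℝ} (hh : 0 < h) (y : E d) :
    ‖w (y + normal d h) - w y‖ₑ ^ 2
      ≤ ENNReal.ofReal h * ∫⁻ t in Ioc 0 h, ‖grad w (y + normal d t)‖ₑ ^ 2 := by
  have hd : ∀ t : ℝ, HasDerivAt (fun t => w (y + normal d t))
      (pd (Fin.last d) w (y + normal d t)) t := by
    intro t
    have h1 : HasDerivAt (fun t => y + normal d t) (EuclideanSpace.single (Fin.last d) 1) t := by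
      simpa [normal] using ((hasDerivAt_id t).smul_const
        (EuclideanSpace.single (Fin.last d) (1 : ℝ) : E d)).const_add y
    exact ((hw.differentiable (by simp) _).hasFDerivAt).comp_hasDerivAt t h1
  have hc : Continuous fun t : ℝ => pd (Fin.last d) w (y + normal d t) :=
    (contDiff_pd hw _).continuous.comp (continuous_const.add (continuous_normal d))
  have hc2 : Continuous fun t : ℝ => grad w (y + normal d t) :=
    (contDiff_grad hw).continuous.comp (continuous_const.add (continuous_normal d))
  have h0 : y = y + normal d 0 := by simp [normal]
  have h1 : w (y + normal d h) - w y = ∫ t in Ioc 0 h, pd (Fin.last d) w (y + normal d t) := by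
    rw [← intervalIntegral.integral_of_le hh.le,
      intervalIntegral.integral_eq_sub_of_hasDerivAt (fun t _ => hd t)
        (hc.intervalIntegrable _ _), ← h0]
  rw [h1]
  calc _ ≤ (∫⁻ t in Ioc 0 h, ‖pd (Fin.last d) w (y + normal d t)‖ₑ) ^ 2 := by
        gcongr
        exact enorm_integral_le_lintegral_enorm _
    _ ≤ (∫⁻ t in Ioc 0 h, ‖grad w (y + normal d t)‖ₑ) ^ 2 := by
        gcongr with t
        rw [← ofReal_norm, ← ofReal_norm]
        exact ENNReal.ofReal_le_ofReal (PiLp.norm_apply_le (grad w _) (Fin.last d))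
    _ ≤ _ := sq_setLIntegral_Ioc_le h hc2.measurable.enorm

/-- The fundamental theorem and Cauchy-Schwarz along the normal segment, then Fubini: translating by
`t` puts the integration in `t` onto the weight and produces `slab`. -/
lemma lintegral_enorm_sub_le {σ : ℝ} {w : E d → ℝ} (hw : ContDiff ℝ ∞ w) {h : ℝ} (hh : 0 < h) :
    ∫⁻ y, ‖w (y + normal d h) - w y‖ₑ ^ 2 ∂mu d σ
      ≤ ENNReal.ofReal h * ∫⁻ z, slab σ h (z (Fin.last d)) * ‖grad w z‖ₑ ^ 2 := by
  have hgm : Measurable fun z => ‖grad w z‖ₑ ^ 2 :=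
    ((contDiff_grad hw).continuous.measurable.enorm).pow_const 2
  have hm : Measurable fun p : E d × ℝ =>
      wt σ (p.1 (Fin.last d)) * ‖grad w (p.1 + normal d p.2)‖ₑ ^ 2 :=
    ((measurable_wt σ).comp (measurable_last.comp measurable_fst)).mul
      (hgm.comp (measurable_fst.add ((continuous_normal d).measurable.comp measurable_snd)))
  have hl : Measurable fun p : E d × ℝ => p.1 (Fin.last d) - p.2 := by fun_prop
  have hm' : Measurable fun p : E d × ℝ =>
      wt σ (p.1 (Fin.last d) - p.2) * ‖grad w p.1‖ₑ ^ 2 :=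
    ((measurable_wt σ).comp hl).mul (hgm.comp measurable_fst)
  calc ∫⁻ y, ‖w (y + normal d h) - w y‖ₑ ^ 2 ∂mu d σ
      = ∫⁻ y, wt σ (y (Fin.last d)) * ‖w (y + normal d h) - w y‖ₑ ^ 2 := by
        rw [lintegral_mu]
        have := hw.continuous
        exact (Continuous.measurable (by fun_prop)).enorm.pow_const 2
    _ ≤ ∫⁻ y, ENNReal.ofReal h * ∫⁻ t in Ioc 0 h,
          wt σ (y (Fin.last d)) * ‖grad w (y + normal d t)‖ₑ ^ 2 := by
        refine lintegral_mono fun y => ?_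
        have hy : Measurable fun t => ‖grad w (y + normal d t)‖ₑ ^ 2 := hgm.comp
          (measurable_const.add (continuous_normal d).measurable)
        simp only
        rw [lintegral_const_mul _ hy, mul_left_comm]
        gcongr
        exact enorm_sub_sq_le hw hh y
    _ = ENNReal.ofReal h * ∫⁻ t in Ioc 0 h, ∫⁻ y,
          wt σ (y (Fin.last d)) * ‖grad w (y + normal d t)‖ₑ ^ 2 := by
        rw [lintegral_const_mul _ (hm.lintegral_prod_right' :
          Measurable fun y => ∫⁻ t in Ioc 0 h,
            wt σ (y (Fin.last d)) * ‖grad w (y + normal d t)‖ₑ ^ 2),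
          lintegral_lintegral_swap hm.aemeasurable]
    _ = ENNReal.ofReal h * ∫⁻ t in Ioc 0 h, ∫⁻ z,
          wt σ (z (Fin.last d) - t) * ‖grad w z‖ₑ ^ 2 := by
        congr 1
        refine lintegral_congr fun t => ?_
        rw [← lintegral_sub_right_eq_self _ (normal d t)]
        simp [normal_last]
    _ = _ := by
        rw [← lintegral_lintegral_swap hm'.aemeasurable]
        congr 1
        refine lintegral_congr fun z => ?_
        have hz : Measurable fun t => wt σ (z (Fin.last d) - t) :=
          (measurable_wt σ).comp (measurable_const.sub measurable_id)
        rw [lintegral_mul_const _ hz]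
        rfl

/-- The weight `a` defines a measure dominated by a multiple of `mu d τ`, so `L²` convergence is
inherited. -/
lemma tendsto_lintegral_mul_enorm_sq {B : Type*} [NormedAddCommGroup B] {a : ℝ → ℝ≥0∞}
    (ha : Measurable a) {τ : ℝ} {K : ℝ≥0∞} (hK : K ≠ ⊤) (haK : ∀ r, a r ≤ K * wt τ r)
    {F : ℕ → E d → B} {F' : E d → B} (hF : ∀ k, StronglyMeasurable (F k))
    (hF'm : StronglyMeasurable F') (hF' : MemLp F' 2 (mu d τ))
    (h : Tendsto (fun k => eLpNorm (F k - F') 2 (mu d τ)) atTop (𝓝 0)) :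
    Tendsto (fun k => ∫⁻ y, a (y (Fin.last d)) * ‖F k y‖ₑ ^ 2) atTop
      (𝓝 (∫⁻ y, a (y (Fin.last d)) * ‖F' y‖ₑ ^ 2)) := by
  set ν : Measure (E d) := volume.withDensity fun y => a (y (Fin.last d)) with hν
  have hνeq : ∀ {F : E d → B}, StronglyMeasurable F →
      eLpNorm F 2 ν ^ 2 = ∫⁻ y, a (y (Fin.last d)) * ‖F y‖ₑ ^ 2 := by
    intro F hF
    have hal : Measurable fun y : E d => a (y (Fin.last d)) := ha.comp measurable_last
    rw [eLpNorm_two_sq, hν, lintegral_withDensity_eq_lintegral_mul _ hal (hF.enorm.pow_const 2)]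
    rfl
  have hle : ν ≤ K • mu d τ := by
    refine Measure.le_iff.2 fun s hs => ?_
    rw [hν, withDensity_apply _ hs, Measure.smul_apply, smul_eq_mul, ← lintegral_indicator_one hs,
      lintegral_mu τ (measurable_one.indicator hs), ← lintegral_indicator hs,
      ← lintegral_const_mul' _ _ hK]
    refine lintegral_mono fun y => ?_
    by_cases hy : y ∈ s
    · simpa [hy] using haK _
    · simp [hy]
  have h1 : Tendsto (fun k => eLpNorm (F k - F') 2 ν) atTop (𝓝 0) := by
    have h2 : Tendsto (fun k => K ^ (1 / 2 : ℝ) * eLpNorm (F k - F') 2 (mu d τ)) atTop (𝓝 0) := by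
      have := ENNReal.Tendsto.const_mul (a := K ^ (1 / 2 : ℝ)) h
        (Or.inr (ENNReal.rpow_ne_top_of_nonneg (by norm_num) hK))
      rwa [mul_zero] at this
    refine tendsto_of_tendsto_of_tendsto_of_le_of_le tendsto_const_nhds h2 (fun _ => zero_le)
      fun k => (eLpNorm_mono_measure _ hle).trans (le_of_eq ?_)
    rw [eLpNorm_smul_measure_of_ne_top (by norm_num)]
    simp
  have h3 := tendsto_eLpNorm_of_tendsto (fun k => (hF k).aestronglyMeasurable)
    (hF'.of_measure_le_smul hK hle) h1
  simp only [← hνeq (hF _), ← hνeq hF'm]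
  exact ENNReal.Tendsto.pow h3

/-- The `L²_σ` norm of a normal difference is bounded by a weighted norm of the gradient. -/
lemma HasWeakGradient.lintegral_enorm_sub_le {σ : ℝ} (hσ : -1 < σ) {v : E d → ℝ} {G : E d → E d}
    (hvG : HasWeakGradient v G) (hvm : StronglyMeasurable v) (hGm : StronglyMeasurable G)
    (hv : MemLp v 2 (mu d σ)) (hG : MemLp G 2 (mu d (1 + σ))) {h : ℝ} (hh : 0 < h) :
    ∫⁻ y, ‖v (y + normal d h) - v y‖ₑ ^ 2 ∂mu d σ
      ≤ ENNReal.ofReal h * ∫⁻ z, slab σ h (z (Fin.last d)) * ‖G z‖ₑ ^ 2 := by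
  obtain ⟨w, hw, -, hwv, hwG, -⟩ := exists_smooth_approx hσ hvm hGm hv hvG
  have hwm : ∀ k, AEStronglyMeasurable (w k) (mu d σ) := fun k =>
    (hw k).continuous.aestronglyMeasurable
  obtain ⟨ns, hns, hae⟩ := exists_subseq_tendsto_ae hwm hv.1 hwv
  -- Drop the translated weight in `slab_add_wt`.
  have hK : ∀ r, slab σ h r ≤ (ENNReal.ofReal (1 + σ))⁻¹ * wt (1 + σ) r := by
    intro r
    rw [← slab_add_wt hσ hh r, mul_add, ← mul_assoc, ENNReal.inv_mul_cancel, one_mul]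
    · exact le_self_add
    · simpa using (by linarith : 0 < 1 + σ)
    · simp
  have hlim := (tendsto_lintegral_mul_enorm_sq (measurable_slab σ h) (by
    simpa using (by linarith : 0 < 1 + σ)) hK (fun k => (contDiff_grad (hw k)).continuous.stronglyMeasurable) hGm hG
    (hwG (1 + σ) ⟨by linarith, le_rfl⟩ hG)).comp hns.tendsto_atTop
  have hae' : ∀ᵐ y ∂mu d σ, Tendsto (fun k => w (ns k) (y + normal d h)) atTop
      (𝓝 (v (y + normal d h))) := by
    have h1 := (ae_restrict_iff' isOpen_openHalf.measurableSet).1 (absolutelyContinuous_mu σ hae)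
    have h2 := (measurePreserving_add_right volume (normal d h)).quasiMeasurePreserving.ae h1
    refine mu_absolutelyContinuous σ
      ((ae_restrict_iff' isOpen_openHalf.measurableSet).2 ?_)
    filter_upwards [h2] with y hy hyH
    refine hy ?_
    have : 0 < y (Fin.last d) := hyH
    simp only [openHalf, mem_ofPred_eq, PiLp.add_apply, normal_last]
    linarith
  -- For negative `σ` translation is not bounded on `L²_σ`. Fatou needs only convergence almost
  -- everywhere on this side; on the other side the limit is a true one.
  calc ∫⁻ y, ‖v (y + normal d h) - v y‖ₑ ^ 2 ∂mu d σ
      ≤ ∫⁻ y, liminf (fun k => ‖w (ns k) (y + normal d h) - w (ns k) y‖ₑ ^ 2) atTop ∂mu d σ := by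
        refine lintegral_mono_ae ?_
        filter_upwards [hae, hae'] with y h1 h2
        exact (ENNReal.Tendsto.pow (n := 2) ((h2.sub h1).enorm)).liminf_eq.ge
    _ ≤ liminf (fun k => ∫⁻ y, ‖w (ns k) (y + normal d h) - w (ns k) y‖ₑ ^ 2 ∂mu d σ) atTop := by
        refine lintegral_liminf_le fun k => ?_
        have := (hw (ns k)).continuous
        exact (Continuous.measurable (by fun_prop)).enorm.pow_const 2
    _ ≤ liminf (fun k => ENNReal.ofReal h * ∫⁻ z, slab σ h (z (Fin.last d))
          * ‖grad (w (ns k)) z‖ₑ ^ 2) atTop :=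
        liminf_le_liminf (Eventually.of_forall fun k =>
          HalfSpace.lintegral_enorm_sub_le (hw (ns k)) hh)
    _ = _ := (ENNReal.Tendsto.const_mul hlim (Or.inr ENNReal.ofReal_ne_top)).liminf_eq

end HalfSpace

lemma MeasureTheory.MemLp.lintegral_enorm_sq_eq {α : Type*} [MeasurableSpace α] {μ : Measure α}
    {B : Type*} [NormedAddCommGroup B] {F : α → B} (hF : MemLp F 2 μ) :
    ∫⁻ x, ‖F x‖ₑ ^ 2 ∂μ = ENNReal.ofReal (∫ x, ‖F x‖ ^ 2 ∂μ) := by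
  rw [ofReal_integral_eq_lintegral_ofReal (hF.integrable_norm_pow two_ne_zero)
    (ae_of_all _ fun x => sq_nonneg _)]
  simp only [enorm_sq_eq_ofReal]

lemma memLp_two_of_lintegral_lt_top {α : Type*} [MeasurableSpace α] {μ : Measure α}
    {B : Type*} [NormedAddCommGroup B] {F : α → B} (hF : AEStronglyMeasurable F μ)
    (h : ∫⁻ x, ‖F x‖ₑ ^ 2 ∂μ < ⊤) : MemLp F 2 μ := by
  refine ⟨hF, ?_⟩
  rw [← eLpNorm_two_sq] at h
  by_contra h1
  rw [not_lt, top_le_iff] at h1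
  simp [h1] at h

lemma MeasureTheory.MemLp.integrable_inner {α : Type*} [MeasurableSpace α] {μ : Measure α}
    {B : Type*} [NormedAddCommGroup B] [InnerProductSpace ℝ B] {F F' : α → B} (hF : MemLp F 2 μ)
    (hF' : MemLp F' 2 μ) : Integrable (fun x => inner ℝ (F x) (F' x)) μ :=
  (hF.norm.integrable_mul hF'.norm).mono (hF.1.inner hF'.1) (ae_of_all _ fun x => by
    simpa using norm_inner_le_norm (𝕜 := ℝ) (F x) (F' x))

/-! ### The first order elliptic estimate by normal translations -/

namespace HalfSpace

variable {d : ℕ}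

/-- `G` represents `g`: this is the weak form of `-y_n Δ v - (1 + σ) ∂_n v = g` for `G = ∇v`. -/
def IsWeakElliptic (σ : ℝ) (G : E d → E d) (g : E d → ℝ) : Prop :=
  ∀ (ζ : E d → ℝ) (Z : E d → E d), MemLp ζ 2 (mu d σ) → MemLp Z 2 (mu d (1 + σ)) →
    HasWeakGradient ζ Z → ∫ y, inner ℝ (G y) (Z y) ∂mu d (1 + σ) = ∫ y, g y * ζ y ∂mu d σ

lemma lintegral_comp_add_normal (τ h : ℝ) {F : E d → ℝ≥0∞} (hF : Measurable F) :
    ∫⁻ y, F (y + normal d h) ∂mu d τ = ∫⁻ y, wt τ (y (Fin.last d) - h) * F y := by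
  have hm : Measurable fun y => F (y + normal d h) :=
    hF.comp (measurable_id.add_const (normal d h))
  rw [lintegral_mu τ hm, ← lintegral_sub_right_eq_self _ (normal d h)]
  simp [normal_last]

lemma slab_lintegral_add {σ : ℝ} (hσ : -1 < σ) {h : ℝ} (hh : 0 < h) {F : E d → ℝ≥0∞}
    (hF : Measurable F) :
    ENNReal.ofReal (1 + σ) * (∫⁻ z, slab σ h (z (Fin.last d)) * F z)
      + ∫⁻ y, F (y + normal d h) ∂mu d (1 + σ) = ∫⁻ y, F y ∂mu d (1 + σ) := by
  have hm : Measurable fun z : E d => slab σ h (z (Fin.last d)) * F z :=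
    ((measurable_slab σ h).comp measurable_last).mul hF
  rw [lintegral_comp_add_normal _ _ hF, lintegral_mu _ hF, ← lintegral_const_mul _ hm,
    ← lintegral_add_left (hm.const_mul _)]
  refine lintegral_congr fun z => ?_
  rw [← slab_add_wt hσ hh (z (Fin.last d)), add_mul, mul_assoc]

/-- Test with `ζ = v(· + h e_n) - v`. As `G · (G(· + h e_n) - G) ≤ (|G(· + h e_n)|² - |G|²) / 2`,
the left side is at most `-(1 + σ) S / 2` by the slab identity. On the right, Young's inequality and
`‖ζ‖² ≤ h S` cost `(1 + σ) S / 4` and `h ‖g‖² / (1 + σ)`. Half of the gain survives. -/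
lemma IsWeakElliptic.slab_lintegral_le {σ : ℝ} (hσ : -1 < σ) {v g : E d → ℝ} {G : E d → E d}
    (hvm : StronglyMeasurable v) (hGm : StronglyMeasurable G) (hv : MemLp v 2 (mu d σ))
    (hG : MemLp G 2 (mu d (1 + σ))) (hvG : HasWeakGradient v G) (hg : MemLp g 2 (mu d σ))
    (hell : IsWeakElliptic σ G g) {h : ℝ} (hh : 0 < h) :
    ∫⁻ z, slab σ h (z (Fin.last d)) * ‖G z‖ₑ ^ 2
      ≤ ENNReal.ofReal (4 * h / (1 + σ) ^ 2 * ∫ y, ‖g y‖ ^ 2 ∂mu d σ) := by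
  have hσ1 : 0 < 1 + σ := by linarith
  set S := ∫⁻ z, slab σ h (z (Fin.last d)) * ‖G z‖ₑ ^ 2 with hS
  have hGe : Measurable fun y => ‖G y‖ₑ ^ 2 := hGm.enorm.pow_const 2
  have hP := hG.lintegral_enorm_sq_eq
  have hsum := slab_lintegral_add (d := d) hσ hh hGe
  rw [← hS, hP] at hsum
  -- Absorbing `S` is legitimate only once it is known to be finite.
  have hSfin : S ≠ ⊤ := by
    intro h0
    rw [h0, ENNReal.mul_top (by simpa using hσ1), top_add] at hsum
    exact ENNReal.ofReal_ne_top hsum.symm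
  have hadd : Measurable fun y : E d => y + normal d h := measurable_id.add_const _
  have hGs : MemLp (fun y => G (y + normal d h)) 2 (mu d (1 + σ)) := by
    refine memLp_two_of_lintegral_lt_top (hGm.comp_measurable hadd).aestronglyMeasurable ?_
    refine lt_of_le_of_lt (le_add_self.trans hsum.le) ENNReal.ofReal_lt_top
  rw [hGs.lintegral_enorm_sq_eq, ← ENNReal.ofReal_toReal hSfin, ← ENNReal.ofReal_mul hσ1.le,
    ← ENNReal.ofReal_add (by positivity) (integral_nonneg fun y => sq_nonneg _),
    ENNReal.ofReal_eq_ofReal_iff (add_nonneg (by positivity) (integral_nonneg fun y => sq_nonneg _))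
      (integral_nonneg fun y => sq_nonneg _)] at hsum
  have hz := hvG.lintegral_enorm_sub_le hσ hvm hGm hv hG hh
  rw [← hS] at hz
  -- The difference is square integrable by the slab bound, although for negative `σ` the translate
  -- alone need not be.
  have hζ : MemLp (fun y => v (y + normal d h) - v y) 2 (mu d σ) :=
    memLp_two_of_lintegral_lt_top ((hvm.comp_measurable hadd).sub hvm).aestronglyMeasurable
      (hz.trans_lt (ENNReal.mul_lt_top ENNReal.ofReal_lt_top hSfin.lt_top))
  rw [hζ.lintegral_enorm_sq_eq, ← ENNReal.ofReal_toReal hSfin, ← ENNReal.ofReal_mul hh.le,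
    ENNReal.ofReal_le_ofReal_iff (by positivity)] at hz
  have hwg : HasWeakGradient (fun y => v (y + normal d h) - v y)
      fun y => G (y + normal d h) - G y := by
    have := (hvG.comp_add (w := normal d h) (by rw [normal_last]; exact hh.le)).add
      (hvG.const_smul (-1))
    convert this using 1
    · ext y; simp [sub_eq_add_neg]
    · ext1 y; simp [sub_eq_add_neg]
  have heq := hell _ _ hζ (hGs.sub hG) hwg
  simp only [Pi.sub_apply] at heq
  have h1 : ∫ y, inner ℝ (G y) (G (y + normal d h) - G y) ∂mu d (1 + σ)
      ≤ ∫ y, (1 / 2) * (‖G (y + normal d h)‖ ^ 2 - ‖G y‖ ^ 2) ∂mu d (1 + σ) := by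
    refine integral_mono (hG.integrable_inner (hGs.sub hG)) (((hGs.integrable_norm_pow two_ne_zero).sub
      (hG.integrable_norm_pow two_ne_zero)).const_mul _) fun y => ?_
    have := norm_sub_sq_real (G (y + normal d h)) (G y)
    simp only [inner_sub_right, real_inner_self_eq_norm_sq]
    rw [real_inner_comm]
    nlinarith [sq_nonneg ‖G (y + normal d h) - G y‖]
  rw [integral_const_mul, integral_sub (hGs.integrable_norm_pow two_ne_zero)
    (hG.integrable_norm_pow two_ne_zero), heq] at h1
  have h2 : ∫ y, -((h / (1 + σ)) * ‖g y‖ ^ 2 + ((1 + σ) / (4 * h)) *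
      ‖v (y + normal d h) - v y‖ ^ 2) ∂mu d σ ≤ ∫ y, g y * (v (y + normal d h) - v y) ∂mu d σ := by
    refine integral_mono (((hg.integrable_norm_pow two_ne_zero).const_mul _).add
      ((hζ.integrable_norm_pow two_ne_zero).const_mul _)).neg (hg.integrable_mul hζ) fun y => ?_
    simp only [Real.norm_eq_abs, sq_abs]
    have h3 : (h / (1 + σ)) * g y ^ 2 + ((1 + σ) / (4 * h)) * (v (y + normal d h) - v y) ^ 2
        + g y * (v (y + normal d h) - v y)
        = (h / (1 + σ)) * (g y + (1 + σ) / (2 * h) * (v (y + normal d h) - v y)) ^ 2 := by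
      field_simp
      ring
    have h4 : 0 ≤ (h / (1 + σ)) * (g y + (1 + σ) / (2 * h) * (v (y + normal d h) - v y)) ^ 2 := by
      positivity
    linarith
  rw [integral_neg, integral_add ((hg.integrable_norm_pow two_ne_zero).const_mul _)
    ((hζ.integrable_norm_pow two_ne_zero).const_mul _), integral_const_mul,
    integral_const_mul] at h2
  have h5 : (1 + σ) / (4 * h) * ∫ y, ‖v (y + normal d h) - v y‖ ^ 2 ∂mu d σ
      ≤ (1 + σ) / 4 * S.toReal := by
    calc _ ≤ (1 + σ) / (4 * h) * (h * S.toReal) := by gcongr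
      _ = _ := by field_simp
  rw [← ENNReal.ofReal_toReal hSfin]
  refine ENNReal.ofReal_le_ofReal ?_
  have h6 : (1 + σ) / 4 * S.toReal ≤ h / (1 + σ) * ∫ y, ‖g y‖ ^ 2 ∂mu d σ := by linarith
  calc S.toReal = 4 / (1 + σ) * ((1 + σ) / 4 * S.toReal) := by field_simp
    _ ≤ 4 / (1 + σ) * (h / (1 + σ) * ∫ y, ‖g y‖ ^ 2 ∂mu d σ) := by gcongr
    _ = _ := by field_simp

/-- The first order estimate: the gradient lies in the space with the smaller weight exponent. -/
theorem IsWeakElliptic.lintegral_grad_le {σ : ℝ} (hσ : -1 < σ) {v g : E d → ℝ} {G : E d → E d}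
    (hvm : StronglyMeasurable v) (hGm : StronglyMeasurable G) (hv : MemLp v 2 (mu d σ))
    (hG : MemLp G 2 (mu d (1 + σ))) (hvG : HasWeakGradient v G) (hg : MemLp g 2 (mu d σ))
    (hell : IsWeakElliptic σ G g) :
    ∫⁻ y, ‖G y‖ₑ ^ 2 ∂mu d σ
      ≤ ENNReal.ofReal (4 / ((1 / 2) ^ |σ| * (1 + σ) ^ 2)) * ∫⁻ y, ‖g y‖ₑ ^ 2 ∂mu d σ := by
  have hσ1 : 0 < 1 + σ := by linarith
  have hGe : Measurable fun y => ‖G y‖ₑ ^ 2 := hGm.enorm.pow_const 2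
  set c₀ : ℝ := (1 / 2) ^ |σ| with hc₀
  have hc₀0 : 0 < c₀ := by positivity
  set s : ℕ → Set (E d) := fun k => {y | 1 / ((k : ℝ) + 1) ≤ y (Fin.last d)} with hs
  have hsm : ∀ k, MeasurableSet (s k) := fun k => measurableSet_le measurable_const measurable_last
  have hle : ∀ k, ∫⁻ y in s k, wt σ (y (Fin.last d)) * ‖G y‖ₑ ^ 2
      ≤ ENNReal.ofReal (4 / (c₀ * (1 + σ) ^ 2) * ∫ y, ‖g y‖ ^ 2 ∂mu d σ) := by
    intro k
    -- The height threshold of `s k` is `2 * h`, as `le_slab` demands. Both sides carry a factor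
    -- `h`, so the resulting bound does not depend on `k`.
    set h : ℝ := 1 / (2 * ((k : ℝ) + 1)) with hh
    have hh0 : 0 < h := by positivity
    have h1 := hell.slab_lintegral_le hσ hvm hGm hv hG hvG hg hh0
    have h2 : ENNReal.ofReal (h * c₀) * ∫⁻ y in s k, wt σ (y (Fin.last d)) * ‖G y‖ₑ ^ 2
        ≤ ENNReal.ofReal (4 * h / (1 + σ) ^ 2 * ∫ y, ‖g y‖ ^ 2 ∂mu d σ) := by
      refine le_trans ?_ h1
      rw [← lintegral_const_mul' _ _ ENNReal.ofReal_ne_top]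
      refine le_trans (setLIntegral_mono' (hsm k) fun y hy => ?_) (setLIntegral_le_lintegral (s k) _)
      rw [← mul_assoc]
      gcongr
      refine le_slab σ hh0 (le_trans (le_of_eq ?_) hy)
      rw [hh]; field_simp
    have h3 : ENNReal.ofReal (h * c₀) ≠ 0 := by simp; positivity
    rw [← ENNReal.mul_le_mul_iff_right h3 ENNReal.ofReal_ne_top]
    refine h2.trans (le_of_eq ?_)
    rw [← ENNReal.ofReal_mul (by positivity)]
    congr 1
    field_simp
  have hH : openHalf d = ⋃ k, s k := by
    ext y
    simp only [mem_iUnion, hs, mem_ofPred_eq, openHalf]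
    constructor
    · intro hy
      obtain ⟨k, hk⟩ := exists_nat_one_div_lt hy
      exact ⟨k, hk.le⟩
    · rintro ⟨k, hk⟩
      exact lt_of_lt_of_le (by positivity) hk
  have hmono : Monotone s := by
    intro k l hkl y hy
    refine le_trans (?_ : 1 / ((l : ℝ) + 1) ≤ 1 / ((k : ℝ) + 1)) hy
    have : (k : ℝ) ≤ l := by exact_mod_cast hkl
    gcongr
  rw [hg.lintegral_enorm_sq_eq, ← ENNReal.ofReal_mul (by positivity), lintegral_mu σ hGe,
    ← setLIntegral_eq_of_support_subset (s := openHalf d), hH,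
    setLIntegral_iUnion_of_directed _ hmono.directed_le]
  · exact iSup_le hle
  · intro y hy
    by_contra h0
    exact hy (by simp [wt_of_nonpos σ (not_lt.1 h0)])

end HalfSpace

/-! ### Integration by parts against the weight and the Hessian estimate for smooth functions -/

/-- The function `r ↦ r₊ ^ a` is differentiable for `a > 1`. -/
lemma hasDerivAt_max_rpow {a : ℝ} (ha : 1 < a) (r : ℝ) :
    HasDerivAt (fun r : ℝ => max r 0 ^ a) (a * max r 0 ^ (a - 1)) r := by
  have ha1 : a - 1 ≠ 0 := by linarith
  rcases lt_trichotomy r 0 with hr | rfl | hr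
  · rw [max_eq_right hr.le, Real.zero_rpow ha1, mul_zero]
    refine (hasDerivAt_const r (0 : ℝ)).congr_of_eventuallyEq ?_
    filter_upwards [Iio_mem_nhds hr] with x hx
    rw [max_eq_right (le_of_lt hx), Real.zero_rpow (by linarith)]
  · rw [max_self, Real.zero_rpow ha1, mul_zero, hasDerivAt_iff_tendsto_slope]
    have hc : Continuous fun x : ℝ => max x 0 ^ (a - 1) :=
      (continuous_id.max continuous_const).rpow_const fun _ => Or.inr (by linarith)
    have h1 := hc.tendsto 0
    rw [max_self, Real.zero_rpow ha1] at h1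
    refine (h1.mono_left nhdsWithin_le_nhds).congr' ?_
    filter_upwards [self_mem_nhdsWithin] with x hx
    rw [slope_def_field, max_self, Real.zero_rpow (by linarith), sub_zero, sub_zero]
    rcases lt_or_gt_of_ne (show x ≠ 0 from hx) with h2 | h2
    · rw [max_eq_right h2.le, Real.zero_rpow ha1, Real.zero_rpow (by linarith), zero_div]
    · rw [max_eq_left h2.le, Real.rpow_sub_one h2.ne']
  · rw [max_eq_left hr.le]
    refine (Real.hasDerivAt_rpow_const (Or.inl hr.ne')).congr_of_eventuallyEq ?_
    filter_upwards [Ioi_mem_nhds hr] with x hx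
    rw [max_eq_left (le_of_lt hx)]

namespace HalfSpace

variable {d : ℕ}

lemma integral_mu (τ : ℝ) (F : E d → ℝ) :
    ∫ y, F y ∂mu d τ = ∫ y in openHalf d, y (Fin.last d) ^ τ * F y := by
  rw [mu, integral_withDensity_eq_integral_toReal_smul (g := F)
    ((measurable_last.pow_const τ).ennreal_ofReal) (ae_of_all _ fun _ => ENNReal.ofReal_lt_top)]
  refine setIntegral_congr_fun isOpen_openHalf.measurableSet fun y hy => ?_
  simp only [smul_eq_mul]
  rw [ENNReal.toReal_ofReal (Real.rpow_nonneg (le_of_lt hy) _)]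

/-- For a positive exponent the weight extends continuously by zero, and integrals over `H` become
integrals over `ℝⁿ`. -/
lemma integral_mu_eq_max {τ : ℝ} (hτ : 0 < τ) (F : E d → ℝ) :
    ∫ y, F y ∂mu d τ = ∫ y, max (y (Fin.last d)) 0 ^ τ * F y := by
  have h : ∫ y in openHalf d, max (y (Fin.last d)) 0 ^ τ * F y
      = ∫ y, max (y (Fin.last d)) 0 ^ τ * F y := by
    refine setIntegral_eq_integral_of_forall_compl_eq_zero fun y hy => ?_
    have hy0 : y (Fin.last d) ≤ 0 := not_lt.1 hy
    rw [max_eq_right hy0, Real.zero_rpow hτ.ne', zero_mul]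
  rw [integral_mu, ← h]
  refine setIntegral_congr_fun isOpen_openHalf.measurableSet fun y hy => ?_
  have hy0 : 0 < y (Fin.last d) := hy
  simp only
  rw [max_eq_left hy0.le]

lemma integral_mu_natCast_add (k : ℕ) (τ : ℝ) (F : E d → ℝ) :
    ∫ y, F y ∂mu d (k + τ) = ∫ y, y (Fin.last d) ^ k * F y ∂mu d τ := by
  rw [integral_mu, integral_mu]
  refine setIntegral_congr_fun isOpen_openHalf.measurableSet fun y hy => ?_
  have hy0 : 0 < y (Fin.last d) := hy
  simp only
  rw [Real.rpow_add hy0, Real.rpow_natCast]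
  ring

/-- Integration by parts against the weight. -/
lemma integral_pd_mu {a : ℝ} (ha : 1 < a) {F : E d → ℝ} (hF : ContDiff ℝ ∞ F)
    (hFc : HasCompactSupport F) (i : Fin (d + 1)) :
    ∫ y, pd i F y ∂mu d a = if i = Fin.last d then -(a * ∫ y, F y ∂mu d (a - 1)) else 0 := by
  set e : E d := EuclideanSpace.single i 1 with he
  have hw : ∀ y : E d, HasFDerivAt (fun y : E d => max (y (Fin.last d)) 0 ^ a)
      ((a * max (y (Fin.last d)) 0 ^ (a - 1)) •
        (EuclideanSpace.proj (Fin.last d) : E d →L[ℝ] ℝ)) y := fun y =>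
    (hasDerivAt_max_rpow ha _).comp_hasFDerivAt y
      (EuclideanSpace.proj (𝕜 := ℝ) (Fin.last d) : E d →L[ℝ] ℝ).hasFDerivAt
  have hc : ∀ b : ℝ, 0 ≤ b → Continuous fun y : E d => max (y (Fin.last d)) 0 ^ b := fun b hb =>
    (Continuous.max (by fun_prop) continuous_const).rpow_const fun _ => Or.inr hb
  have hpc : Continuous (pd i F) := (contDiff_pd hF i).continuous
  have hfd : ∀ y : E d, fderiv ℝ (fun y : E d => max (y (Fin.last d)) 0 ^ a) y e
      = if i = Fin.last d then a * max (y (Fin.last d)) 0 ^ (a - 1) else 0 := by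
    intro y
    rw [(hw y).fderiv]
    by_cases hi : i = Fin.last d
    · simp [he, hi]
    · simp [he, hi, Ne.symm hi]
  -- Since `a > 1`, the extended weight is differentiable across the boundary and no boundary term
  -- arises.
  have key := integral_mul_fderiv_eq_neg_fderiv_mul_of_integrable (μ := (volume : Measure (E d)))
    (f := fun y : E d => max (y (Fin.last d)) 0 ^ a) (g := F) (v := e) (by
      simp only [hfd]
      split_ifs
      · exact (((hc _ (by linarith)).const_mul a).mul hF.continuous).integrable_of_hasCompactSupport
          hFc.mul_left
      · simp)
    (((hc a (by linarith)).mul hpc).integrable_of_hasCompactSupport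
      (hasCompactSupport_pd hFc i).mul_left)
    (((hc a (by linarith)).mul hF.continuous).integrable_of_hasCompactSupport hFc.mul_left)
    (fun y _ => (hw y).differentiableAt) (fun y _ => hF.differentiable (by simp) y)
  rw [integral_mu_eq_max (by linarith), integral_mu_eq_max (by linarith)]
  refine key.trans ?_
  simp only [hfd]
  split_ifs
  · simp only [mul_assoc, integral_const_mul]
  · simp

/-- The Hessian bound for smooth functions up to the boundary. -/
lemma integral_hess_le {σ : ℝ} (hσ : -1 < σ) {w : E d → ℝ} (hw : ContDiff ℝ ∞ w)
    (hwc : HasCompactSupport w) :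
    ∫ y, ‖hess w y‖ ^ 2 ∂mu d (2 + σ) ≤ 3 * (∫ y, ‖lap w y‖ ^ 2 ∂mu d (2 + σ))
      + 2 * (2 + σ) ^ 2 * ∫ y, ‖grad w y‖ ^ 2 ∂mu d σ := by
  set a := 2 + σ with ha
  set n := Fin.last d with hn
  have hint : ∀ {τ : ℝ}, -1 < τ → ∀ {F : E d → ℝ}, Continuous F → HasCompactSupport F →
      Integrable F (mu d τ) := by
    intro τ hτ F hF hFc
    have := isLocallyFiniteMeasure_mu (d := d) hτ
    exact hF.integrable_of_hasCompactSupport hFc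
  have h1 : ∀ i, ContDiff ℝ ∞ (pd i w) := fun i => contDiff_pd hw i
  have h2 : ∀ i j, ContDiff ℝ ∞ (pd i (pd j w)) := fun i j => contDiff_pd (h1 j) i
  have hc1 : ∀ i, HasCompactSupport (pd i w) := fun i => hasCompactSupport_pd hwc i
  -- Summed over `i` and `j`, `|D²w|² - (Δw)²` is a divergence; the third derivatives cancel.
  have hpt : ∀ i j y, pd i (pd j w) y ^ 2 - pd i (pd i w) y * pd j (pd j w) y
      = pd i (fun y => pd j w y * pd i (pd j w) y) y
        - pd j (fun y => pd j w y * pd i (pd i w) y) y := by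
    intro i j y
    rw [pd_mul (h1 j) (h2 i j), pd_mul (h1 j) (h2 i i), pd_comm (h1 i) j i,
      pd_comm hw j i]
    ring
  have hij : ∀ i j, ∫ y, pd i (pd j w) y ^ 2 - pd i (pd i w) y * pd j (pd j w) y ∂mu d a
      = (if i = n then -(a * ∫ y, pd j w y * pd i (pd j w) y ∂mu d (a - 1)) else 0)
        - (if j = n then -(a * ∫ y, pd j w y * pd i (pd i w) y ∂mu d (a - 1)) else 0) := by
    intro i j
    have hF1 := (h1 j).mul (h2 i j)
    have hF2 := (h1 j).mul (h2 i i)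
    simp only [hpt]
    rw [integral_sub, integral_pd_mu (by linarith) hF1 (hc1 j).mul_right,
      integral_pd_mu (by linarith) hF2 (hc1 j).mul_right]
    · exact hint (by linarith) (contDiff_pd hF1 i).continuous
        (hasCompactSupport_pd (hc1 j).mul_right i)
    · exact hint (by linarith) (contDiff_pd hF2 j).continuous
        (hasCompactSupport_pd (hc1 j).mul_right j)
  have hi1 : ∀ i j, Integrable (fun y => pd i (pd j w) y ^ 2 - pd i (pd i w) y * pd j (pd j w) y)
      (mu d a) := by
    intro i j
    refine hint (by linarith) ?_ ?_
    · have := (h2 i j).continuous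
      have := (h2 i i).continuous
      have := (h2 j j).continuous
      fun_prop
    · refine HasCompactSupport.sub ?_ (hasCompactSupport_pd (hc1 i) i).mul_right
      simp only [sq]
      exact (hasCompactSupport_pd (hc1 j) i).mul_right
  have hi2 : ∀ j, Integrable (fun y => pd j w y * pd n (pd j w) y) (mu d (a - 1)) := fun j =>
    hint (by linarith) ((h1 j).mul (h2 n j)).continuous (hc1 j).mul_right
  have hi3 : ∀ i, Integrable (fun y => pd n w y * pd i (pd i w) y) (mu d (a - 1)) := fun i =>
    hint (by linarith) ((h1 n).mul (h2 i i)).continuous (hc1 n).mul_right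
  -- Only the normal derivatives meet the weight, so all remaining terms carry one power of `y_n`
  -- less and the factor `a`.
  have hsum : ∫ y, ‖hess w y‖ ^ 2 - lap w y ^ 2 ∂mu d a
      = a * ∫ y, pd n w y * lap w y - ∑ j, pd j w y * pd n (pd j w) y ∂mu d (a - 1) := by
    have e1 : ∀ y, ‖hess w y‖ ^ 2 - lap w y ^ 2
        = ∑ i, ∑ j, (pd i (pd j w) y ^ 2 - pd i (pd i w) y * pd j (pd j w) y) := by
      intro y
      simp only [EuclideanSpace.norm_sq_eq, hess_apply, Real.norm_eq_abs, sq_abs, lap,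
        Finset.sum_sub_distrib, sq (∑ i, pd i (pd i w) y), Finset.sum_mul_sum,
        Fintype.sum_prod_type]
    simp only [e1]
    rw [integral_finsetSum _ fun i _ => integrable_finsetSum _ fun j _ => hi1 i j]
    simp only [integral_finsetSum _ fun j _ => hi1 _ j, hij]
    have e2 : ∀ y, pd n w y * lap w y = ∑ i, pd n w y * pd i (pd i w) y := fun y => by
      rw [lap, Finset.mul_sum]
    simp only [e2]
    rw [integral_sub (integrable_finsetSum _ fun i _ => hi3 i)
      (integrable_finsetSum _ fun j _ => hi2 j), integral_finsetSum _ fun i _ => hi3 i,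
      integral_finsetSum _ fun j _ => hi2 j]
    simp only [Finset.sum_sub_distrib, Finset.sum_ite_irrel, Finset.sum_const_zero,
      Finset.sum_ite_eq', Finset.mem_univ, if_true, Finset.sum_neg_distrib, ← Finset.mul_sum]
    ring
  have hm1 : Continuous (fun y => ‖hess w y‖ ^ 2) ∧ HasCompactSupport (fun y => ‖hess w y‖ ^ 2) :=
    ⟨(contDiff_hess hw).continuous.norm.pow 2,
      (hasCompactSupport_hess hwc).norm.comp_left (g := fun r : ℝ => r ^ 2) (by simp)⟩
  have hm2 : Continuous (fun y => lap w y ^ 2) ∧ HasCompactSupport (fun y => lap w y ^ 2) :=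
    ⟨(contDiff_lap hw).continuous.pow 2,
      (hasCompactSupport_lap hwc).comp_left (g := fun r : ℝ => r ^ 2) (by simp)⟩
  have hm3 : Integrable (fun y => ‖grad w y‖ ^ 2) (mu d σ) :=
    hint hσ ((contDiff_grad hw).continuous.norm.pow 2)
      ((hasCompactSupport_grad hwc).norm.comp_left (g := fun r : ℝ => r ^ 2) (by simp))
  have hlast : Continuous fun y : E d => y n ^ 2 := by fun_prop
  -- Writing `y_n ^ (1 + σ)` as `y_n * y_n ^ σ`, the factor `y_n` goes to the second derivatives.
  -- Young's inequality then leaves half of the Hessian integral, which is absorbed at the end; this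
  -- doubles the other terms into `3` and `2 * a ^ 2`.
  have hle : a * ∫ y, pd n w y * lap w y - ∑ j, pd j w y * pd n (pd j w) y ∂mu d (a - 1)
      ≤ 1 / 2 * (∫ y, ‖hess w y‖ ^ 2 ∂mu d a) + 1 / 2 * (∫ y, lap w y ^ 2 ∂mu d a)
        + a ^ 2 * ∫ y, ‖grad w y‖ ^ 2 ∂mu d σ := by
    have ea : a = ((2 : ℕ) : ℝ) + σ := by simp [ha]
    have ea1 : a - 1 = ((1 : ℕ) : ℝ) + σ := by rw [ha]; push_cast; ring
    have hj1 : Integrable (fun y => y n ^ 2 * ‖hess w y‖ ^ 2) (mu d σ) :=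
      hint hσ (hlast.mul hm1.1) hm1.2.mul_left
    have hj2 : Integrable (fun y => y n ^ 2 * lap w y ^ 2) (mu d σ) :=
      hint hσ (hlast.mul hm2.1) hm2.2.mul_left
    have hj12 : Integrable (fun y => 1 / 2 * (y n ^ 2 * ‖hess w y‖ ^ 2)
      + 1 / 2 * (y n ^ 2 * lap w y ^ 2)) (mu d σ) := (hj1.const_mul _).add (hj2.const_mul _)
    rw [ea1, integral_mu_natCast_add, show mu d a = mu d (((2 : ℕ) : ℝ) + σ) by rw [← ea],
      integral_mu_natCast_add, integral_mu_natCast_add, ← integral_const_mul, ← integral_const_mul,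
      ← integral_const_mul, ← integral_const_mul, ← integral_add (hj1.const_mul _)
      (hj2.const_mul _), ← integral_add hj12 (hm3.const_mul _)]
    refine integral_mono ((hint hσ ?_ ?_).const_mul a) (hj12.add (hm3.const_mul _)) fun y => ?_
    · have e1 := (h1 n).continuous
      have e2 := (contDiff_lap hw).continuous
      have e3 : ∀ j, Continuous fun y => pd j w y * pd n (pd j w) y := fun j =>
        (h1 j).continuous.mul (h2 n j).continuous
      fun_prop
    · refine HasCompactSupport.mul_left (HasCompactSupport.sub (hc1 n).mul_right ?_)
      refine hwc.mono' fun y hy => ?_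
      by_contra h
      refine hy (Finset.sum_eq_zero fun j _ => ?_)
      rw [image_eq_zero_of_notMem_tsupport fun h' => h (tsupport_pd_subset w j h'), zero_mul]
    · have e1 : ∑ j, pd j w y * pd n (pd j w) y = inner ℝ (grad w y) (grad (pd n w) y) := by
        rw [PiLp.inner_apply]
        refine Finset.sum_congr rfl fun j _ => ?_
        rw [pd_comm hw n j]
        simp [mul_comm]
      have e2 : ‖grad (pd n w) y‖ ^ 2 ≤ ‖hess w y‖ ^ 2 := by
        simp only [EuclideanSpace.norm_sq_eq, grad_apply, hess_apply, Fintype.sum_prod_type]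
        exact Finset.sum_le_sum fun j _ =>
          Finset.single_le_sum (f := fun i => ‖pd j (pd i w) y‖ ^ 2) (fun i _ => sq_nonneg _)
            (Finset.mem_univ n)
      have e3 : pd n w y ^ 2 ≤ ‖grad w y‖ ^ 2 := by
        rw [← sq_abs]
        exact pow_le_pow_left₀ (abs_nonneg _) (abs_apply_le_norm (grad w y) n) 2
      have e4 := norm_add_sq_real (a • grad w y) (y n • grad (pd n w) y)
      rw [inner_smul_left, inner_smul_right, norm_smul, norm_smul, mul_pow, mul_pow,
        Real.norm_eq_abs, Real.norm_eq_abs, sq_abs, sq_abs] at e4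
      simp only [conj_trivial] at e4
      simp only
      rw [e1, pow_one]
      nlinarith [sq_nonneg (y n * lap w y - a * pd n w y),
        sq_nonneg ‖a • grad w y + y n • grad (pd n w) y‖,
        mul_le_mul_of_nonneg_left e2 (sq_nonneg (y n)), mul_le_mul_of_nonneg_left e3 (sq_nonneg a)]
  rw [← hsum, integral_sub (hint (by linarith) hm1.1 hm1.2) (hint (by linarith) hm2.1 hm2.2)] at hle
  simp only [Real.norm_eq_abs, sq_abs]
  linarith

end HalfSpace

lemma tendsto_integral_mul_of_eLpNorm {α : Type*} [MeasurableSpace α] {μ : Measure α}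
    {F : ℕ → α → ℝ} {F' k : α → ℝ} (hF : ∀ n, MemLp (F n) 2 μ) (hF' : MemLp F' 2 μ)
    (hk : MemLp k 2 μ) (h : Tendsto (fun n => eLpNorm (F n - F') 2 μ) atTop (𝓝 0)) :
    Tendsto (fun n => ∫ x, F n x * k x ∂μ) atTop (𝓝 (∫ x, F' x * k x ∂μ)) := by
  rw [tendsto_iff_edist_tendsto_0]
  have h1 : Tendsto (fun n => eLpNorm (F n - F') 2 μ * eLpNorm k 2 μ) atTop (𝓝 0) := by
    simpa using ENNReal.Tendsto.mul_const h (Or.inr hk.2.ne)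
  refine tendsto_of_tendsto_of_tendsto_of_le_of_le tendsto_const_nhds h1 (fun _ => zero_le)
    fun n => ?_
  simp only
  have h2 : Integrable (fun x => F n x * k x) μ := (hF n).integrable_mul hk
  have h3 : Integrable (fun x => F' x * k x) μ := hF'.integrable_mul hk
  rw [edist_eq_enorm_sub, ← integral_sub h2 h3]
  calc _ ≤ ∫⁻ x, ‖F n x * k x - F' x * k x‖ₑ ∂μ := enorm_integral_le_lintegral_enorm _
    _ = eLpNorm ((F n - F') • k) 1 μ := by
        rw [eLpNorm_one_eq_lintegral_enorm]
        simp [sub_mul]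
    _ ≤ _ := eLpNorm_smul_le_mul_eLpNorm hk.1 ((hF n).sub hF').1

namespace HalfSpace

variable {d : ℕ}

/-! ### Testing against the weighted measures -/

lemma contDiffAt_rpow_last (τ : ℝ) {y : E d} (hy : y ∈ openHalf d) :
    ContDiffAt ℝ ∞ (fun y : E d => y (Fin.last d) ^ τ) y :=
  ContDiffAt.rpow_const_of_ne ((EuclideanSpace.proj (𝕜 := ℝ) (Fin.last d) :
    E d →L[ℝ] ℝ).contDiff.contDiffAt) (ne_of_gt hy)

/-- The weight is smooth on the support of `φ`. Powers of `y_n` of either sign can thus be moved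
into the test function, which converts weighted pairings into unweighted ones and back. -/
lemma IsTestOnHalf.rpow_mul {φ : E d → ℝ} (hφ : IsTestOnHalf φ) (τ : ℝ) :
    IsTestOnHalf fun y => y (Fin.last d) ^ τ * φ y := by
  have hs : tsupport (fun y => y (Fin.last d) ^ τ * φ y) ⊆ tsupport φ := tsupport_mul_subset_right
  refine ⟨contDiff_iff_contDiffAt.2 fun y => ?_, hφ.2.1.mul_left,
    hs.trans hφ.2.2⟩
  by_cases hy : y ∈ tsupport φ
  · exact (contDiffAt_rpow_last τ (hφ.2.2 hy)).mul hφ.1.contDiffAt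
  · refine (contDiffAt_const (c := (0 : ℝ))).congr_of_eventuallyEq ?_
    filter_upwards [(isClosed_tsupport φ).isOpen_compl.mem_nhds hy] with z hz
    rw [image_eq_zero_of_notMem_tsupport hz, mul_zero]

lemma IsTestOnHalf.memLp {φ : E d → ℝ} (hφ : IsTestOnHalf φ) {τ : ℝ} (hτ : -1 < τ) :
    MemLp φ 2 (mu d τ) := memLp_mu_of_hasCompactSupport hτ hφ.1.continuous hφ.2.1

lemma setIntegral_eq_integral_mu (τ : ℝ) (F φ : E d → ℝ) :
    ∫ y in openHalf d, F y * φ y = ∫ y, F y * (y (Fin.last d) ^ (-τ) * φ y) ∂mu d τ := by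
  rw [integral_mu]
  refine setIntegral_congr_fun isOpen_openHalf.measurableSet fun y hy => ?_
  have hy0 : 0 < y (Fin.last d) := hy
  have := Real.rpow_pos_of_pos hy0 τ
  simp only
  rw [Real.rpow_neg hy0.le]
  field_simp

lemma IsTestOnHalf.tendsto_setIntegral {φ : E d → ℝ} (hφ : IsTestOnHalf φ) {τ : ℝ} (hτ : -1 < τ)
    {F : ℕ → E d → ℝ} {F' : E d → ℝ} (hF : ∀ n, MemLp (F n) 2 (mu d τ)) (hF' : MemLp F' 2 (mu d τ))
    (h : Tendsto (fun n => eLpNorm (F n - F') 2 (mu d τ)) atTop (𝓝 0)) :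
    Tendsto (fun n => ∫ y in openHalf d, F n y * φ y) atTop
      (𝓝 (∫ y in openHalf d, F' y * φ y)) := by
  simp only [setIntegral_eq_integral_mu τ]
  exact tendsto_integral_mul_of_eLpNorm hF hF' ((hφ.rpow_mul (-τ)).memLp hτ) h

lemma integral_mul_pd {w φ : E d → ℝ} (hw : ContDiff ℝ ∞ w) (hφ : IsTestOnHalf φ)
    (i : Fin (d + 1)) :
    ∫ y in openHalf d, w y * pd i φ y = -∫ y in openHalf d, pd i w y * φ y := by
  rw [(hφ.pd i).setIntegral_eq, hφ.setIntegral_eq]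
  have hi : ∀ {F ψ : E d → ℝ}, Continuous F → IsTestOnHalf ψ → Integrable fun y => F y * ψ y :=
    fun hF hψ => (hF.mul hψ.1.continuous).integrable_of_hasCompactSupport hψ.2.1.mul_left
  exact integral_mul_fderiv_eq_neg_fderiv_mul_of_integrable
    (hi (contDiff_pd hw i).continuous hφ) (hi hw.continuous (hφ.pd i)) (hi hw.continuous hφ)
    (fun y _ => hw.differentiable (by simp) y) (fun y _ => hφ.1.differentiable (by simp) y)

lemma hasWeakGradient_grad {w : E d → ℝ} (hw : ContDiff ℝ ∞ w) : HasWeakGradient w (grad w) :=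
  ⟨hw.continuous.locallyIntegrable.locallyIntegrableOn _,
    (contDiff_grad hw).continuous.locallyIntegrable.locallyIntegrableOn _,
    fun _ hφ i => integral_mul_pd hw hφ i⟩

lemma integral_mul_pd_pd {w φ : E d → ℝ} (hw : ContDiff ℝ ∞ w) (hφ : IsTestOnHalf φ)
    (i j : Fin (d + 1)) :
    ∫ y in openHalf d, w y * pd i (pd j φ) y = ∫ y in openHalf d, hess w y (i, j) * φ y := by
  rw [pd_comm hφ.1, integral_mul_pd hw (hφ.pd i), integral_mul_pd (contDiff_pd hw j) hφ, neg_neg]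
  rfl

/-! ### The second order estimate -/

/-- The Laplacian of a solution of the elliptic equation. -/
noncomputable def ellipticLap (σ : ℝ) (G : E d → E d) (g : E d → ℝ) (y : E d) : ℝ :=
  -(g y + (1 + σ) * G y (Fin.last d)) / y (Fin.last d)

lemma stronglyMeasurable_ellipticLap {σ : ℝ} {G : E d → E d} {g : E d → ℝ}
    (hGm : StronglyMeasurable G) (hgm : StronglyMeasurable g) :
    StronglyMeasurable (ellipticLap σ G g) := by
  have h1 := hGm.measurable
  have h2 := hgm.measurable
  unfold ellipticLap
  exact Measurable.stronglyMeasurable (by fun_prop)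

/-- The division by `y_n` lowers the exponent `2 + σ` to `σ`; here the first order gain for `G` is
used. -/
lemma eLpNorm_ellipticLap_le {σ : ℝ} {G : E d → E d} {g : E d → ℝ}
    (hGm : StronglyMeasurable G) (hgm : StronglyMeasurable g) :
    eLpNorm (ellipticLap σ G g) 2 (mu d (2 + σ)) ^ 2
      ≤ ENNReal.ofReal 2 * eLpNorm g 2 (mu d σ) ^ 2
        + ENNReal.ofReal (2 * (1 + σ) ^ 2) * eLpNorm G 2 (mu d σ) ^ 2 := by
  rw [eLpNorm_two_sq, eLpNorm_two_sq, eLpNorm_two_sq,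
    lintegral_mu _ ((stronglyMeasurable_ellipticLap hGm hgm).enorm.pow_const 2),
    lintegral_mu _ (hgm.enorm.pow_const 2), lintegral_mu _ (hGm.enorm.pow_const 2)]
  have hm1 : Measurable fun y : E d => wt σ (y (Fin.last d)) * ‖g y‖ₑ ^ 2 :=
    ((measurable_wt σ).comp measurable_last).mul (hgm.enorm.pow_const 2)
  have hm2 : Measurable fun y : E d => wt σ (y (Fin.last d)) * ‖G y‖ₑ ^ 2 :=
    ((measurable_wt σ).comp measurable_last).mul (hGm.enorm.pow_const 2)
  rw [← lintegral_const_mul _ hm1, ← lintegral_const_mul _ hm2,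
    ← lintegral_add_left (hm1.const_mul _)]
  refine lintegral_mono fun y => ?_
  rcases le_or_gt (y (Fin.last d)) 0 with hy | hy
  · simp [wt_of_nonpos _ hy]
  have hr := Real.rpow_pos_of_pos hy σ
  simp only [enorm_sq_eq_ofReal, wt_of_pos _ hy]
  rw [← ENNReal.ofReal_mul (by positivity),
    ← ENNReal.ofReal_mul (by positivity), ← ENNReal.ofReal_mul (by positivity),
    ← ENNReal.ofReal_mul (by positivity), ← ENNReal.ofReal_mul (by positivity),
    ← ENNReal.ofReal_add (by positivity) (by positivity)]
  refine ENNReal.ofReal_le_ofReal ?_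
  have h1 : G y (Fin.last d) ^ 2 ≤ ‖G y‖ ^ 2 := by
    rw [← sq_abs]
    exact pow_le_pow_left₀ (abs_nonneg _) (abs_apply_le_norm (G y) _) 2
  have h2 : (g y + (1 + σ) * G y (Fin.last d)) ^ 2
      ≤ 2 * g y ^ 2 + 2 * (1 + σ) ^ 2 * ‖G y‖ ^ 2 := by
    nlinarith [sq_nonneg (g y - (1 + σ) * G y (Fin.last d)),
      mul_le_mul_of_nonneg_left h1 (sq_nonneg (1 + σ))]
  rw [rpow_two_add hy, Real.norm_eq_abs, Real.norm_eq_abs, sq_abs, sq_abs, ellipticLap, div_pow,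
    neg_sq]
  calc _ = y (Fin.last d) ^ σ * (g y + (1 + σ) * G y (Fin.last d)) ^ 2 := by field_simp
    _ ≤ y (Fin.last d) ^ σ * (2 * g y ^ 2 + 2 * (1 + σ) ^ 2 * ‖G y‖ ^ 2) := by gcongr
    _ = _ := by ring

lemma pd_rpow_mul {φ : E d → ℝ} (hφ : IsTestOnHalf φ) (τ : ℝ) (i : Fin (d + 1)) {y : E d}
    (hy : y ∈ openHalf d) :
    pd i (fun y => y (Fin.last d) ^ τ * φ y) y = y (Fin.last d) ^ τ * pd i φ y
      + if i = Fin.last d then τ * y (Fin.last d) ^ (τ - 1) * φ y else 0 := by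
  have h0 : HasDerivAt (fun r : ℝ => r ^ τ) (τ * y (Fin.last d) ^ (τ - 1))
      ((EuclideanSpace.proj (𝕜 := ℝ) (Fin.last d) : E d →L[ℝ] ℝ) y) :=
    Real.hasDerivAt_rpow_const (Or.inl (ne_of_gt hy))
  have h1 : HasFDerivAt (fun y : E d => y (Fin.last d) ^ τ)
      ((τ * y (Fin.last d) ^ (τ - 1)) • (EuclideanSpace.proj (Fin.last d) : E d →L[ℝ] ℝ)) y :=
    h0.comp_hasFDerivAt y
      (EuclideanSpace.proj (𝕜 := ℝ) (Fin.last d) : E d →L[ℝ] ℝ).hasFDerivAt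
  have h2 := h1.mul (hφ.1.differentiable (by simp) y).hasFDerivAt
  have h3 : fderiv ℝ (fun y => y (Fin.last d) ^ τ * φ y) y = _ := h2.fderiv
  rw [pd, h3]
  by_cases hi : i = Fin.last d
  · simp [hi, pd, mul_comm]
  · simp [hi, Ne.symm hi, pd]

/-- Test with `y_n ^ (-(1 + σ)) φ`. The power cancels the weight, and its derivative contributes the
term `-(1 + σ) G_n φ / y_n`. -/
lemma IsWeakElliptic.hasWeakLaplacian {σ : ℝ} (hσ : -1 < σ) {v g : E d → ℝ} {G : E d → E d}
    (hvG : HasWeakGradient v G) (hg : LocallyIntegrableOn g (openHalf d))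
    (hq : LocallyIntegrableOn (ellipticLap σ G g) (openHalf d)) (hell : IsWeakElliptic σ G g) :
    HasWeakLaplacian v (ellipticLap σ G g) := by
  refine ⟨hq, fun φ hφ => ?_⟩
  have hψ := hφ.rpow_mul (-(1 + σ))
  have h1 := hell _ _ (hψ.memLp hσ) (memLp_mu_of_hasCompactSupport (by linarith)
    (contDiff_grad hψ.1).continuous (hasCompactSupport_grad hψ.2.1)) (hasWeakGradient_grad hψ.1)
  have hGi : ∀ i, Integrable fun y => G y i * pd i φ y := fun i =>
    (hφ.pd i).integrable_mul (locallyIntegrableOn_apply hvG.2.1 i)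
  have hφ1 := hφ.rpow_mul (-1)
  have e1 : ∫ y, inner ℝ (G y) (grad (fun y => y (Fin.last d) ^ (-(1 + σ)) * φ y) y) ∂mu d (1 + σ)
      = ∫ y in openHalf d, (∑ i, G y i * pd i φ y)
        - (1 + σ) * (G y (Fin.last d) * (y (Fin.last d) ^ (-1 : ℝ) * φ y)) := by
    rw [integral_mu]
    refine setIntegral_congr_fun isOpen_openHalf.measurableSet fun y hy => ?_
    have hy0 : 0 < y (Fin.last d) := hy
    have hr := Real.rpow_pos_of_pos hy0 (1 + σ)
    simp only [PiLp.inner_apply, grad_apply, pd_rpow_mul hφ _ _ hy]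
    simp only [RCLike.inner_apply, conj_trivial, add_mul, Finset.sum_add_distrib, ite_mul, zero_mul,
      Finset.sum_ite_eq', Finset.mem_univ, if_true, mul_add, Finset.mul_sum, sub_eq_add_neg]
    congr 1
    · refine Finset.sum_congr rfl fun i _ => ?_
      rw [Real.rpow_neg hy0.le]
      field_simp
    · rw [← sub_eq_add_neg, Real.rpow_sub_one hy0.ne', Real.rpow_neg hy0.le, Real.rpow_neg_one]
      field_simp
  have e2 : ∫ y, g y * (y (Fin.last d) ^ (-(1 + σ)) * φ y) ∂mu d σ
      = ∫ y in openHalf d, g y * (y (Fin.last d) ^ (-1 : ℝ) * φ y) := by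
    rw [integral_mu]
    refine setIntegral_congr_fun isOpen_openHalf.measurableSet fun y hy => ?_
    have hy0 : 0 < y (Fin.last d) := hy
    have hr := Real.rpow_pos_of_pos hy0 σ
    simp only
    rw [neg_add, Real.rpow_add hy0, Real.rpow_neg hy0.le σ]
    field_simp
  have e3 : ∫ y in openHalf d, v y * lap φ y = -∫ y in openHalf d, ∑ i, G y i * pd i φ y := by
    simp only [lap, Finset.mul_sum]
    rw [integral_finsetSum _ fun i _ => (((hφ.pd i).pd i).integrable_mul hvG.1).integrableOn,
      integral_finsetSum _ fun i _ => (hGi i).integrableOn, ← Finset.sum_neg_distrib]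
    exact Finset.sum_congr rfl fun i _ => hvG.2.2 _ (hφ.pd i) i
  have hGn := hφ1.integrable_mul (locallyIntegrableOn_apply hvG.2.1 (Fin.last d))
  rw [e1, e2, integral_sub (integrable_finsetSum _ fun i _ => (hGi i).integrableOn)
    (hGn.integrableOn.const_mul _)] at h1
  rw [e3]
  have e4 : ∫ y in openHalf d, ellipticLap σ G g y * φ y
      = ∫ y in openHalf d, -(g y * (y (Fin.last d) ^ (-1 : ℝ) * φ y)
        + (1 + σ) * (G y (Fin.last d) * (y (Fin.last d) ^ (-1 : ℝ) * φ y))) := by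
    refine integral_congr_ae (ae_of_all _ fun y => ?_)
    simp only [ellipticLap, Real.rpow_neg_one]
    ring
  rw [e4, integral_neg, integral_add (hφ1.integrable_mul hg).integrableOn
    (hGn.integrableOn.const_mul _), ← h1]
  ring

end HalfSpace

/-! ### The weak Hessian and elliptic regularity -/

namespace HalfSpace

variable {d : ℕ}

lemma grad_sub {φ ψ : E d → ℝ} (hφ : ContDiff ℝ ∞ φ) (hψ : ContDiff ℝ ∞ ψ) :
    grad (φ - ψ) = grad φ - grad ψ := by
  ext y i
  exact congrFun (pd_sub hφ hψ i) y

lemma lap_sub {φ ψ : E d → ℝ} (hφ : ContDiff ℝ ∞ φ) (hψ : ContDiff ℝ ∞ ψ) :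
    lap (φ - ψ) = lap φ - lap ψ := by
  ext y
  rw [Pi.sub_apply, lap, lap, lap, ← Finset.sum_sub_distrib]
  refine Finset.sum_congr rfl fun i _ => ?_
  have h1 : pd i (φ - ψ) = fun y => pd i φ y - pd i ψ y := pd_sub hφ hψ i
  rw [h1, pd_sub (contDiff_pd hφ i) (contDiff_pd hψ i)]

lemma hess_sub {φ ψ : E d → ℝ} (hφ : ContDiff ℝ ∞ φ) (hψ : ContDiff ℝ ∞ ψ) :
    hess (φ - ψ) = hess φ - hess ψ := by
  ext y p
  have h1 : pd p.2 (φ - ψ) = fun y => pd p.2 φ y - pd p.2 ψ y := pd_sub hφ hψ p.2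
  rw [hess_apply, h1, pd_sub (contDiff_pd hφ _) (contDiff_pd hψ _)]
  rfl

lemma eLpNorm_hess_le {σ : ℝ} (hσ : -1 < σ) {w : E d → ℝ} (hw : ContDiff ℝ ∞ w)
    (hwc : HasCompactSupport w) :
    eLpNorm (hess w) 2 (mu d (2 + σ)) ^ 2
      ≤ ENNReal.ofReal 3 * eLpNorm (lap w) 2 (mu d (2 + σ)) ^ 2
        + ENNReal.ofReal (2 * (2 + σ) ^ 2) * eLpNorm (grad w) 2 (mu d σ) ^ 2 := by
  have h1 := memLp_mu_of_hasCompactSupport (τ := 2 + σ) (by linarith) (contDiff_hess hw).continuous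
    (hasCompactSupport_hess hwc)
  have h2 := memLp_mu_of_hasCompactSupport (τ := 2 + σ) (by linarith) (contDiff_lap hw).continuous
    (hasCompactSupport_lap hwc)
  have h3 := memLp_mu_of_hasCompactSupport hσ (contDiff_grad hw).continuous
    (hasCompactSupport_grad hwc)
  rw [eLpNorm_two_sq, eLpNorm_two_sq, eLpNorm_two_sq, h1.lintegral_enorm_sq_eq,
    h2.lintegral_enorm_sq_eq, h3.lintegral_enorm_sq_eq, ← ENNReal.ofReal_mul (by norm_num),
    ← ENNReal.ofReal_mul (by positivity), ← ENNReal.ofReal_add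
      (mul_nonneg (by norm_num) (integral_nonneg fun y => sq_nonneg _))
      (mul_nonneg (by positivity) (integral_nonneg fun y => sq_nonneg _))]
  exact ENNReal.ofReal_le_ofReal (integral_hess_le hσ hw hwc)

/-- Functions in the weighted Sobolev space with Laplacian in the appropriate space have a weak
Hessian. -/
lemma exists_hessian {σ : ℝ} (hσ : -1 < σ) {v q : E d → ℝ} {G : E d → E d}
    (hvm : StronglyMeasurable v) (hGm : StronglyMeasurable G) (hqm : StronglyMeasurable q)
    (hv : MemLp v 2 (mu d σ)) (hG : MemLp G 2 (mu d σ)) (hq : MemLp q 2 (mu d (2 + σ)))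
    (hvG : HasWeakGradient v G) (hvq : HasWeakLaplacian v q) :
    ∃ D : E d → EuclideanSpace ℝ (Fin (d + 1) × Fin (d + 1)), StronglyMeasurable D ∧
      MemLp D 2 (mu d (2 + σ)) ∧ HasWeakHessian v D ∧
      eLpNorm D 2 (mu d (2 + σ)) ^ 2 ≤ ENNReal.ofReal 3 * eLpNorm q 2 (mu d (2 + σ)) ^ 2
        + ENNReal.ofReal (2 * (2 + σ) ^ 2) * eLpNorm G 2 (mu d σ) ^ 2 := by
  obtain ⟨w, hw, hwc, hwv, hwG, hwq⟩ := exists_smooth_approx hσ hvm hGm hv hvG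
  have hwG := hwG σ ⟨le_rfl, by linarith⟩ hG
  have hwq := hwq q hqm hvq hq hG
  have hσ2 : -1 < 2 + σ := by linarith
  have hmw : ∀ k, MemLp (w k) 2 (mu d σ) := fun k =>
    memLp_mu_of_hasCompactSupport hσ (hw k).continuous (hwc k)
  have hmg : ∀ k, MemLp (grad (w k)) 2 (mu d σ) := fun k =>
    memLp_mu_of_hasCompactSupport hσ (contDiff_grad (hw k)).continuous
      (hasCompactSupport_grad (hwc k))
  have hml : ∀ k, MemLp (lap (w k)) 2 (mu d (2 + σ)) := fun k =>
    memLp_mu_of_hasCompactSupport hσ2 (contDiff_lap (hw k)).continuous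
      (hasCompactSupport_lap (hwc k))
  have hmh : ∀ k, MemLp (hess (w k)) 2 (mu d (2 + σ)) := fun k =>
    memLp_mu_of_hasCompactSupport hσ2 (contDiff_hess (hw k)).continuous
      (hasCompactSupport_hess (hwc k))
  -- The Hessian bound for `w n - w m` transfers the Cauchy property from gradients and Laplacians
  -- to Hessians.
  have hcauchy : ∀ δ : ℝ≥0∞, 0 < δ → ∃ N, ∀ n ≥ N, ∀ m ≥ N,
      eLpNorm (hess (w n) - hess (w m)) 2 (mu d (2 + σ)) ≤ δ := by
    intro δ hδ
    set M : ℝ≥0∞ := ENNReal.ofReal 3 + ENNReal.ofReal (2 * (2 + σ) ^ 2) with hM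
    have hM0 : M ≠ 0 := by simp [hM]
    have hMt : M ≠ ⊤ := ENNReal.add_ne_top.2 ⟨ENNReal.ofReal_ne_top, ENNReal.ofReal_ne_top⟩
    -- Chosen so that `η ^ 2 ≤ η ≤ δ ^ 2 / M`, which avoids a square root.
    set η : ℝ≥0∞ := min 1 (δ ^ 2 / M) with hη
    have hη0 : 0 < η := lt_min one_pos (ENNReal.div_pos (ENNReal.pow_pos hδ 2).ne' hMt)
    obtain ⟨N₁, hN₁⟩ := cauchy_of_tendsto_eLpNorm (fun k => (hmg k).1) hG.1 hwG η hη0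
    obtain ⟨N₂, hN₂⟩ := cauchy_of_tendsto_eLpNorm (fun k => (hml k).1) hq.1 hwq η hη0
    refine ⟨max N₁ N₂, fun n hn m hm => ?_⟩
    have h1 := hN₁ n (le_of_max_le_left hn) m (le_of_max_le_left hm)
    have h2 := hN₂ n (le_of_max_le_right hn) m (le_of_max_le_right hm)
    have h3 := eLpNorm_hess_le hσ ((hw n).sub (hw m)) ((hwc n).sub (hwc m))
    rw [show (fun y => w n y - w m y) = w n - w m from rfl, grad_sub (hw n) (hw m),
      lap_sub (hw n) (hw m), hess_sub (hw n) (hw m)] at h3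
    rw [← ENNReal.pow_le_pow_left_iff two_ne_zero]
    have h4 : η ^ 2 ≤ η := by
      rw [sq]
      exact mul_le_of_le_one_right' (min_le_left _ _)
    calc _ ≤ _ := h3
      _ ≤ ENNReal.ofReal 3 * η ^ 2 + ENNReal.ofReal (2 * (2 + σ) ^ 2) * η ^ 2 := by gcongr
      _ = M * η ^ 2 := by rw [hM, add_mul]
      _ ≤ M * (δ ^ 2 / M) := by
          gcongr
          exact h4.trans (min_le_right _ _)
      _ = δ ^ 2 := ENNReal.mul_div_cancel hM0 hMt
  obtain ⟨D, hDm, hD, hwD⟩ := exists_memLp_two_limit hmh hcauchy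
  refine ⟨D, hDm, hD, ⟨hvG.1, locallyIntegrableOn_of_memLp_mu hD, fun φ hφ i j => ?_⟩, ?_⟩
  · have h1 := ((hφ.pd j).pd i).tendsto_setIntegral hσ hmw hv hwv
    have hcomp : ∀ {F : E d → EuclideanSpace ℝ (Fin (d + 1) × Fin (d + 1))},
        MemLp F 2 (mu d (2 + σ)) → MemLp (fun y => F y (i, j)) 2 (mu d (2 + σ)) := fun hF =>
      (EuclideanSpace.proj (𝕜 := ℝ) (i, j) :
        EuclideanSpace ℝ (Fin (d + 1) × Fin (d + 1)) →L[ℝ] ℝ).comp_memLp' hF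
    have h2 := hφ.tendsto_setIntegral hσ2 (F := fun k y => hess (w k) y (i, j))
      (fun k => hcomp (hmh k)) (hcomp hD) (by
        refine tendsto_of_tendsto_of_tendsto_of_le_of_le tendsto_const_nhds hwD
          (fun _ => zero_le) fun k => eLpNorm_mono fun y => ?_
        exact PiLp.norm_apply_le ((hess (w k) - D) y) (i, j))
    refine tendsto_nhds_unique h1 (h2.congr fun k => ?_)
    exact (integral_mul_pd_pd (hw k) hφ i j).symm
  · have t1 := ENNReal.Tendsto.pow (n := 2)
      (tendsto_eLpNorm_of_tendsto (fun k => (hmh k).1) hD hwD)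
    have t2 := ENNReal.Tendsto.pow (n := 2)
      (tendsto_eLpNorm_of_tendsto (fun k => (hml k).1) hq hwq)
    have t3 := ENNReal.Tendsto.pow (n := 2)
      (tendsto_eLpNorm_of_tendsto (fun k => (hmg k).1) hG hwG)
    refine le_of_tendsto_of_tendsto' t1 ((ENNReal.Tendsto.const_mul t2
      (Or.inr ENNReal.ofReal_ne_top)).add (ENNReal.Tendsto.const_mul t3
      (Or.inr ENNReal.ofReal_ne_top))) fun k => eLpNorm_hess_le hσ (hw k) (hwc k)

/-- Regularity for the elliptic equation. -/
theorem IsWeakElliptic.regularity {σ : ℝ} (hσ : -1 < σ) : ∃ C : ℝ, 0 ≤ C ∧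
    ∀ (d : ℕ) (v g : E d → ℝ) (G : E d → E d), StronglyMeasurable v → StronglyMeasurable G →
      StronglyMeasurable g → MemLp v 2 (mu d σ) → MemLp G 2 (mu d (1 + σ)) → MemLp g 2 (mu d σ) →
      HasWeakGradient v G → IsWeakElliptic σ G g →
      MemLp G 2 (mu d σ) ∧
      eLpNorm G 2 (mu d σ) ^ 2 ≤ ENNReal.ofReal C * eLpNorm g 2 (mu d σ) ^ 2 ∧
      ∃ D : E d → EuclideanSpace ℝ (Fin (d + 1) × Fin (d + 1)),
        MemLp D 2 (mu d (2 + σ)) ∧ HasWeakHessian v D ∧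
        eLpNorm D 2 (mu d (2 + σ)) ^ 2 ≤ ENNReal.ofReal C * eLpNorm g 2 (mu d σ) ^ 2 := by
  set C₁ : ℝ := 4 / ((1 / 2) ^ |σ| * (1 + σ) ^ 2) with hC₁
  have hC₁0 : 0 ≤ C₁ := by positivity
  -- The Hessian bound with the Laplacian estimated through `g` and `G`, and `G` through the
  -- constant of the first order estimate. Neither constant depends on the dimension.
  set C₂ : ℝ := 3 * (2 + 2 * (1 + σ) ^ 2 * C₁) + 2 * (2 + σ) ^ 2 * C₁ with hC₂
  have hC₂0 : 0 ≤ C₂ := by positivity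
  refine ⟨max C₁ C₂, le_max_of_le_left hC₁0, fun d v g G hvm hGm hgm hv hG hg hvG hell => ?_⟩
  have h1 := hell.lintegral_grad_le hσ hvm hGm hv hG hvG hg
  rw [← eLpNorm_two_sq, ← eLpNorm_two_sq] at h1
  have hgt : eLpNorm g 2 (mu d σ) ^ 2 < ⊤ := ENNReal.pow_lt_top hg.2
  have hGσ : MemLp G 2 (mu d σ) := by
    refine memLp_two_of_lintegral_lt_top hGm.aestronglyMeasurable ?_
    rw [← eLpNorm_two_sq]
    exact h1.trans_lt (ENNReal.mul_lt_top ENNReal.ofReal_lt_top hgt)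
  have hqle := eLpNorm_ellipticLap_le (σ := σ) hGm hgm
  have hq1 : eLpNorm (ellipticLap σ G g) 2 (mu d (2 + σ)) ^ 2
      ≤ ENNReal.ofReal (2 + 2 * (1 + σ) ^ 2 * C₁) * eLpNorm g 2 (mu d σ) ^ 2 := by
    refine hqle.trans ?_
    rw [ENNReal.ofReal_add (by norm_num) (by positivity), add_mul,
      ENNReal.ofReal_mul (p := 2 * (1 + σ) ^ 2) (by positivity), mul_assoc]
    gcongr
  have hqm := stronglyMeasurable_ellipticLap (σ := σ) hGm hgm
  have hq : MemLp (ellipticLap σ G g) 2 (mu d (2 + σ)) := by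
    refine memLp_two_of_lintegral_lt_top hqm.aestronglyMeasurable ?_
    rw [← eLpNorm_two_sq]
    exact hq1.trans_lt (ENNReal.mul_lt_top ENNReal.ofReal_lt_top hgt)
  have hlap := hell.hasWeakLaplacian hσ hvG (locallyIntegrableOn_of_memLp_mu hg)
    (locallyIntegrableOn_of_memLp_mu hq)
  obtain ⟨D, -, hD, hvD, hDle⟩ := exists_hessian hσ hvm hGm hqm hv hGσ hq hvG hlap
  refine ⟨hGσ, h1.trans (by gcongr; exact le_max_left _ _), D, hD, hvD, hDle.trans ?_⟩
  calc _ ≤ ENNReal.ofReal 3 * (ENNReal.ofReal (2 + 2 * (1 + σ) ^ 2 * C₁)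
          * eLpNorm g 2 (mu d σ) ^ 2) + ENNReal.ofReal (2 * (2 + σ) ^ 2)
          * (ENNReal.ofReal C₁ * eLpNorm g 2 (mu d σ) ^ 2) := by gcongr
    _ = ENNReal.ofReal C₂ * eLpNorm g 2 (mu d σ) ^ 2 := by
        rw [hC₂, ENNReal.ofReal_add (p := 3 * (2 + 2 * (1 + σ) ^ 2 * C₁)) (by positivity)
          (by positivity), ENNReal.ofReal_mul (p := 3) (by norm_num),
          ENNReal.ofReal_mul (p := 2 * (2 + σ) ^ 2) (by positivity)]
        ring
    _ ≤ _ := by gcongr; exact le_max_right _ _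

end HalfSpace

/-- A measurable selection from a linear, single valued and bounded relation. -/
lemma exists_aestronglyMeasurable_of_relation {P Z : Type*} [NormedAddCommGroup P]
    [NormedSpace ℝ P] [NormedAddCommGroup Z] [NormedSpace ℝ Z] {T : Submodule ℝ P}
    {R : P → Z → Prop} (hadd : ∀ p q z w, R p z → R q w → R (p + q) (z + w))
    (hsmul : ∀ (c : ℝ) p z, R p z → R (c • p) (c • z)) (huniq : ∀ p z w, R p z → R p w → z = w)
    {C : ℝ} (hex : ∀ p ∈ T, ∃ z, R p z ∧ ‖z‖ ≤ C * ‖p‖) {α : Type*} [MeasurableSpace α]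
    {μ : Measure α} {t : α → P} (ht : AEStronglyMeasurable t μ) (htT : ∀ᵐ s ∂μ, t s ∈ T) :
    ∃ z : α → Z, AEStronglyMeasurable z μ ∧ ∀ᵐ s ∂μ, R (t s) (z s) := by
  classical
  choose! L hL hLC using hex
  -- Uniqueness makes any choice of values linear on `T`, and the bound makes it continuous;
  -- measurability then follows by composition.
  let l : T →ₗ[ℝ] Z :=
    { toFun := fun p => L p
      map_add' := fun p q => huniq _ _ _ (hL _ (p + q).2) (hadd _ _ _ _ (hL _ p.2) (hL _ q.2))
      map_smul' := fun c p => huniq _ _ _ (hL _ (c • p).2) (hsmul c _ _ (hL _ p.2)) }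
  have hl : Continuous l := (l.mkContinuous C fun p => hLC p p.2).continuous
  let t' : α → T := fun s => if h : t s ∈ T then ⟨t s, h⟩ else 0
  have h1 : AEStronglyMeasurable (fun s => (t' s : P)) μ := by
    refine ht.congr ?_
    filter_upwards [htT] with s hs
    simp [t', hs]
  have h2 : AEStronglyMeasurable t' μ :=
    IsEmbedding.subtypeVal.aestronglyMeasurable_comp_iff.1 h1
  refine ⟨fun s => l (t' s), hl.comp_aestronglyMeasurable h2, ?_⟩
  filter_upwards [htT] with s hs
  have h3 : (t' s : P) = t s := by simp [t', hs]
  have h4 : l (t' s) = L (t s) := by rw [← h3]; rfl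
  rw [h4]
  exact hL _ hs

/-! ### The graphs of the gradient and of the elliptic equation, and regularity of families -/

namespace HalfSpace

variable {d : ℕ} {σ τ : ℝ}

lemma HasWeakHessian.add {v v' : E d → ℝ}
    {D D' : E d → EuclideanSpace ℝ (Fin (d + 1) × Fin (d + 1))} (h : HasWeakHessian v D)
    (h' : HasWeakHessian v' D') : HasWeakHessian (v + v') (D + D') := by
  refine ⟨h.1.add h'.1, h.2.1.add h'.2.1, fun φ hφ i j => ?_⟩
  simp only [Pi.add_apply, PiLp.add_apply, add_mul]
  rw [integral_add (((hφ.pd j).pd i).integrable_mul h.1).integrableOn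
      (((hφ.pd j).pd i).integrable_mul h'.1).integrableOn,
    integral_add (hφ.integrable_mul (locallyIntegrableOn_apply h.2.1 _)).integrableOn
      (hφ.integrable_mul (locallyIntegrableOn_apply h'.2.1 _)).integrableOn,
    h.2.2 φ hφ i j, h'.2.2 φ hφ i j]

lemma HasWeakHessian.const_smul {v : E d → ℝ}
    {D : E d → EuclideanSpace ℝ (Fin (d + 1) × Fin (d + 1))} (h : HasWeakHessian v D) (c : ℝ) :
    HasWeakHessian (c • v) (c • D) := by
  refine ⟨h.1.smul c, h.2.1.smul c, fun φ hφ i j => ?_⟩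
  simp only [Pi.smul_apply, PiLp.smul_apply, smul_eq_mul, mul_assoc]
  rw [integral_const_mul, integral_const_mul, h.2.2 φ hφ i j]

lemma HasWeakHessian.congr {v v' : E d → ℝ}
    {D D' : E d → EuclideanSpace ℝ (Fin (d + 1) × Fin (d + 1))} (h : HasWeakHessian v D)
    (hv : v =ᵐ[volume.restrict (openHalf d)] v') (hD : D =ᵐ[volume.restrict (openHalf d)] D') :
    HasWeakHessian v' D' := by
  refine ⟨h.1.congr hv, h.2.1.congr hD, fun φ hφ i j => ?_⟩
  rw [← integral_congr_ae (hv.mono fun y hy => by simp only [hy] :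
      (fun y => v y * HalfSpace.pd i (HalfSpace.pd j φ) y)
        =ᵐ[_] fun y => v' y * HalfSpace.pd i (HalfSpace.pd j φ) y),
    ← integral_congr_ae (hD.mono fun y hy => by simp only [hy] :
      (fun y => D y (i, j) * φ y) =ᵐ[_] fun y => D' y (i, j) * φ y)]
  exact h.2.2 φ hφ i j

lemma HasWeakHessian.ae_eq {v : E d → ℝ}
    {D D' : E d → EuclideanSpace ℝ (Fin (d + 1) × Fin (d + 1))} (h : HasWeakHessian v D)
    (h' : HasWeakHessian v D') : D =ᵐ[volume.restrict (openHalf d)] D' := by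
  have h1 : ∀ p : Fin (d + 1) × Fin (d + 1),
      ∀ᵐ y, y ∈ openHalf d → D y p - D' y p = 0 := by
    rintro ⟨i, j⟩
    have hD := locallyIntegrableOn_apply h.2.1 (i, j)
    have hD' := locallyIntegrableOn_apply h'.2.1 (i, j)
    refine isOpen_openHalf.ae_eq_zero_of_integral_contDiff_smul_eq_zero (hD.sub hD')
      fun φ hφ hφc hφH => ?_
    have ht : IsTestOnHalf φ := ⟨hφ, hφc, hφH⟩
    have e := (h.2.2 φ ht i j).symm.trans (h'.2.2 φ ht i j)
    rw [ht.setIntegral_eq, ht.setIntegral_eq] at e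
    have e2 := integral_sub (ht.integrable_mul hD) (ht.integrable_mul hD')
    rw [e, sub_self] at e2
    rw [← e2]
    refine integral_congr_ae (ae_of_all _ fun y => ?_)
    simp only [smul_eq_mul]
    ring
  rw [Filter.EventuallyEq, ae_restrict_iff' isOpen_openHalf.measurableSet]
  filter_upwards [ae_all_iff.2 h1] with y hy hyH
  exact PiLp.ext fun p => sub_eq_zero.1 (hy p hyH)

lemma tendsto_Lp_iff {B : Type*} [NormedAddCommGroup B] {F : ℕ → Lp B 2 (mu d τ)}
    {F' : Lp B 2 (mu d τ)} : Tendsto F atTop (𝓝 F') ↔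
      Tendsto (fun n => eLpNorm (⇑(F n) - ⇑F') 2 (mu d τ)) atTop (𝓝 0) :=
  Lp.tendsto_Lp_iff_tendsto_eLpNorm' F F'

/-- The graph of the gradient. -/
def gradGraph (d : ℕ) (σ : ℝ) : Submodule ℝ (L2 d σ × L2Vec d (1 + σ)) where
  carrier := {p | HasWeakGradient p.1 p.2}
  add_mem' := fun {p q} hp hq => (HasWeakGradient.add hp hq).congr
    (absolutelyContinuous_mu σ (Lp.coeFn_add p.1 q.1).symm)
    (absolutelyContinuous_mu (1 + σ) (Lp.coeFn_add p.2 q.2).symm)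
  zero_mem' := by
    have h : HasWeakGradient (0 : E d → ℝ) (0 : E d → E d) :=
      ⟨locallyIntegrableOn_zero, locallyIntegrableOn_zero, fun φ _ i => by simp⟩
    exact h.congr (absolutelyContinuous_mu σ (Lp.coeFn_zero _ _ _).symm)
      (absolutelyContinuous_mu (1 + σ) (Lp.coeFn_zero _ _ _).symm)
  smul_mem' := fun c p hp => (HasWeakGradient.const_smul hp c).congr
    (absolutelyContinuous_mu σ (Lp.coeFn_smul c p.1).symm)
    (absolutelyContinuous_mu (1 + σ) (Lp.coeFn_smul c p.2).symm)

lemma tendsto_eLpNorm_apply {ι : Type*} [Fintype ι] {F : ℕ → E d → EuclideanSpace ℝ ι}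
    {F' : E d → EuclideanSpace ℝ ι}
    (h : Tendsto (fun n => eLpNorm (F n - F') 2 (mu d τ)) atTop (𝓝 0)) (i : ι) :
    Tendsto (fun n => eLpNorm ((fun y => F n y i) - fun y => F' y i) 2 (mu d τ)) atTop (𝓝 0) :=
  tendsto_of_tendsto_of_tendsto_of_le_of_le tendsto_const_nhds h (fun _ => zero_le)
    fun k => eLpNorm_mono fun y => PiLp.norm_apply_le ((F k - F') y) i

lemma memLp_apply {ι : Type*} [Fintype ι] {F : E d → EuclideanSpace ℝ ι}
    (hF : MemLp F 2 (mu d τ)) (i : ι) : MemLp (fun y => F y i) 2 (mu d τ) :=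
  (EuclideanSpace.proj (𝕜 := ℝ) i : EuclideanSpace ℝ ι →L[ℝ] ℝ).comp_memLp' hF

/-- For a fixed test function both sides of the defining identity are continuous on the weighted
spaces. -/
lemma isClosed_gradGraph (hσ : -1 < σ) :
    IsClosed (gradGraph d σ : Set (L2 d σ × L2Vec d (1 + σ))) := by
  refine IsSeqClosed.isClosed fun p q hp hpq => ?_
  have h1 := tendsto_Lp_iff.1 ((continuous_fst.tendsto q).comp hpq)
  have h2 := tendsto_Lp_iff.1 ((continuous_snd.tendsto q).comp hpq)
  refine ⟨locallyIntegrableOn_of_memLp_mu (Lp.memLp q.1),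
    locallyIntegrableOn_of_memLp_mu (Lp.memLp q.2), fun φ hφ i => ?_⟩
  have e1 := (hφ.pd i).tendsto_setIntegral hσ (fun n => Lp.memLp (p n).1) (Lp.memLp q.1) h1
  have e2 := hφ.tendsto_setIntegral (τ := 1 + σ) (by linarith)
    (F := fun n y => (p n).2 y i) (fun n => memLp_apply (Lp.memLp (p n).2) i)
    (memLp_apply (Lp.memLp q.2) i) (tendsto_eLpNorm_apply h2 i)
  exact tendsto_nhds_unique e1 (e2.neg.congr fun n => ((hp n).2.2 φ hφ i).symm)

/-- The elements of the graph that come from `C_c^∞(ℝⁿ)`. -/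
def smoothGraph (d : ℕ) (σ : ℝ) : Set (L2 d σ × L2Vec d (1 + σ)) :=
  {p | ∃ ζ : E d → ℝ, ContDiff ℝ ∞ ζ ∧ HasCompactSupport ζ ∧
    p.1 =ᵐ[mu d σ] ζ ∧ p.2 =ᵐ[mu d (1 + σ)] grad ζ}

/-- The equation is assumed only for smooth test functions, which need not vanish at the boundary;
density makes every element of the graph admissible. -/
lemma gradGraph_subset_closure (hσ : -1 < σ) :
    (gradGraph d σ : Set (L2 d σ × L2Vec d (1 + σ))) ⊆ closure (smoothGraph d σ) := by
  intro p hp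
  obtain ⟨w, hw, hwc, hwv, hwG, -⟩ := exists_smooth_approx hσ (Lp.stronglyMeasurable p.1)
    (Lp.stronglyMeasurable p.2) (Lp.memLp p.1) hp
  have hwG := hwG (1 + σ) ⟨by linarith, le_rfl⟩ (Lp.memLp p.2)
  have h1 : ∀ k, MemLp (w k) 2 (mu d σ) := fun k =>
    memLp_mu_of_hasCompactSupport hσ (hw k).continuous (hwc k)
  have h2 : ∀ k, MemLp (grad (w k)) 2 (mu d (1 + σ)) := fun k =>
    memLp_mu_of_hasCompactSupport (by linarith) (contDiff_grad (hw k)).continuous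
      (hasCompactSupport_grad (hwc k))
  have hlim : Tendsto (fun k => ((h1 k).toLp (w k), (h2 k).toLp (grad (w k)))) atTop (𝓝 p) := by
    refine Tendsto.prodMk_nhds (x := p.1) (y := p.2) ?_ ?_
    · exact tendsto_Lp_iff.2 (hwv.congr fun k => eLpNorm_congr_ae
        ((h1 k).coeFn_toLp.symm.sub EventuallyEq.rfl))
    · exact tendsto_Lp_iff.2 (hwG.congr fun k => eLpNorm_congr_ae
        ((h2 k).coeFn_toLp.symm.sub EventuallyEq.rfl))
  exact mem_closure_of_tendsto hlim (Eventually.of_forall fun k =>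
    ⟨w k, hw k, hwc k, (h1 k).coeFn_toLp, (h2 k).coeFn_toLp⟩)

/-- The weak elliptic equation between elements of the weighted spaces. -/
def ellipticGraph (d : ℕ) (σ : ℝ) : Submodule ℝ ((L2 d σ × L2Vec d (1 + σ)) × L2 d σ) where
  carrier := {t | t.1 ∈ gradGraph d σ ∧ ∀ p ∈ gradGraph d σ,
    inner ℝ t.1.2 p.2 = inner ℝ t.2 p.1}
  add_mem' := fun {s t} hs ht => ⟨add_mem hs.1 ht.1, fun p hp => by
    simp only [Prod.fst_add, Prod.snd_add, inner_add_left, hs.2 p hp, ht.2 p hp]⟩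
  zero_mem' := ⟨zero_mem _, fun p _ => by simp⟩
  smul_mem' := fun c t ht => ⟨Submodule.smul_mem _ c ht.1, fun p hp => by
    simp only [Prod.smul_fst, Prod.smul_snd, inner_smul_left, ht.2 p hp]⟩

lemma isWeakElliptic_of_mem {t : (L2 d σ × L2Vec d (1 + σ)) × L2 d σ}
    (ht : t ∈ ellipticGraph d σ) : IsWeakElliptic σ t.1.2 t.2 := by
  intro ζ Z hζ hZ h
  have h1 := ht.2 (hζ.toLp ζ, hZ.toLp Z) (h.congr
    (absolutelyContinuous_mu σ hζ.coeFn_toLp.symm)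
    (absolutelyContinuous_mu (1 + σ) hZ.coeFn_toLp.symm))
  rw [L2.inner_def, L2.inner_def] at h1
  refine (integral_congr_ae ?_).trans (h1.trans (integral_congr_ae ?_))
  · filter_upwards [hZ.coeFn_toLp] with y hy
    simp only [hy]
  · filter_upwards [hζ.coeFn_toLp] with y hy
    simp only [hy, RCLike.inner_apply, conj_trivial, mul_comm]

lemma norm_le_sqrt_mul {α B B' : Type*} [MeasurableSpace α] {μ ν : Measure α}
    [NormedAddCommGroup B] [NormedAddCommGroup B'] {F : Lp B 2 μ} {F' : Lp B' 2 ν} {C : ℝ}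
    (hC : 0 ≤ C) (h : eLpNorm F 2 μ ^ 2 ≤ ENNReal.ofReal C * eLpNorm F' 2 ν ^ 2) :
    ‖F‖ ≤ Real.sqrt C * ‖F'‖ := by
  have h1 := ENNReal.toReal_mono (ENNReal.mul_ne_top ENNReal.ofReal_ne_top
    (ENNReal.pow_ne_top (Lp.eLpNorm_ne_top F'))) h
  rw [ENNReal.toReal_mul, ENNReal.toReal_pow, ENNReal.toReal_pow, ENNReal.toReal_ofReal hC,
    ← Lp.norm_def, ← Lp.norm_def] at h1
  refine le_of_sq_le_sq ?_ (by positivity)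
  rwa [mul_pow, Real.sq_sqrt hC]

/-- Regularity for the elliptic equation, for elements of the weighted spaces. -/
theorem exists_elliptic_regularity (hσ : -1 < σ) : ∃ C : ℝ, 0 ≤ C ∧ ∀ (d : ℕ),
    ∀ t ∈ ellipticGraph d σ,
      (∃ G : L2Vec d σ, G =ᵐ[volume.restrict (openHalf d)] t.1.2 ∧ ‖G‖ ≤ C * ‖t.2‖) ∧
      ∃ D : L2Mat d (2 + σ), HasWeakHessian t.1.1 D ∧ ‖D‖ ≤ C * ‖t.2‖ := by
  obtain ⟨C, hC, hreg⟩ := IsWeakElliptic.regularity hσ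
  refine ⟨Real.sqrt C, Real.sqrt_nonneg C, fun d t ht => ?_⟩
  obtain ⟨hG, hGle, D, hD, hvD, hDle⟩ := hreg d t.1.1 t.2 t.1.2 (Lp.stronglyMeasurable _)
    (Lp.stronglyMeasurable _) (Lp.stronglyMeasurable _) (Lp.memLp _) (Lp.memLp _) (Lp.memLp _)
    ht.1 (isWeakElliptic_of_mem ht)
  refine ⟨⟨hG.toLp _, absolutelyContinuous_mu σ hG.coeFn_toLp, norm_le_sqrt_mul hC ?_⟩,
    hD.toLp _, hvD.congr EventuallyEq.rfl (absolutelyContinuous_mu _ hD.coeFn_toLp.symm),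
    norm_le_sqrt_mul hC ?_⟩
  · rwa [eLpNorm_congr_ae hG.coeFn_toLp]
  · rwa [eLpNorm_congr_ae hD.coeFn_toLp]

/-- Regularity for families of elliptic equations. -/
theorem exists_elliptic_regularity_family (hσ : -1 < σ) : ∃ C : ℝ, 0 ≤ C ∧ ∀ (d : ℕ)
    (μ : Measure ℝ) (t : ℝ → (L2 d σ × L2Vec d (1 + σ)) × L2 d σ), AEStronglyMeasurable t μ →
    (∀ᵐ s ∂μ, t s ∈ ellipticGraph d σ) →
      ∃ (G : ℝ → L2Vec d σ) (D : ℝ → L2Mat d (2 + σ)), AEStronglyMeasurable G μ ∧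
        AEStronglyMeasurable D μ ∧ (∀ᵐ s ∂μ, G s =ᵐ[volume.restrict (openHalf d)] (t s).1.2) ∧
        (∀ᵐ s ∂μ, HasWeakHessian (t s).1.1 (D s)) ∧ (∀ᵐ s ∂μ, ‖G s‖ ≤ C * ‖(t s).2‖) ∧
        ∀ᵐ s ∂μ, ‖D s‖ ≤ C * ‖(t s).2‖ := by
  obtain ⟨C, hC, hreg⟩ := exists_elliptic_regularity hσ
  refine ⟨C, hC, fun d μ t ht htT => ?_⟩
  -- The selection needs a bound by the norm of the whole triple. The sharper bound by the right
  -- hand side alone is recovered at the end from uniqueness.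
  have hle : ∀ p : (L2 d σ × L2Vec d (1 + σ)) × L2 d σ, C * ‖p.2‖ ≤ C * ‖p‖ := fun p => by
    gcongr
    exact norm_snd_le p
  have huG : ∀ (p : (L2 d σ × L2Vec d (1 + σ)) × L2 d σ) (z w : L2Vec d σ),
      z =ᵐ[volume.restrict (openHalf d)] p.1.2 → w =ᵐ[volume.restrict (openHalf d)] p.1.2 →
      z = w := fun p z w hz hw => Lp.ext (mu_absolutelyContinuous σ (hz.trans hw.symm))
  have huD : ∀ (p : (L2 d σ × L2Vec d (1 + σ)) × L2 d σ) (z w : L2Mat d (2 + σ)),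
      HasWeakHessian p.1.1 z → HasWeakHessian p.1.1 w → z = w := fun p z w hz hw =>
    Lp.ext (mu_absolutelyContinuous _ (hz.ae_eq hw))
  obtain ⟨G, hGm, hG⟩ := exists_aestronglyMeasurable_of_relation (T := ellipticGraph d σ)
    (R := fun (p : (L2 d σ × L2Vec d (1 + σ)) × L2 d σ) (z : L2Vec d σ) =>
      z =ᵐ[volume.restrict (openHalf d)] p.1.2)
    (fun p q z w hz hw => EventuallyEq.trans (absolutelyContinuous_mu σ (Lp.coeFn_add z w))
      ((hz.add hw).trans (absolutelyContinuous_mu (1 + σ) (Lp.coeFn_add p.1.2 q.1.2).symm)))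
    (fun c p z hz => EventuallyEq.trans (absolutelyContinuous_mu σ (Lp.coeFn_smul c z))
      ((hz.const_smul c).trans (absolutelyContinuous_mu (1 + σ) (Lp.coeFn_smul c p.1.2).symm)))
    huG (C := C)
    (fun p hp => (hreg d p hp).1.imp fun z hz => ⟨hz.1, hz.2.trans (hle p)⟩) ht htT
  obtain ⟨D, hDm, hD⟩ := exists_aestronglyMeasurable_of_relation (T := ellipticGraph d σ)
    (R := fun (p : (L2 d σ × L2Vec d (1 + σ)) × L2 d σ) (z : L2Mat d (2 + σ)) =>
      HasWeakHessian p.1.1 z)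
    (fun p q z w hz hw => (hz.add hw).congr
      (absolutelyContinuous_mu σ (Lp.coeFn_add p.1.1 q.1.1).symm)
      (absolutelyContinuous_mu _ (Lp.coeFn_add z w).symm))
    (fun c p z hz => (hz.const_smul c).congr
      (absolutelyContinuous_mu σ (Lp.coeFn_smul c p.1.1).symm)
      (absolutelyContinuous_mu _ (Lp.coeFn_smul c z).symm))
    huD (C := C)
    (fun p hp => (hreg d p hp).2.imp fun z hz => ⟨hz.1, hz.2.trans (hle p)⟩) ht htT
  refine ⟨G, D, hGm, hDm, hG, hD, ?_, ?_⟩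
  · filter_upwards [hG, htT] with s hs hsT
    obtain ⟨z, hz, hzC⟩ := (hreg d _ hsT).1
    rwa [huG _ _ _ hs hz]
  · filter_upwards [hD, htT] with s hs hsT
    obtain ⟨z, hz, hzC⟩ := (hreg d _ hsT).2
    rwa [huD _ _ _ hs hz]

end HalfSpace

/-! ### From solutions on `I` to the evolution equation for all times before `s₂` -/

namespace HalfSpace

variable {d : ℕ} {σ : ℝ} {s₁ s₂ : EReal}

lemma isOpen_timeI (s₁ s₂ : EReal) : IsOpen (timeI s₁ s₂) :=
  (isOpen_lt continuous_const continuous_coe_real_ereal).inter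
    (isOpen_lt continuous_coe_real_ereal continuous_const)

/-- The times before `s₂`. -/
def timeBefore (s₂ : EReal) : Set ℝ := {s | (s : EReal) < s₂}

lemma isOpen_timeBefore (s₂ : EReal) : IsOpen (timeBefore s₂) :=
  isOpen_lt continuous_coe_real_ereal continuous_const

lemma timeI_subset_timeBefore (s₁ s₂ : EReal) : timeI s₁ s₂ ⊆ timeBefore s₂ := fun _ hs => hs.2

lemma mem_closure_timeBefore {s : ℝ} (hs : (s : EReal) ≤ s₂) : s ∈ closure (timeBefore s₂) := by
  have h : Iio s ⊆ timeBefore s₂ := fun r hr =>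
    lt_of_lt_of_le (EReal.coe_lt_coe_iff.2 hr) hs
  refine closure_mono h ?_
  rw [closure_Iio]
  exact self_mem_Iic

lemma timeIclosed_subset_closure : timeIclosed s₁ s₂ ⊆ closure (timeBefore s₂) :=
  fun _ hs => mem_closure_timeBefore hs.2

/-- The support of `ψ` may extend to times before `s₁`. Test functions are judged only on the times
from `s₁` on, where intersecting with closed conditions keeps the support compact. -/
lemma isTestOn_mul {ψ : ℝ → ℝ} {ζ : E d → ℝ} (hψ : ContDiff ℝ ∞ ψ) (hψc : HasCompactSupport ψ)
    (hψs : tsupport ψ ⊆ timeBefore s₂) (hζ : ContDiff ℝ ∞ ζ) (hζc : HasCompactSupport ζ) :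
    IsTestOn (timeIleft s₁ s₂ ×ˢ closedHalf d) fun x : ℝ × E d => ψ x.1 * ζ x.2 := by
  have hc1 : IsClosed {s : ℝ | s₁ ≤ (s : EReal)} :=
    isClosed_le continuous_const continuous_coe_real_ereal
  have hc2 : IsClosed (closedHalf d) := isClosed_le continuous_const (by fun_prop)
  refine ⟨(hψ.comp contDiff_fst).mul (hζ.comp contDiff_snd), ?_,
    (tsupport ψ ∩ {s | s₁ ≤ (s : EReal)}) ×ˢ (tsupport ζ ∩ closedHalf d), ?_,
    (hψc.isCompact.inter_right hc1).prod (hζc.isCompact.inter_right hc2), ?_⟩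
  · refine HasCompactSupport.intro (hψc.isCompact.prod hζc.isCompact) fun x hx => ?_
    by_cases h : x.1 ∈ tsupport ψ
    · rw [image_eq_zero_of_notMem_tsupport fun h' => hx ⟨h, h'⟩, mul_zero]
    · rw [image_eq_zero_of_notMem_tsupport h, zero_mul]
  · rintro ⟨s, y⟩ ⟨⟨hs1, hs2⟩, -, hy⟩
    exact ⟨⟨hs2, hψs hs1⟩, hy⟩
  · rintro ⟨s, y⟩ ⟨⟨hs1, -⟩, hy⟩ hx
    simp only
    by_cases h : s ∈ tsupport ψ
    · rw [image_eq_zero_of_notMem_tsupport fun h' => hx ⟨⟨h, hs1⟩, h', hy⟩, mul_zero]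
    · rw [image_eq_zero_of_notMem_tsupport h, zero_mul]

lemma IsSigmaSolution.integrableOn {f u : ℝ → L2 d σ} {u₀ : L2 d σ}
    (h : IsSigmaSolution s₁ s₂ f u u₀) {K : Set ℝ} (hK : IsCompact K)
    (hKs : K ⊆ timeIleft s₁ s₂) : IntegrableOn u K := by
  have : IsFiniteMeasure (volume.restrict K) := ⟨by
    rw [Measure.restrict_apply_univ]; exact hK.measure_lt_top⟩
  exact (h.2.1 K hKs hK).integrable (by norm_num)

/-- A finite left end point belongs to `timeIleft`, so `u` is integrable up to it and the extension
by zero is locally integrable across `s₁`. -/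
lemma IsSigmaSolution.locallyIntegrable {f u : ℝ → L2 d σ} {u₀ : L2 d σ}
    (h : IsSigmaSolution s₁ s₂ f u u₀) {b : ℝ} (hb : b ∈ timeBefore s₂) :
    LocallyIntegrable ((Iic b).indicator ((timeI s₁ s₂).indicator u)) := by
  rw [locallyIntegrable_iff]
  intro K hK
  have hc1 : IsClosed {s : ℝ | s₁ ≤ (s : EReal)} :=
    isClosed_le continuous_const continuous_coe_real_ereal
  have h1 : IntegrableOn u (K ∩ (Iic b ∩ {s : ℝ | s₁ ≤ (s : EReal)})) :=
    h.integrableOn (hK.inter_right (isClosed_Iic.inter hc1)) fun s hs =>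
      ⟨hs.2.2, lt_of_le_of_lt (EReal.coe_le_coe_iff.2 hs.2.1) hb⟩
  rw [indicator_indicator,
    integrableOn_indicator_iff (measurableSet_Iic.inter (isOpen_timeI s₁ s₂).measurableSet)]
  exact h1.mono_set fun s hs => ⟨hs.2, hs.1.1, le_of_lt hs.1.2.1⟩

/-- The equation for products of a function of time and a function of space. -/
lemma weak_mul {f u : ℝ → L2 d σ} {G : ℝ → L2Vec d (1 + σ)}
    (h : ∀ φ : ℝ × E d → ℝ, IsTestOn (timeIleft s₁ s₂ ×ˢ closedHalf d) φ →
      - (∫ s in timeI s₁ s₂, ∫ y, u s y * deriv (fun τ => φ (τ, y)) s ∂(mu d σ))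
        + (∫ s in timeI s₁ s₂,
            ∫ y, fderiv ℝ (fun z => φ (s, z)) y (G s y) ∂(mu d (1 + σ)))
      = (∫ s in timeI s₁ s₂, ∫ y, f s y * φ (s, y) ∂(mu d σ))
        + ∫ y, (0 : L2 d σ) y * φ (s₁.toReal, y) ∂(mu d σ))
    {p : L2 d σ × L2Vec d (1 + σ)} (hp : p ∈ smoothGraph d σ) {ψ : ℝ → ℝ} (hψ : ContDiff ℝ ∞ ψ)
    (hψc : HasCompactSupport ψ) (hψs : tsupport ψ ⊆ timeBefore s₂) :
    -(∫ s in timeI s₁ s₂, deriv ψ s * inner ℝ (u s) p.1)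
      + ∫ s in timeI s₁ s₂, ψ s * inner ℝ (G s) p.2
      = ∫ s in timeI s₁ s₂, ψ s * inner ℝ (f s) p.1 := by
  obtain ⟨ζ, hζ, hζc, h1, h2⟩ := hp
  have key := h _ (isTestOn_mul (s₁ := s₁) hψ hψc hψs hζ hζc)
  have e0 : ∫ y, (0 : L2 d σ) y * (ψ s₁.toReal * ζ y) ∂(mu d σ) = 0 := by
    refine integral_eq_zero_of_ae ?_
    filter_upwards [Lp.coeFn_zero ℝ 2 (mu d σ)] with y hy
    rw [hy, Pi.zero_apply, zero_mul]
  have e1 : ∀ (v : L2 d σ) (c : ℝ), ∫ y, v y * (c * ζ y) ∂(mu d σ) = c * inner ℝ v p.1 := by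
    intro v c
    rw [L2.inner_def, ← integral_const_mul]
    refine integral_congr_ae ?_
    filter_upwards [h1] with y hy
    simp only [hy, RCLike.inner_apply, conj_trivial]
    ring
  have e2 : ∀ (s : ℝ) (F : L2Vec d (1 + σ)),
      ∫ y, fderiv ℝ (fun z => ψ s * ζ z) y (F y) ∂(mu d (1 + σ)) = ψ s * inner ℝ F p.2 := by
    intro s F
    rw [L2.inner_def, ← integral_const_mul]
    refine integral_congr_ae ?_
    filter_upwards [h2] with y hy
    rw [hy, fderiv_const_mul (hζ.differentiable (by simp) y), ← real_inner_comm,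
      ← fderiv_apply_eq_inner]
    simp
  have e3 : ∀ s y, deriv (fun τ => ψ τ * ζ y) s = deriv ψ s * ζ y := fun s y =>
    deriv_mul_const (hψ.differentiable (by simp) s) _
  simp only [e0, e1, e2, e3, add_zero] at key
  exact key

lemma integral_mul_inner_indicator {I : Set ℝ} (hI : MeasurableSet I) {X : Type*}
    [NormedAddCommGroup X] [InnerProductSpace ℝ X] (a : ℝ → ℝ) (F : ℝ → X) (p : X) :
    ∫ s, a s * inner ℝ (I.indicator F s) p = ∫ s in I, a s * inner ℝ (F s) p := by
  rw [← integral_indicator hI]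
  congr 1
  ext s
  by_cases hs : s ∈ I <;> simp [hs]

/-- A solution with zero initial value, extended by zero, solves an evolution equation for all
times before `s₂`. -/
lemma isWeakEvolution (hσ : -1 < σ) (h12 : s₁ < s₂) {f f₀ u : ℝ → L2 d σ}
    {G : ℝ → L2Vec d (1 + σ)} (hsol : IsSigmaSolution s₁ s₂ f u 0)
    (hf : MemLp f 2 (volume.restrict (timeI s₁ s₂))) (hf₀ : StronglyMeasurable f₀)
    (hff₀ : f =ᵐ[volume.restrict (timeI s₁ s₂)] f₀)
    (hG : MemLp G 2 (volume.restrict (timeI s₁ s₂)))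
    (huG : ∀ᵐ s ∂(volume.restrict (timeI s₁ s₂)), HasWeakGradient (u s) (G s))
    (h : ∀ φ : ℝ × E d → ℝ, IsTestOn (timeIleft s₁ s₂ ×ˢ closedHalf d) φ →
      - (∫ s in timeI s₁ s₂, ∫ y, u s y * deriv (fun τ => φ (τ, y)) s ∂(mu d σ))
        + (∫ s in timeI s₁ s₂,
            ∫ y, fderiv ℝ (fun z => φ (s, z)) y (G s y) ∂(mu d (1 + σ)))
      = (∫ s in timeI s₁ s₂, ∫ y, f s y * φ (s, y) ∂(mu d σ))
        + ∫ y, (0 : L2 d σ) y * φ (s₁.toReal, y) ∂(mu d σ)) :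
    IsWeakEvolution (timeBefore s₂) (gradGraph d σ) ((timeI s₁ s₂).indicator u)
      ((timeI s₁ s₂).indicator G) ((timeI s₁ s₂).indicator f₀) where
  isOpen := isOpen_timeBefore s₂
  isLowerSet := fun _ _ hba ha => lt_of_le_of_lt (EReal.coe_le_coe_iff.2 hba) ha
  nonempty := by
    obtain ⟨r, -, hr⟩ := EReal.lt_iff_exists_real_btwn.1 h12
    exact ⟨r, hr⟩
  isClosed := isClosed_gradGraph hσ
  locallyIntegrable := fun _ hb => hsol.locallyIntegrable hb
  memLp_grad := (memLp_indicator_iff_restrict (isOpen_timeI s₁ s₂).measurableSet).2 hG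
  memLp_rhs := (memLp_indicator_iff_restrict (isOpen_timeI s₁ s₂).measurableSet).2
    (hf.ae_eq hff₀)
  stronglyMeasurable_rhs := hf₀.indicator (isOpen_timeI s₁ s₂).measurableSet
  mem := by
    filter_upwards [(ae_restrict_iff' (isOpen_timeI s₁ s₂).measurableSet).1 huG] with s hs
    by_cases hsI : s ∈ timeI s₁ s₂
    · rw [indicator_of_mem hsI, indicator_of_mem hsI]
      exact hs hsI
    · rw [indicator_of_notMem hsI, indicator_of_notMem hsI]
      exact zero_mem (gradGraph d σ)
  weak := by
    -- `ψ` need not vanish at `s₁`: the initial term is absent because the initial value is zero.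
    -- This is what allows the extension by zero.
    refine ⟨smoothGraph d σ, gradGraph_subset_closure hσ, fun p hp ψ hψ hψc hψs => ?_⟩
    have hI := (isOpen_timeI s₁ s₂).measurableSet
    rw [integral_mul_inner_indicator hI, integral_mul_inner_indicator hI,
      integral_mul_inner_indicator hI, weak_mul h hp hψ hψc hψs]
    refine integral_congr_ae ?_
    filter_upwards [hff₀] with s hs
    rw [hs]

/-- The norm of a function of time, set to zero at infinite times. -/
noncomputable def normAt {Y : Type*} [NormedAddCommGroup Y] (G : ℝ → Y) (x : EReal) : ℝ :=
  if x = ⊥ ∨ x = ⊤ then 0 else ‖G x.toReal‖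

lemma normAt_coe {Y : Type*} [NormedAddCommGroup Y] (G : ℝ → Y) (s : ℝ) :
    normAt G s = ‖G s‖ := by
  simp [normAt]

/-- At infinite end points the assigned value zero is the limit of the norm. At finite points the
reals are openly embedded in `EReal`, so continuity in time carries over. -/
lemma continuousOn_normAt {Y : Type*} [NormedAddCommGroup Y] {G : ℝ → Y}
    (hG : ContinuousOn G (timeIclosed s₁ s₂)) (hbot : Tendsto G atBot (𝓝 0))
    (htop : s₂ = ⊤ → Tendsto G atTop (𝓝 0)) : ContinuousOn (normAt G) (Icc s₁ s₂) := by
  intro x hx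
  induction x with
  | bot =>
    have h0 : normAt G ⊥ = 0 := by simp [normAt]
    rw [ContinuousWithinAt, h0]
    refine Tendsto.mono_left ?_ nhdsWithin_le_nhds
    rw [Metric.tendsto_nhds]
    intro ε hε
    obtain ⟨M, hM⟩ := eventually_atBot.1 (Metric.tendsto_nhds.1 hbot ε hε)
    filter_upwards [Iio_mem_nhds (EReal.bot_lt_coe M)] with x hx
    induction x with
    | bot => simpa [h0] using hε
    | top => exact absurd hx (by simp)
    | coe r =>
      have := hM r (EReal.coe_lt_coe_iff.1 hx).le
      simpa [normAt_coe] using this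
  | top =>
    have h0 : normAt G ⊤ = 0 := by simp [normAt]
    rw [ContinuousWithinAt, h0]
    refine Tendsto.mono_left ?_ nhdsWithin_le_nhds
    rw [Metric.tendsto_nhds]
    intro ε hε
    obtain ⟨M, hM⟩ := eventually_atTop.1
      (Metric.tendsto_nhds.1 (htop (top_le_iff.1 hx.2)) ε hε)
    filter_upwards [Ioi_mem_nhds (EReal.coe_lt_top M)] with x hx
    induction x with
    | bot => exact absurd hx (by simp)
    | top => simpa [h0] using hε
    | coe r =>
      have := hM r (EReal.coe_lt_coe_iff.1 hx).le
      simpa [normAt_coe] using this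
  | coe s =>
    have h1 : ContinuousWithinAt (fun r : ℝ => normAt G r) (Real.toEReal ⁻¹' Icc s₁ s₂) s := by
      simp only [normAt_coe]
      exact (hG s hx).norm
    rw [ContinuousWithinAt, ← EReal.isOpenEmbedding_coe.map_nhdsWithin_preimage_eq,
      tendsto_map'_iff]
    exact h1

end HalfSpace

/-! ### Integrated bounds in time and the conclusion -/

lemma integral_norm_sq_le_of_eLpNorm_le {α β B B' : Type*} [MeasurableSpace α] [MeasurableSpace β]
    {μ : Measure α} {ν : Measure β} [NormedAddCommGroup B] [NormedAddCommGroup B'] {F : α → B}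
    {F' : β → B'} (hF : MemLp F 2 μ) (hF' : MemLp F' 2 ν)
    (h : eLpNorm F 2 μ ≤ eLpNorm F' 2 ν) : ∫ x, ‖F x‖ ^ 2 ∂μ ≤ ∫ x, ‖F' x‖ ^ 2 ∂ν := by
  have h1 := pow_le_pow_left' h 2
  rwa [eLpNorm_two_sq, eLpNorm_two_sq, hF.lintegral_enorm_sq_eq, hF'.lintegral_enorm_sq_eq,
    ENNReal.ofReal_le_ofReal_iff (integral_nonneg fun x => sq_nonneg _)] at h1

lemma integral_norm_sq_le_of_norm_le {α B X : Type*} [MeasurableSpace α] {μ : Measure α}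
    [NormedAddCommGroup B] [NormedAddCommGroup X] {Z : α → B} {f V : α → X} {C : ℝ}
    (hf : MemLp f 2 μ) (hV : MemLp V 2 μ) (hZm : AEStronglyMeasurable Z μ)
    (hZ : ∀ᵐ s ∂μ, ‖Z s‖ ≤ C * ‖f s - V s‖) :
    MemLp Z 2 μ ∧ ∫ s, ‖Z s‖ ^ 2 ∂μ ≤ C ^ 2 * (2 * (∫ s, ‖f s‖ ^ 2 ∂μ) + 2 * ∫ s, ‖V s‖ ^ 2 ∂μ) := by
  have hZ2 : MemLp Z 2 μ := (hf.sub hV).of_le_mul hZm hZ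
  refine ⟨hZ2, ?_⟩
  have h1 := hf.integrable_norm_pow two_ne_zero
  have h2 := hV.integrable_norm_pow two_ne_zero
  rw [← integral_const_mul, ← integral_const_mul, ← integral_add (h1.const_mul 2) (h2.const_mul 2),
    ← integral_const_mul]
  refine integral_mono_ae (hZ2.integrable_norm_pow two_ne_zero)
    (((h1.const_mul 2).add (h2.const_mul 2)).const_mul _) ?_
  filter_upwards [hZ] with s hs
  calc ‖Z s‖ ^ 2 ≤ (C * ‖f s - V s‖) ^ 2 := by gcongr
    _ = C ^ 2 * ‖f s - V s‖ ^ 2 := mul_pow _ _ _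
    _ ≤ C ^ 2 * (‖f s‖ + ‖V s‖) ^ 2 := by
        gcongr
        exact norm_sub_le _ _
    _ ≤ C ^ 2 * (2 * ‖f s‖ ^ 2 + 2 * ‖V s‖ ^ 2) := by
        gcongr
        nlinarith [sq_nonneg (‖f s‖ - ‖V s‖)]

theorem proposition3p2 (d : ℕ) (σ : ℝ) (hσ : -1 < σ) :
    ∃ c : ℝ, 0 < c ∧
      ∀ (s₁ s₂ : EReal), s₁ < s₂ →
      ∀ (f u : ℝ → L2 d σ),
        MemLp f 2 (volume.restrict (timeI s₁ s₂)) →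
        IsSigmaSolution s₁ s₂ f u 0 →
        -- the gradient of the continuous representative of `u`, at every time
        (∃ (U : ℝ → L2 d σ) (G : ℝ → L2Vec d (1 + σ)) (N : EReal → ℝ),
          (∀ᵐ s ∂(volume.restrict (timeI s₁ s₂)), U s = u s) ∧
          ContinuousOn U (timeIclosed s₁ s₂) ∧
          (∀ s ∈ timeIclosed s₁ s₂, HasWeakGradient (U s) (G s)) ∧
          (∀ s ∈ timeIclosed s₁ s₂, N s = ‖G s‖) ∧
          ContinuousOn N (Icc s₁ s₂) ∧
          (∃ B : ℝ, ∀ s ∈ Icc s₁ s₂, |N s| ≤ B) ∧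
          N s₁ = 0) ∧
        -- the weighted estimate
        (∃ (V : ℝ → L2 d σ) (G : ℝ → L2Vec d σ) (D : ℝ → L2Mat d (2 + σ)),
          HasWeakTimeDeriv s₁ s₂ u V ∧
          (∀ᵐ s ∂(volume.restrict (timeI s₁ s₂)), HasWeakGradient (u s) (G s)) ∧
          (∀ᵐ s ∂(volume.restrict (timeI s₁ s₂)), HasWeakHessian (u s) (D s)) ∧
          MemLp V 2 (volume.restrict (timeI s₁ s₂)) ∧
          MemLp G 2 (volume.restrict (timeI s₁ s₂)) ∧
          MemLp D 2 (volume.restrict (timeI s₁ s₂)) ∧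
          (∫ s in timeI s₁ s₂, ‖V s‖ ^ 2) + (∫ s in timeI s₁ s₂, ‖G s‖ ^ 2)
              + (∫ s in timeI s₁ s₂, ‖D s‖ ^ 2)
            ≤ c * ∫ s in timeI s₁ s₂, ‖f s‖ ^ 2) := by
  obtain ⟨C, hC, hreg⟩ := exists_elliptic_regularity_family hσ
  -- The time derivative contributes `1`. Gradient and Hessian are at most `C ‖f - V‖`, which
  -- contributes `C ^ 2 * (2 + 2)` each.
  refine ⟨1 + 8 * C ^ 2, by positivity, fun s₁ s₂ h12 f u hf hsol => ?_⟩
  obtain ⟨G₀, hG₀, huG, heq⟩ := hsol.2.2.2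
  set I := timeI s₁ s₂ with hI
  set J := timeBefore s₂ with hJ
  have hIo : IsOpen I := isOpen_timeI s₁ s₂
  have hIm := hIo.measurableSet
  have hJm : MeasurableSet J := (isOpen_timeBefore s₂).measurableSet
  have hIJ : I ⊆ J := timeI_subset_timeBefore s₁ s₂
  have hIcl : I ⊆ closure J := hIJ.trans subset_closure
  have hres : ∀ {P : ℝ → Prop}, (∀ᵐ s ∂volume.restrict J, P s) → ∀ᵐ s ∂volume.restrict I, P s :=
    fun h => ae_mono (Measure.restrict_mono hIJ le_rfl) h
  obtain ⟨V, U, G', hV, hVle, hUu, hUc, hGG, hGc, hUG, hder, hell, hbot, htop, hzero⟩ :=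
    (isWeakEvolution hσ h12 hsol hf hf.1.stronglyMeasurable_mk hf.1.ae_eq_mk hG₀ huG
      heq).maximal_regularity
  have hind : ∀ {X : Type _} {F F' : ℝ → X} [Zero X],
      (∀ᵐ s ∂volume.restrict J, F s = I.indicator F' s) →
      ∀ᵐ s ∂volume.restrict I, F s = F' s := by
    intro X F F' _ h
    filter_upwards [hres h, ae_restrict_mem hIm] with s hs hsI
    rw [hs, indicator_of_mem hsI]
  have hUu' := hind hUu
  have hGG' := hind hGG
  have hVI : MemLp V 2 (volume.restrict I) := hV.mono_measure (Measure.restrict_mono hIJ le_rfl)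
  have hVf : ∫ s in I, ‖V s‖ ^ 2 ≤ ∫ s in I, ‖f s‖ ^ 2 := by
    refine integral_norm_sq_le_of_eLpNorm_le hVI hf ?_
    refine (eLpNorm_mono_measure V (Measure.restrict_mono hIJ le_rfl)).trans (hVle.trans ?_)
    rw [eLpNorm_indicator_eq_eLpNorm_restrict hIm]
    exact (eLpNorm_congr_ae hf.1.ae_eq_mk.symm).le
  refine ⟨⟨U, G', normAt G', hUu', hUc.mono timeIclosed_subset_closure,
    fun s hs => hUG s (timeIclosed_subset_closure hs), fun s _ => normAt_coe G' s, ?_⟩, ?_⟩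
  · have hN : ContinuousOn (normAt G') (Icc s₁ s₂) := by
      refine continuousOn_normAt (hGc.mono timeIclosed_subset_closure) hbot fun hs₂ => htop ?_
      rw [hs₂]
      exact eq_univ_of_forall fun s => EReal.coe_lt_top s
    refine ⟨hN, isCompact_Icc.exists_bound_of_continuousOn hN, ?_⟩
    -- At `-∞` the value is zero by definition; at a finite `s₁` the extended gradient vanishes at
    -- all earlier times.
    induction s₁ with
    | bot => simp [normAt]
    | top => exact absurd h12 (by simp)
    | coe s =>
      rw [normAt_coe, hzero s (mem_closure_timeBefore h12.le), norm_zero]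
      intro τ hτ
      exact indicator_of_notMem (fun h => lt_asymm hτ (EReal.coe_lt_coe_iff.1 h.1)) _
  · have hum : AEStronglyMeasurable u (volume.restrict I) :=
      ((hUc.mono hIcl).aestronglyMeasurable hIm).congr hUu'
    -- At almost every time `u s` solves the elliptic equation with right hand side `f s - V s`.
    obtain ⟨G, D, hGm, hDm, hGe, hDe, hGle, hDle⟩ := hreg d (volume.restrict I)
      (fun s => ((u s, G₀ s), f s - V s)) ((hum.prodMk hG₀.1).prodMk (hf.1.sub hVI.1)) (by
        filter_upwards [huG, hGG', hres hell, hf.1.ae_eq_mk, ae_restrict_mem hIm]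
          with s h1 h2 h3 h4 hsI
        refine ⟨h1, fun p hp => ?_⟩
        have h5 := h3 p hp
        rw [indicator_of_mem hsI, ← h4, h2] at h5
        rw [inner_sub_left, ← h5]
        ring)
    obtain ⟨hG2, hGb⟩ := integral_norm_sq_le_of_norm_le hf hVI hGm hGle
    obtain ⟨hD2, hDb⟩ := integral_norm_sq_le_of_norm_le hf hVI hDm hDle
    refine ⟨V, G, D, ⟨?_, ?_, fun ψ hψ hψc hψs => ?_⟩, ?_, hDe, hVI, hG2, hD2, ?_⟩
    · rw [locallyIntegrableOn_iff hIo.isLocallyClosed]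
      exact fun K hKI hK => hsol.integrableOn hK fun s hs => ⟨(hKI hs).1.le, (hKI hs).2⟩
    · rw [locallyIntegrableOn_iff hIo.isLocallyClosed]
      intro K hKI hK
      have : IsFiniteMeasure (volume.restrict K) := ⟨by
        rw [Measure.restrict_apply_univ]; exact hK.measure_lt_top⟩
      exact (hVI.mono_measure (Measure.restrict_mono hKI le_rfl)).integrable (by norm_num)
    · have h1 := hder ψ hψ hψc (hψs.trans hIJ)
      have h2 : ∀ (a : ℝ → ℝ) (F : ℝ → L2 d σ), tsupport a ⊆ I →
          ∫ s in J, a s • F s = ∫ s in I, a s • F s := fun a F ha =>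
        (setIntegral_eq_of_subset_of_forall_sdiff_eq_zero hJm hIJ fun s hs => by
          rw [image_eq_zero_of_notMem_tsupport fun h => hs.2 (ha h), zero_smul])
      have h3 : tsupport (deriv ψ) ⊆ I := (tsupport_deriv_subset (f := ψ)).trans hψs
      rw [h2 _ _ h3, h2 _ _ hψs] at h1
      rw [← h1]
      refine integral_congr_ae ?_
      filter_upwards [hUu'] with s hs
      rw [hs]
    · filter_upwards [huG, hGe] with s h1 h2
      exact h1.congr EventuallyEq.rfl h2.symm
    · have h0 : 0 ≤ C ^ 2 := sq_nonneg C
      nlinarith [mul_le_mul_of_nonneg_left hVf h0]
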